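/- **Setting.** Let $K$ be a field and $A=K[a_1,\dots,a_n]$ a solvable polynomial algebra with a graded monomial ordering: the standard monomials $a^\alpha=a_1^{\alpha_1}\cdots a_n^{\alpha_n}$, $\alpha\in\mathbb N^n$, form a $K$-basis $\mathcal B$ of $A$; $\prec$ is a well-ordering of $\mathcal B$ such that * if $a^\gamma\ne 1$, $a^\beta\neq a^\gamma$ and $a^\gamma=\mathrm{LM}(a^\alpha a^\beta a^\eta)$, then $a^\beta\prec a^\gamma$; * if $a^\alpha\prec a^\beta$, $\mathrm{LM}(a^\gamma a^\alpha a^\eta)\neq 0$ and $\mathrm{LM}(a^\gamma a^\beta a^\eta)\notin\{0,1\}$, then $\mathrm{LM}(a^\gamma a^\alpha a^\eta)\prec \mathrm{LM}(a^\gamma a^\beta a^\eta)$; for all $\alpha,\beta$ one has $a^\alpha a^\beta=\lambda a^{\alpha+\beta}+f$ with $\lambda\in K^*$ and $f=0$ or $\mathrm{LM}(f)\prec a^{\alpha+\beta}$; and for some weights $w_i>0$ and $d(a^\alpha)=\sum_i w_i\alpha_i$, $a^\alpha\prec a^\beta$ implies $d(a^\alpha)\le d(a^\beta)$. Here $\mathrm{LM}$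 and $\mathrm{LC}$ denote leading monomial and leading coefficient. Let $F_pA$ be the $K$-span of the $a^\alpha$ with $d(a^\alpha)\le p$. A filtered free module $L=\bigoplus_i Ae_i$ of finite rank with degrees $b_i\in\mathbb N$ has the filtration $F_qL=K\text{-span}\{a^\alpha e_i: d(a^\alpha)+b_i\le q\}$; $d_{\rm fil}(\xi)$ is the least $q$ with $\xi\in F_qL$. Submodules $N\subseteq M$ and quotients carry the induced filtrations $N\cap F_qM$ and $(F_qM+N)/N$. A homomorphism $\varphi:M\to M'$ of filtered modules is a strict filtered homomorphism if $\varphi(F_qM)=\varphi(M)\cap F_qM'$ for all $q$. A finite set of nonzero elements $v_k$ of $M$ is an F-basis of $M$ if there are $n_k\in\mathbb N$ with $F_qM=\sum_k\sum_{p+n_k\le q}F_pA\,v_k$ for all $q$, and a minimal F-basis if moreover no proper subset is an F-basis. A (minimal) standard basis of a submodule $N$ is a (minimal) F-basis of $N$ with the induced filtration. A minimal filtered free resolution of a filtered module $M$ is an exact sequence $\cdots\to L_2\xrightarrow{\varphi_2}L_1\xrightarrow{\varphi_1}L_0\xrightarrow{\varphi_0}M\to0$ of strict filtered homomorphisms,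 where the $L_i$ are filtered free of finite rank, such that $\varphi_0$ maps the basis of $L_0$ to a minimal F-basis of $M$ and $\varphi_i$ maps the basis of $L_i$ to a minimal standard basis of $\ker\varphi_{i-1}$ for $i\ge1$. It has length at most $d$ if $L_i=0$ for $i>d$. A graded left monomial ordering on the basis $\mathcal B(e)=\{a^\alpha e_i\}$ of $L$ is a total ordering such that $a^\alpha e_i\prec a^\beta e_j$ implies $\mathrm{LM}(a^\gamma a^\alpha e_i)\prec\mathrm{LM}(a^\gamma a^\beta e_j)$ and $d(a^\alpha)+b_i\le d(a^\beta)+b_j$, and $a^\alpha\prec a^\beta$ implies $a^\alpha e_i\prec a^\beta e_i$. A left Gröbner basis of a submodule $N$ is a finite set of nonzero elements of $N$ such that the leading monomial of every nonzero element of $N$ is $\mathrm{LM}(a^\gamma\mathrm{LM}(g))$ for some member $g$ and some $\gamma$. **Algorithms.** *Division* of $\omega$ by a list $\Xi$: as long as $\omega\ne0$, if $\mathrm{LM}(\omega)$ is divisible by the leading monomial of a member of $\Xi$, take the first such member $\xi$ and the $\alpha$ with $\mathrm{LM}(a^\alpha\xi)=\mathrm{LM}(\omega)$, and subtract $\mathrm{LC}(a^\alpha\xi)^{-1}\mathrm{LC}(\omega)a^\alpha\xi$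 from $\omega$; otherwise move the leading term of $\omega$ to the remainder. *S-polynomial* of $\xi,\zeta$ with leading monomials $a^\alpha e_i$, $a^\beta e_i$, $\gamma=\max(\alpha,\beta)$: $\mathrm{LC}(a^{\gamma-\alpha}\xi)^{-1}a^{\gamma-\alpha}\xi-\mathrm{LC}(a^{\gamma-\beta}\zeta)^{-1}a^{\gamma-\beta}\zeta$ (and $0$ if the leading monomials involve different basis vectors). * *Algorithm GB.* As long as there are untreated pairs of generators with nonzero S-polynomial, choose one, divide its S-polynomial by the current list, and append the remainder if it is nonzero; with each generator keep the row of its coefficients in terms of the given elements. * *Algorithm MINHGS*, for a list of homogeneous elements of the associated graded module $G(L)$ over $G(A)$: degree by degree, in increasing order, first treat the S-polynomials of that degree (divide by the current list, append a nonzero remainder), then the given elements of that degree (divide by the current list; if the remainder is nonzero, append it and select the given element). Continue until no S-polynomials and no given elements are left; the output consists of the selected elements. * *Algorithm MINSB*, for a list of generators of a submodule $N$: compute a left Gröbner basis $\mathcal G$ by Algorithm GB, apply Algorithm MINHGS to the principal symbols of its members, and output the members of $\mathcal G$ whose symbols have been selected. * *Algorithm MINFB*, for a list $V$ of elements of $L_0=\bigoplus_{i\in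 E_0}Ae_i$: as long as some $v\in V$ has a component $f_i\in K^*$ with $b_i=d_{\rm fil}(v)$, take such a $v$ and the least such $i$, replace every other $u=\sum_k u_ke_k$ in $V$ by $u-f_i^{-1}u_iv$, discard zeros, and discard $v$ and the basis vector $e_i$. * *Syzygies* of a list $W$: from a left Gröbner basis $\mathcal G$ of the module generated by $W$, computed from $W$ by Algorithm GB, with the matrix $V$ such that $\mathcal G=VW$: divide the members of $W$ by $\mathcal G$, $W=Q\mathcal G$, divide the S-polynomials of $\mathcal G$, which gives a matrix $\mathcal S$ of syzygies of $\mathcal G$, and output the nonzero rows of $\mathcal SV$ and of $QV-E$, where $E$ is the identity matrix. **Theorem.** Let $L_0=\bigoplus_{i=1}^m Ae_i$ be a filtered free $A$-module of finite rank with degrees $b_i\in\mathbb N$, $N$ a submodule of $L_0$, and $M=L_0/N$ with the induced filtration. (a) $M$ has a minimal filtered free resolution of length $d\le n$ whose degree-zero term is the filtered free submodule $L_0'=\bigoplus_{e_i\in E_0'}Ae_i$ of $L_0$ for a subset $E_0'$ of $\{e_1,\dots,e_m\}$, with the map $L_0'\to M$ that sends each $e_i$ to its class. (b) If $N$ is given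 by a finite list $U$ of nonzero generators, such a resolution is constructed by the following procedures. The graded left monomial orderings that they use exist, and for every choice of such orderings and of the other choices left open, all the procedures terminate and have the properties stated. 1. For a graded left monomial ordering on $\mathcal B(e)$, Algorithm GB, applied to $U$, yields a left Gröbner basis $\mathcal G$ of $N$, which is also a standard basis of $N$. 2. Algorithm MINFB, applied to $\mathcal G$, yields a subset $E_0'$ of the basis of $L_0$, with the filtered free submodule $L_0'$ that it spans, and a list $V\subseteq N\cap L_0'$, such that with $N'=\sum_{v\in V}Av$ there is a strict filtered isomorphism $L_0'/N'\cong M$ that sends the class of each $e_i\in E_0'$ to its class $\bar e_i$ in $M$, and such that $\{\bar e_i: e_i\in E_0'\}$ is a minimal F-basis of $M$. Replace $L_0$, $N$, $U$ by $L_0'$, $N'$, $V$. If the list of generators is empty, stop. 3. For a graded left monomial ordering, Algorithm MINSB, applied to the given generators of $N$, yields a minimal standard basis $W=\{\xi_{j_1},\dots,\xi_{j_t}\}$ of $N$. 4. For a graded left monomial ordering, Algorithm GB, applied to $W$, and the computation of syzygies yield a finite set $U_1$ of nonzero generators of the syzygy module $N_1$ of $W$. 5. Let $L_1=\bigoplus_{k=1}^tA\varepsilon_k$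 be the filtered free module with $d_{\rm fil}(\varepsilon_k)=d_{\rm fil}(\xi_{j_k})$, and $\varphi_1(\varepsilon_k)=\xi_{j_k}$, so that $\ker\varphi_1=N_1$. If $N_1\neq0$, repeat Procedures 3–5 with $L_1$, $N_1$, $U_1$ in place of $L_0$, $N$, $U$, and so on. Procedures 3–5 are carried out at most $n$ times, and the sequence of free modules that is obtained is a minimal filtered free resolution of $M$ of length at most $n$. -/

import Mathlib

namespace SolvPoly

noncomputable section

open scoped Classical

/-! ### Solvable polynomial algebras with a graded monomial ordering -/

/-- Exponent vectors `α = (α₁, …, αₙ)`. -/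
abbrev Expo (n : ℕ) := Fin n → ℕ

/-- The standard monomial `a^α = a₁^α₁ ⋯ aₙ^αₙ` (ordered product). -/
def stdMonomial {A : Type*} [Monoid A] {n : ℕ} (a : Fin n → A) (α : Expo n) : A :=
  (List.ofFn fun i => a i ^ α i).prod

/-- `s` indexes the leading monomial of the element with coefficients `c`:
it is the largest index, with respect to `r`, that has a nonzero coefficient. -/
def IsLeading {σ K : Type*} [Zero K] (r : σ → σ → Prop) (c : σ → K) (s : σ) : Prop :=
  c s ≠ 0 ∧ ∀ t, c t ≠ 0 → t = s ∨ r t s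

/-- The leading monomial (`none` if there is none, for instance for the zero element). -/
def leadOpt {σ K : Type*} [Zero K] (r : σ → σ → Prop) (c : σ → K) : Option σ :=
  if h : ∃ s, IsLeading r c s then some h.choose else none

/-- `r` is a strict total ordering. -/
structure IsStrictTotal {σ : Type*} (r : σ → σ → Prop) : Prop where
  irrefl : ∀ s, ¬ r s s
  trans : ∀ s t u, r s t → r t u → r s u
  total : ∀ s t, r s t ∨ s = t ∨ r t s

/-- A solvable polynomial algebra structure on the `K`-algebra `A = K[a₁, …, aₙ]`: generators
with a PBW basis of standard monomials, a monomial ordering `lt` (written `≺`), the solvability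
relation, and a positive-degree function given by the weights `w`, with respect to which
the ordering is graded. -/
structure GradedSolvPolyAlg (K A : Type*) [Field K] [Ring A] [Algebra K A] (n : ℕ) where
  gen : Fin n → A
  basis : Module.Basis (Expo n) K A
  basis_apply : ∀ α, basis α = stdMonomial gen α
  lt : Expo n → Expo n → Prop
  strictTotal : IsStrictTotal lt
  wf : WellFounded lt
  /-- `a^γ ≠ 1`, `a^β ≠ a^γ`, `a^γ = LM(a^α a^β a^η)` imply `a^β ≺ a^γ`. -/
  lt_of_factor : ∀ α β γ η : Expo n, γ ≠ 0 → β ≠ γ →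
    IsLeading lt (basis.repr (basis α * basis β * basis η)) γ → lt β γ
  /-- `a^α ≺ a^β` implies `LM(a^γ a^α a^η) ≺ LM(a^γ a^β a^η)`, provided that the products are
  nonzero and that the second leading monomial is not `1`. -/
  lt_mul : ∀ α β γ η μ ν : Expo n, lt α β →
    IsLeading lt (basis.repr (basis γ * basis α * basis η)) μ →
    IsLeading lt (basis.repr (basis γ * basis β * basis η)) ν → ν ≠ 0 → lt μ ν
  /-- `a^α a^β = κ a^(α+β) + f` with `κ ≠ 0` and `f = 0` or `LM(f) ≺ a^(α+β)`. -/
  solvable : ∀ α β : Expo n, ∃ κ : K, κ ≠ 0 ∧ ∃ f : A,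
    basis α * basis β = κ • basis (α + β) + f ∧
      (f = 0 ∨ ∃ μ, IsLeading lt (basis.repr f) μ ∧ lt μ (α + β))
  w : Fin n → ℕ
  w_pos : ∀ i, 0 < w i
  graded : ∀ α β : Expo n, lt α β → ∑ i, w i * α i ≤ ∑ i, w i * β i

variable {K A : Type*} [Field K] [Ring A] [Algebra K A] {n : ℕ} (P : GradedSolvPolyAlg K A n)

/-- The degree `d(a^α) = ∑ wᵢ αᵢ`. -/
def GradedSolvPolyAlg.wdeg (α : Expo n) : ℕ := ∑ i, P.w i * α i

/-- The element `∑ κ a^δ` of `A` that is given by a finite list of coefficients. -/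
def GradedSolvPolyAlg.toA (f : Expo n →₀ K) : A := f.sum fun δ κ => κ • P.basis δ

/-! ### Filtrations -/

/-- `F_p A`, the span of the standard monomials of degree at most `p`. -/
def GradedSolvPolyAlg.fil (p : ℕ) : Submodule K A :=
  Submodule.span K {x | ∃ α, P.wdeg α ≤ p ∧ x = P.basis α}

/-- `F_q L` for the filtered free module `L = ⨁ A e_i` in which `e_i` has degree `b i`:
the span of the `a^α e_i` with `d(a^α) + b i ≤ q`. -/
def GradedSolvPolyAlg.freeFil {ι : Type*} (b : ι → ℕ) (q : ℕ) : Submodule K (ι → A) :=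
  Submodule.span K {x | ∃ α i, P.wdeg α + b i ≤ q ∧ x = Pi.single i (P.basis α)}

/-- The filtered degree `d_fil(ξ)` of a (nonzero) element of the filtered free module. -/
def GradedSolvPolyAlg.filDeg {ι : Type*} (b : ι → ℕ) (ξ : ι → A) : ℕ :=
  sInf {q | ξ ∈ P.freeFil b q}

section Filtered

variable {M M' : Type*} [AddCommGroup M] [Module A M] [Module K M] [IsScalarTower K A M]
  [AddCommGroup M'] [Module A M'] [Module K M'] [IsScalarTower K A M']

variable (K) in
/-- The induced filtration `N ∩ F_q M` of a submodule. -/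
def subFil (FM : ℕ → Submodule K M) (N : Submodule A M) (q : ℕ) : Submodule K N :=
  (FM q).comap (N.subtype.restrictScalars K)

variable (K) in
/-- The induced filtration `(F_q M + N) / N` of a quotient. -/
def quotFil (FM : ℕ → Submodule K M) (N : Submodule A M) (q : ℕ) : Submodule K (M ⧸ N) :=
  (FM q).map (N.mkQ.restrictScalars K)

/-- `φ` is a strict filtered homomorphism: `φ(F_q M) = φ(M) ∩ F_q M'`. -/
def IsStrictFiltered (FM : ℕ → Submodule K M) (FM' : ℕ → Submodule K M') (φ : M →ₗ[A] M') :
    Prop :=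
  ∀ q, (FM q).map (φ.restrictScalars K) = (LinearMap.range φ).restrictScalars K ⊓ FM' q

/-- The (finite) family `v` of nonzero elements is an F-basis of `M` with the filtration `FM`:
there are numbers `nn k` with `F_q M = ∑_k ∑_{p + nn k ≤ q} F_p A · v k` for all `q`. -/
def IsFBasis (FM : ℕ → Submodule K M) {κ : Type*} (v : κ → M) : Prop :=
  Finite κ ∧ (∀ k, v k ≠ 0) ∧ ∃ nn : κ → ℕ, ∀ q, FM q =
    ⨆ k, ⨆ p, ⨆ (_ : p + nn k ≤ q),
      (P.fil p).map ((LinearMap.toSpanSingleton A M (v k)).restrictScalars K)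

/-- A minimal F-basis: no proper subfamily is an F-basis. -/
def IsMinimalFBasis (FM : ℕ → Submodule K M) {κ : Type*} (v : κ → M) : Prop :=
  IsFBasis P FM v ∧ ∀ T : Set κ, T ≠ Set.univ → ¬ IsFBasis P FM (fun k : T => v k)

/-- A standard basis of the submodule `N`: an F-basis of `N` with the induced filtration. -/
def IsStandardBasis (FM : ℕ → Submodule K M) (N : Submodule A M) {κ : Type*} (v : κ → M) :
    Prop :=
  ∃ h : ∀ k, v k ∈ N, IsFBasis P (subFil K FM N) (fun k => (⟨v k, h k⟩ : N))

/-- A minimal standard basis of the submodule `N`. -/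
def IsMinimalStandardBasis (FM : ℕ → Submodule K M) (N : Submodule A M) {κ : Type*}
    (v : κ → M) : Prop :=
  ∃ h : ∀ k, v k ∈ N, IsMinimalFBasis P (subFil K FM N) (fun k => (⟨v k, h k⟩ : N))

end Filtered

/-! ### Filtered free complexes and minimal filtered free resolutions -/

/-- The data of a filtered free module `⨁_{i : ι} A e_i` of finite rank, `d_fil(e_i) = deg i`. -/
structure FreeLevel where
  ι : Type
  fin : Fintype ι
  deg : ι → ℕ

attribute [instance] FreeLevel.fin

/-- A sequence `⋯ → L₂ → L₁ → L₀` of homomorphisms of filtered free modules of finite rank,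
where `L₀` is given by `F` and `L_{i+1}` by `lev i`. -/
structure FilteredFreeComplex (A : Type*) [Ring A] (F : FreeLevel) where
  lev : ℕ → FreeLevel
  d0 : ((lev 0).ι → A) →ₗ[A] (F.ι → A)
  d : ∀ i, ((lev (i + 1)).ι → A) →ₗ[A] ((lev i).ι → A)

namespace FilteredFreeComplex

/-- The sequence `⋯ → 0 → 0 → L₀`. -/
def zero (A : Type*) [Ring A] (F : FreeLevel) : FilteredFreeComplex A F where
  lev _ := ⟨Empty, inferInstance, fun _ => 0⟩
  d0 := 0
  d _ := 0

/-- The sequence `⋯ → L₂ → L₁ → L₀` that is obtained from `⋯ → L₂ → L₁` and `f : L₁ → L₀`. -/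
def cons {A : Type*} [Ring A] {F : FreeLevel} (F' : FreeLevel) (f : (F'.ι → A) →ₗ[A] (F.ι → A))
    (C : FilteredFreeComplex A F') : FilteredFreeComplex A F where
  lev
    | 0 => F'
    | i + 1 => C.lev i
  d0 := f
  d
    | 0 => C.d0
    | i + 1 => C.d i

/-- The sequence has length at most `d`, that is `L_i = 0` for `i > d`. -/
def LengthLE {A : Type*} [Ring A] {F : FreeLevel} (C : FilteredFreeComplex A F) (d : ℕ) : Prop :=
  ∀ i, d ≤ i → IsEmpty (C.lev i).ι

end FilteredFreeComplex

/-- The standard basis vectors `e_i` of a free module. -/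
def stdVec (A : Type*) [Ring A] {ι : Type*} (i : ι) : ι → A := Pi.single i 1

/-- `⋯ → L₂ → L₁ → L₀ → M → 0` (the last map is `φ0`) is a minimal filtered free
resolution of the filtered module `M`: the sequence is exact, all maps are strict filtered
homomorphisms, `φ0` maps the basis of `L₀` to a minimal F-basis of `M`, and each further map sends
the basis of its source to a minimal standard basis of the kernel of the preceding map. -/
structure IsMinimalFilteredFreeResolution {M : Type*} [AddCommGroup M] [Module A M] [Module K M]
    [IsScalarTower K A M] (FM : ℕ → Submodule K M) {F : FreeLevel} (φ0 : (F.ι → A) →ₗ[A] M)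
    (C : FilteredFreeComplex A F) : Prop where
  surj : Function.Surjective φ0
  exact_d0 : LinearMap.range C.d0 = LinearMap.ker φ0
  exact_d1 : LinearMap.range (C.d 0) = LinearMap.ker C.d0
  exact_d : ∀ i, LinearMap.range (C.d (i + 1)) = LinearMap.ker (C.d i)
  strict_φ0 : IsStrictFiltered (P.freeFil F.deg) FM φ0
  strict_d0 : IsStrictFiltered (P.freeFil (C.lev 0).deg) (P.freeFil F.deg) C.d0
  strict_d : ∀ i,
    IsStrictFiltered (P.freeFil (C.lev (i + 1)).deg) (P.freeFil (C.lev i).deg) (C.d i)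
  min_φ0 : IsMinimalFBasis P FM (fun i => φ0 (stdVec A i))
  min_d0 : IsMinimalStandardBasis P (P.freeFil F.deg) (LinearMap.ker φ0)
    (fun i => C.d0 (stdVec A i))
  min_d1 : IsMinimalStandardBasis P (P.freeFil (C.lev 0).deg) (LinearMap.ker C.d0)
    (fun i => C.d 0 (stdVec A i))
  min_d : ∀ i, IsMinimalStandardBasis P (P.freeFil (C.lev (i + 1)).deg) (LinearMap.ker (C.d i))
    (fun j => C.d (i + 1) (stdVec A j))

/-! ### Left monomial orderings and left Gröbner bases -/

/-- The coefficient of `a^α e_i` in an element of the free module. -/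
def GradedSolvPolyAlg.coef {ι : Type*} (ξ : ι → A) (s : Expo n × ι) : K :=
  P.basis.repr (ξ s.2) s.1

/-- The basis element `a^α e_i` of the free module. -/
def GradedSolvPolyAlg.mon {ι : Type*} (s : Expo n × ι) : ι → A := Pi.single s.2 (P.basis s.1)

/-- `r` is a graded left monomial ordering on the basis `{a^α e_i}` of the filtered free module
with degrees `b`. -/
structure IsGradedLeftMonomialOrdering {ι : Type*} (b : ι → ℕ)
    (r : Expo n × ι → Expo n × ι → Prop) : Prop where
  strictTotal : IsStrictTotal r
  /-- `a^α e_i ≺ a^β e_j` implies `LM(a^γ a^α e_i) ≺ LM(a^γ a^β e_j)`. -/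
  act : ∀ (γ : Expo n) (s t s' t' : Expo n × ι), r s t →
    IsLeading r (P.coef (P.basis γ • P.mon s)) s' →
    IsLeading r (P.coef (P.basis γ • P.mon t)) t' → r s' t'
  /-- `a^α ≺ a^β` implies `a^α e_i ≺ a^β e_i`. -/
  compat : ∀ (α β : Expo n) (i : ι), P.lt α β → r (α, i) (β, i)
  graded : ∀ s t : Expo n × ι, r s t → P.wdeg s.1 + b s.2 ≤ P.wdeg t.1 + b t.2

/-- `G` is a left Gröbner basis of `N`: it consists of nonzero elements of `N`, and the leading
monomial of each nonzero element of `N` is divisible by the leading monomial of an element of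
`G`, that is, it is `LM(a^γ LM(g))` for some `g` in `G` and some `γ`. -/
def IsLeftGroebnerBasis {ι : Type*} (r : Expo n × ι → Expo n × ι → Prop)
    (N : Submodule A (ι → A)) (G : List (ι → A)) : Prop :=
  (∀ g ∈ G, g ≠ 0 ∧ g ∈ N) ∧
    ∀ ξ ∈ N, ξ ≠ 0 → ∃ g ∈ G, ∃ s t γ, IsLeading r (P.coef ξ) s ∧ IsLeading r (P.coef g) t ∧
      IsLeading r (P.coef (P.basis γ • P.mon t)) s

/-! ### Division and S-polynomials

These are needed over `A` and over the associated graded algebra of `A`. Both cases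
are covered by a space `V` with a basis of monomials indexed by `Expo n × ι` on which the
monomials of the algebra act. -/

/-- A `K`-space with coefficient functions, monomials `mon (α, i)`, standing for `a^α e_i`, and an
action of the monomials `a^α` of the algebra. -/
structure MonomialModule (K : Type*) (n : ℕ) (ι V : Type*) where
  coef : V → Expo n × ι → K
  mon : Expo n × ι → V
  act : Expo n → V → V

namespace MonomialModule

variable {ι V : Type*} [AddCommGroup V] [Module K V] (X : MonomialModule K n ι V)
  (r : Expo n × ι → Expo n × ι → Prop)

/-- The leading monomial. -/
def lm (ξ : V) : Option (Expo n × ι) := leadOpt r (X.coef ξ)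

/-- `f · v` for `f = ∑ κ a^δ`. -/
def evalAct (f : Expo n →₀ K) (v : V) : V := f.sum fun δ κ => κ • X.act δ v

/-- `Divides r ξ s α`: the leading monomial of `ξ` divides the monomial `s`, with
quotient `a^α`. -/
def Divides (ξ : V) (s : Expo n × ι) (α : Expo n) : Prop :=
  ∃ t, X.lm r ξ = some t ∧ t.2 = s.2 ∧ α + t.1 = s.1

/-- The left division algorithm: `DivL r Ξ ω q η` says that the division of `ω` by the list `Ξ`
yields the quotients `q k` and the remainder `η`. If the leading monomial of `ω` is divisible by
leading monomials of members of the list, the first such member is used, else the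
leading term is moved to the remainder. -/
inductive DivL (Ξ : List V) : V → (ℕ → Expo n →₀ K) → V → Prop
  | zero : DivL Ξ 0 (fun _ => 0) 0
  | reduce (ω η ξ : V) (q : ℕ → Expo n →₀ K) (s : Expo n × ι) (k : ℕ) (α : Expo n) (κ : K) :
      X.lm r ω = some s → Ξ[k]? = some ξ → X.Divides r ξ s α →
      (∀ l, l < k → ∀ ζ, Ξ[l]? = some ζ → ∀ β, ¬ X.Divides r ζ s β) →
      -- Here `s` is also the leading monomial of `a^α ξ`.
      κ = (X.coef (X.act α ξ) s)⁻¹ * X.coef ω s →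
      DivL Ξ (ω - κ • X.act α ξ) q η →
      DivL Ξ ω (Function.update q k (q k + Finsupp.single α κ)) η
  | skip (ω η : V) (q : ℕ → Expo n →₀ K) (s : Expo n × ι) :
      X.lm r ω = some s → (∀ ζ ∈ Ξ, ∀ β, ¬ X.Divides r ζ s β) →
      DivL Ξ (ω - X.coef ω s • X.mon s) q η →
      DivL Ξ ω q (η + X.coef ω s • X.mon s)

/-- The first cofactor `LC(a^(γ-α) ξ)⁻¹ a^(γ-α)` of the S-polynomial of `ξ` and `ζ`, where the
leading monomials are `a^α e_i` and `a^β e_i` and `γ = max(α, β)`; it is `0` if the leading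
monomials belong to different basis vectors. -/
def cof (ξ ζ : V) : Expo n →₀ K :=
  match X.lm r ξ, X.lm r ζ with
  | some s, some t =>
    if s.2 = t.2 then
      Finsupp.single (s.1 ⊔ t.1 - s.1) (X.coef (X.act (s.1 ⊔ t.1 - s.1) ξ) (s.1 ⊔ t.1, s.2))⁻¹
    else 0
  | _, _ => 0

/-- The left S-polynomial. -/
def sPoly (ξ ζ : V) : V := X.evalAct (X.cof r ξ ζ) ξ - X.evalAct (X.cof r ζ ξ) ζ

/-- The pairs `(i, k)` with `i < k` and nonzero S-polynomial, for fixed `k`. -/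
def pairsTo (G : List V) (k : ℕ) : Finset (ℕ × ℕ) :=
  ((Finset.range k).image fun i => (i, k)).filter
    fun p => X.sPoly r (G.getD p.1 0) (G.getD p.2 0) ≠ 0

end MonomialModule

/-- The free `A`-module with basis indexed by `ι`. -/
def freeMod (ι : Type*) : MonomialModule K n ι (ι → A) where
  coef := P.coef
  mon := P.mon
  act α ξ := P.basis α • ξ

/-- The associated graded module of the filtered free module with basis indexed by `ι`, in
coordinates with respect to its `K`-basis `σ(a)^α σ(e_i)`. The product
`σ(a)^α σ(a)^β` is the part of degree exactly `d(a^α) + d(a^β)` of `a^α a^β`. -/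
def grMod (ι : Type*) : MonomialModule K n ι (Expo n × ι →₀ K) where
  coef x := x
  mon s := Finsupp.single s 1
  act α x := x.sum fun s κ =>
    ((P.basis.repr (P.basis α * P.basis s.1)).filter
      fun γ => P.wdeg γ = P.wdeg α + P.wdeg s.1).sum fun γ μ => Finsupp.single (γ, s.2) (κ * μ)

/-- The principal symbol `σ(ξ)`: the part of `ξ` of degree exactly `d_fil(ξ)`. -/
def symbol {ι : Type*} [Fintype ι] (b : ι → ℕ) (ξ : ι → A) : Expo n × ι →₀ K :=
  ∑ i, ((P.basis.repr (ξ i)).filter fun γ => P.wdeg γ + b i = P.filDeg b ξ).mapDomain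
    fun γ => (γ, i)

/-- The degree of a (nonzero) homogeneous element of the associated graded module. -/
def grDeg {ι : Type*} (b : ι → ℕ) (x : Expo n × ι →₀ K) : ℕ :=
  x.support.sup fun s => P.wdeg s.1 + b s.2

/-! ### The algorithms

A nondeterministic algorithm is given by its step relation and its halting condition. -/

/-- Total correctness: started in the given state, every run of the algorithm
halts after finitely many steps, does not get stuck before that, and halts in a state
that satisfies `Q`. -/
inductive Always {S : Type*} (R : S → S → Prop) (halt Q : S → Prop) : S → Prop
  | done (s : S) : halt s → Q s → Always R halt Q s
  | step (s : S) : ¬ halt s → (∃ t, R s t) → (∀ t, R s t → Always R halt Q t) →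
      Always R halt Q s

/-! #### Left Gröbner bases with transformation matrix -/

/-- State of the computation of a left Gröbner basis of the module generated by a list of `m`
elements: the current generators, each with its expression (a row) in the given
`m` elements, and the set of pairs that still have to be treated. -/
structure LGBState (A ι : Type*) (m : ℕ) where
  gens : List ((ι → A) × (Fin m → A))
  pairs : Finset (ℕ × ℕ)

section LGB

variable {ι : Type*} (r : Expo n × ι → Expo n × ι → Prop)

/-- The initial state. -/
def lgbStart (U : List (ι → A)) : LGBState A ι U.length where
  gens := List.ofFn fun k : Fin U.length => (U.get k, stdVec A k)
  pairs := (Finset.range U.length).biUnion fun k => (freeMod P ι).pairsTo r U k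

/-- `∑_k q_k row_k`, for quotients `q` by the list of current generators. -/
def rowComb {m : ℕ} (gens : List ((ι → A) × (Fin m → A))) (q : ℕ → Expo n →₀ K) : Fin m → A :=
  ∑ k : Fin gens.length, P.toA (q k) • (gens.get k).2

/-- The next state after the treatment of the pair `(i, j)` of the generators `g`, `h`,
if the division of the S-polynomial has given the quotients `q` and the remainder `η`. -/
def lgbNext {m : ℕ} (s : LGBState A ι m) (p : ℕ × ℕ) (g h : (ι → A) × (Fin m → A))
    (q : ℕ → Expo n →₀ K) (η : ι → A) : LGBState A ι m :=
  if η = 0 then ⟨s.gens, s.pairs.erase p⟩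
  else
    ⟨s.gens ++ [(η, P.toA ((freeMod P ι).cof r g.1 h.1) • g.2
        - P.toA ((freeMod P ι).cof r h.1 g.1) • h.2 - rowComb P s.gens q)],
      s.pairs.erase p ∪
        (freeMod P ι).pairsTo r (s.gens.map Prod.fst ++ [η]) s.gens.length⟩

/-- A step: choose a pair, and divide its S-polynomial by the current generators. -/
inductive LGBStep {m : ℕ} : LGBState A ι m → LGBState A ι m → Prop
  | mk (s : LGBState A ι m) (i j : ℕ) (g h : (ι → A) × (Fin m → A)) (q : ℕ → Expo n →₀ K)
      (η : ι → A) : (i, j) ∈ s.pairs → s.gens[i]? = some g → s.gens[j]? = some h →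
      (freeMod P ι).DivL r (s.gens.map Prod.fst) ((freeMod P ι).sPoly r g.1 h.1) q η →
      LGBStep s (lgbNext P r s (i, j) g h q η)

/-- The Gröbner basis algorithm, applied to `U`, always halts, with a list of generators
and rows that satisfies `Q`. -/
def RunLGB (U : List (ι → A)) (Q : List ((ι → A) × (Fin U.length → A)) → Prop) : Prop :=
  Always (LGBStep P r) (fun s => s.pairs = ∅) (fun s => Q s.gens) (lgbStart P r U)

/-- The list `S` of syzygies of the list `W` is obtained from a Gröbner basis `gens` with
transformation rows: it consists, zeros omitted, of the rows of `D = Q V - E`, where `Q` comes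
from the division of the members of `W` by the Gröbner basis and `V` is the matrix of rows,
and of the products with `V` of the syzygies of the Gröbner basis that result from the
division of its S-polynomials. -/
def IsSyzygyOutput (W : List (ι → A)) (gens : List ((ι → A) × (Fin W.length → A)))
    (S : List (Fin W.length → A)) : Prop :=
  ∃ (q : Fin W.length → ℕ → Expo n →₀ K)
    (f : Fin gens.length → Fin gens.length → ℕ → Expo n →₀ K),
    (∀ k, (freeMod P ι).DivL r (gens.map Prod.fst) (W.get k) (q k) 0) ∧
    (∀ i j, i < j → (freeMod P ι).DivL r (gens.map Prod.fst)
      ((freeMod P ι).sPoly r (gens.get i).1 (gens.get j).1) (f i j) 0) ∧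
    S = (((List.finRange gens.length ×ˢ List.finRange gens.length).filter
          fun p => p.1 < p.2).map (fun p => rowComb P gens (f p.1 p.2)
            - P.toA ((freeMod P ι).cof r (gens.get p.1).1 (gens.get p.2).1) • (gens.get p.1).2
            + P.toA ((freeMod P ι).cof r (gens.get p.2).1 (gens.get p.1).1) • (gens.get p.2).2)
        ++ (List.finRange W.length).map (fun k => rowComb P gens (q k) - stdVec A k)).filter
          fun x => x ≠ 0

end LGB

/-! #### Minimal homogeneous generating sets over the associated graded algebra -/

/-- State of the computation: treated degree by degree are the pairs `S` and the indices `W` of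
given elements; `Sn` and `Wn` are those of the current degree; `G` is
the current (truncated) Gröbner basis and `sel` lists the indices of the chosen elements. -/
structure HGSState (V : Type*) where
  S : Finset (ℕ × ℕ)
  W : Finset ℕ
  Sn : Finset (ℕ × ℕ)
  Wn : Finset ℕ
  G : List V
  sel : List ℕ

section HGS

variable {ι : Type*} (b : ι → ℕ) (r : Expo n × ι → Expo n × ι → Prop)

/-- The degree of a pair: the degree of its S-polynomial. -/
def pairDeg (G : List (Expo n × ι →₀ K)) (p : ℕ × ℕ) : ℕ :=
  grDeg P b ((grMod P ι).sPoly r (G.getD p.1 0) (G.getD p.2 0))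

/-- A step, for the given list `U` of homogeneous elements. -/
inductive HGSStep (U : List (Expo n × ι →₀ K)) :
    HGSState (Expo n × ι →₀ K) → HGSState (Expo n × ι →₀ K) → Prop
  /-- Pass to the least degree `e` that occurs. -/
  | round (s : HGSState (Expo n × ι →₀ K)) (e : ℕ) : s.Sn = ∅ → s.Wn = ∅ →
      IsLeast {x | (∃ p ∈ s.S, x = pairDeg P b r s.G p) ∨
        ∃ k ∈ s.W, x = grDeg P b (U.getD k 0)} e →
      HGSStep U s
        { s with
          S := s.S.filter fun p => pairDeg P b r s.G p ≠ e
          Sn := s.S.filter fun p => pairDeg P b r s.G p = e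
          W := s.W.filter fun k => grDeg P b (U.getD k 0) ≠ e
          Wn := s.W.filter fun k => grDeg P b (U.getD k 0) = e }
  /-- Treat a pair of the current degree. -/
  | pair (s : HGSState (Expo n × ι →₀ K)) (i j : ℕ) (g h : Expo n × ι →₀ K)
      (q : ℕ → Expo n →₀ K) (η : Expo n × ι →₀ K) : (i, j) ∈ s.Sn → s.G[i]? = some g →
      s.G[j]? = some h → (grMod P ι).DivL r s.G ((grMod P ι).sPoly r g h) q η →
      HGSStep U s
        (if η = 0 then { s with Sn := s.Sn.erase (i, j) }
        else
          { s with
            Sn := s.Sn.erase (i, j)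
            S := s.S ∪ (grMod P ι).pairsTo r (s.G ++ [η]) s.G.length
            G := s.G ++ [η] })
  /-- Treat a given element of the current degree, after the pairs. -/
  | elem (s : HGSState (Expo n × ι →₀ K)) (k : ℕ) (ξ : Expo n × ι →₀ K)
      (q : ℕ → Expo n →₀ K) (η : Expo n × ι →₀ K) : s.Sn = ∅ → k ∈ s.Wn → U[k]? = some ξ →
      (grMod P ι).DivL r s.G ξ q η →
      HGSStep U s
        (if η = 0 then { s with Wn := s.Wn.erase k }
        else
          { s with
            Wn := s.Wn.erase k
            S := s.S ∪ (grMod P ι).pairsTo r (s.G ++ [η]) s.G.length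
            G := s.G ++ [η]
            sel := s.sel ++ [k] })

/-- The algorithm that selects a minimal homogeneous generating set from the list `U` of
homogeneous elements always halts, with a list of selected indices that satisfies `Q`. -/
def RunMinHGS (U : List (Expo n × ι →₀ K)) (Q : List ℕ → Prop) : Prop :=
  Always (HGSStep P b r U) (fun s => s.S = ∅ ∧ s.W = ∅ ∧ s.Sn = ∅ ∧ s.Wn = ∅)
    (fun s => Q s.sel) ⟨∅, Finset.range U.length, ∅, ∅, [], []⟩

/-- The minimal standard basis algorithm: compute a left Gröbner basis `G` of the module
generated by `U`, select from the symbols of `G` a minimal homogeneous generating set, and return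
the corresponding members of `G`. -/
def RunMinStdBasis [Fintype ι] (U : List (ι → A)) (Q : List (ι → A) → Prop) : Prop :=
  RunLGB P r U fun G =>
    RunMinHGS P b r (G.map fun g => symbol P b g.1) fun sel =>
      Q (sel.map fun k => (G.map Prod.fst).getD k 0)

end HGS

/-! #### Minimal F-bases -/

section MinFB

variable {m : ℕ} (b : Fin m → ℕ)

/-- The `i`-th component of `v` is the nonzero constant `c`, of degree
`d(c) + b i = d_fil(v)`. -/
def IsPivot (E : Finset (Fin m)) (v : Fin m → A) (i : Fin m) (c : K) : Prop :=
  i ∈ E ∧ c ≠ 0 ∧ v i = algebraMap K A c ∧ b i = P.filDeg b v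

/-- A step of the reduction of the set `E` of basis vectors and of the list of relations: with a
pivot in the relation `v` at the least possible position `i`, eliminate the `i`-th
component from the other relations, omit zeros, and drop `v` and the `i`-th basis vector. -/
inductive MinFBStep :
    Finset (Fin m) × List (Fin m → A) → Finset (Fin m) × List (Fin m → A) → Prop
  | mk (E : Finset (Fin m)) (V : List (Fin m → A)) (j : ℕ) (v : Fin m → A) (i : Fin m) (c : K) :
      V[j]? = some v → IsPivot P b E v i c → (∀ i' < i, ∀ c', ¬ IsPivot P b E v i' c') →
      MinFBStep (E, V) (E.erase i,
        ((V.eraseIdx j).map fun u => u - (c⁻¹ • u i) • v).filter fun u => u ≠ 0)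

/-- The algorithm for a minimal F-basis, applied to the list `V` of relations, always halts, with
a set of basis vectors and a list of relations that satisfy `Q`. -/
def RunMinFB (V : List (Fin m → A)) (Q : Finset (Fin m) → List (Fin m → A) → Prop) : Prop :=
  Always (MinFBStep P b) (fun s => ∀ v ∈ s.2, ∀ i c, ¬ IsPivot P b s.1 v i c)
    (fun s => Q s.1 s.2) (Finset.univ, V)

/-- The filtered free submodule `L₀'` of `L₀` with basis `{e_i | i ∈ E}`. -/
def subLevel (E : Finset (Fin m)) : FreeLevel := ⟨{i // i ∈ E}, inferInstance, fun i => b i⟩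

/-- The map from `L₀' = ⨁_{i ∈ E} A e_i` to `L₀ / N` given by the classes of the `e_i`. -/
def subMap (N : Submodule A (Fin m → A)) (E : Finset (Fin m)) :
    ((subLevel b E).ι → A) →ₗ[A] (Fin m → A) ⧸ N :=
  Fintype.linearCombination A fun i : {i // i ∈ E} => N.mkQ (stdVec A i.1)

end MinFB

/-! #### The resolution -/

/-- The next filtered free module: a basis vector for each member of `W`, of the same degree. -/
def nextLevel (F : FreeLevel) (W : List (F.ι → A)) : FreeLevel :=
  ⟨Fin W.length, inferInstance, fun j => P.filDeg F.deg (W.get j)⟩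

/-- The map to the filtered free module `F` that sends the basis vectors to the members
of `W`. -/
def nextMap (F : FreeLevel) (W : List (F.ι → A)) :
    ((nextLevel P F W).ι → A) →ₗ[A] (F.ι → A) :=
  Fintype.linearCombination A fun j : Fin W.length => W.get j

/-- The loop of the construction of a resolution. Given the list `U` of generators of the
current kernel, a submodule of the free module `F`: if the list is empty, stop. Otherwise, with
an arbitrary graded left monomial ordering, compute a minimal standard basis
`W` of the module generated by `U`, then a left Gröbner basis (again for an arbitrary graded left
monomial ordering) of that module from `W`, and from it a list of generators of the syzygy
module of `W`; pass to the next free module and to this list.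

`ResolveLoop P k F U Q` says that, for all choices made on the way: the orderings exist,
all parts of the computation terminate and yield a minimal standard basis and generators of the
syzygy module, the loop stops after at most `k` rounds, and the sequence of free modules so obtained
satisfies `Q`. -/
def ResolveLoop : ℕ → (F : FreeLevel) → List (F.ι → A) → (FilteredFreeComplex A F → Prop) → Prop
  | 0, F, U, Q => U = [] ∧ Q (FilteredFreeComplex.zero A F)
  | k + 1, F, U, Q =>
    (U = [] → Q (FilteredFreeComplex.zero A F)) ∧
    (U ≠ [] →
      (∃ r, IsGradedLeftMonomialOrdering P F.deg r) ∧
      ∀ r, IsGradedLeftMonomialOrdering P F.deg r →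
        RunMinStdBasis P F.deg r U fun W =>
          IsMinimalStandardBasis P (P.freeFil F.deg) (Submodule.span A {x | x ∈ U}) W.get ∧
          ∀ r', IsGradedLeftMonomialOrdering P F.deg r' →
            RunLGB P r' W fun G =>
              (∃ U₁, IsSyzygyOutput P r' W G U₁) ∧
              ∀ U₁ : List ((nextLevel P F W).ι → A), IsSyzygyOutput P r' W G U₁ →
                Submodule.span A {x | x ∈ U₁} = LinearMap.ker (nextMap P F W) ∧
                ResolveLoop k (nextLevel P F W) U₁ fun C =>
                  Q (FilteredFreeComplex.cons (nextLevel P F W) (nextMap P F W) C))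

end

end SolvPoly

/-! The computational half rests on one Gröbner basis argument. A free module over $A$ and its
associated graded module over $G(A)$ are both spaces with a basis of monomials on which the
monomials of the algebra act so that exponents of leading monomials add; `MonomialModule.Admissible`
records this, and division, S-polynomials and `exists_standard_rep` are treated once for both. The
latter says: if the S-pairs of a family lie, up to smaller terms, in a stable subspace `T` of the
formal combinations, then every formal combination can be changed modulo `T` until none of its terms
exceeds the leading monomial of its value. For `T = ⊥` this is Buchberger's criterion
(`buchberger`), also truncated to bounded degree; for `T` generated by the syzygies coming from
S-polynomials it is Schreyer's theorem (`ker_le_span_sSyzygy`), and a matrix identity carries it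
over to the given generators (`span_isSyzygyOutput`). The Gröbner computations halt because an
appended remainder has a leading monomial not divisible by the earlier ones, which by Dickson's
lemma happens only finitely often.

Since the orderings are graded, the filtered degree is the degree of the leading monomial; so a
Gröbner basis is a standard basis. A standard basis may be thinned by its symbols: a homogeneous
relation among symbols lifts to the filtered module with an error of smaller degree, and induction
on the degree removes the error (`isStandardBasis_of_symbols`). Selecting degree by degree leaves no
redundant symbol, which gives minimality (`isMinimalStandardBasis_of_selection`).

Minimality of the generators of a quotient $L/N$ is one condition on $N$, `NoPivot`: no element of
$N\cap F_{b_i}L$ has a nonzero constant as its $i$-th component. Such an element would eliminate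
$e_i$ without raising degrees, and conversely a superfluous $e_i$ produces one. Algorithm MINFB
reaches this condition for the first module; minimality of each standard basis gives it for the next
kernel (`noPivot_ker_nextMap`).

The bound $n$ comes from comparison with a second, not necessarily minimal resolution. In Schreyer's
construction, with ties at step $i$ decided by the $i$-th exponent, the minimal leading monomials
lose one variable per step. After $n$ steps they could only be bare basis vectors, and these never
occur, so the kernel is zero (`hasFreeRes_of_zeroFirst`). `Linked` says that the identity of $N$
factors through $Q$ by filtered maps, up to a filtered map defined on the whole free module. This
passes to kernels of strict covers (`Linked.ker`). Once $Q=0$, the module $N$ is a filtered direct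
summand of a free module, and `NoPivot` forces $N=0$ by an argument of Nakayama type
(`Linked.eq_bot`). Hence the loop stops after at most $n$ rounds, whatever choices are made, and
existence follows by carrying out one run. -/

namespace SolvPoly

noncomputable section

open scoped Classical

/-! ### Strict total orderings and leading indices -/

section Order

variable {σ K : Type*}

/-- The reflexive closure of `r`. -/
def RLe (r : σ → σ → Prop) (t s : σ) : Prop := t = s ∨ r t s

variable {r : σ → σ → Prop}

theorem RLe.refl (s : σ) : RLe r s s := Or.inl rfl

theorem IsStrictTotal.asymm (hr : IsStrictTotal r) {s t : σ} (h : r s t) : ¬ r t s :=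
  fun h' => hr.irrefl _ (hr.trans _ _ _ h h')

theorem IsStrictTotal.le_trans (hr : IsStrictTotal r) {s t u : σ} (h : RLe r s t)
    (h' : RLe r t u) : RLe r s u := by
  rcases h with rfl | h
  · exact h'
  · rcases h' with rfl | h'
    · exact Or.inr h
    · exact Or.inr (hr.trans _ _ _ h h')

theorem IsStrictTotal.lt_of_le_of_lt (hr : IsStrictTotal r) {s t u : σ} (h : RLe r s t)
    (h' : r t u) : r s u := by
  rcases h with rfl | h
  · exact h'
  · exact hr.trans _ _ _ h h'

theorem IsStrictTotal.lt_of_lt_of_le (hr : IsStrictTotal r) {s t u : σ} (h : r s t)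
    (h' : RLe r t u) : r s u := by
  rcases h' with rfl | h'
  · exact h
  · exact hr.trans _ _ _ h h'

theorem IsStrictTotal.le_or_lt (hr : IsStrictTotal r) (s t : σ) : RLe r s t ∨ r t s := by
  rcases hr.total s t with h | h | h
  · exact Or.inl (Or.inr h)
  · exact Or.inl (Or.inl h)
  · exact Or.inr h

theorem IsStrictTotal.le_antisymm (hr : IsStrictTotal r) {s t : σ} (h : RLe r s t)
    (h' : RLe r t s) : s = t := by
  rcases h with rfl | h
  · rfl
  · exact absurd (hr.lt_of_lt_of_le h h') (hr.irrefl _)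

theorem IsStrictTotal.exists_max (hr : IsStrictTotal r) (S : Finset σ) (hS : S.Nonempty) :
    ∃ s ∈ S, ∀ t ∈ S, RLe r t s := by
  induction hS using Finset.Nonempty.cons_induction with
  | singleton a => exact ⟨a, by simp, fun t ht => Or.inl (by simpa using ht)⟩
  | cons a S ha hS ih =>
    obtain ⟨s, hs, hmax⟩ := ih
    rcases hr.le_or_lt a s with h | h
    · refine ⟨s, by simp [hs], fun t ht => ?_⟩
      rcases Finset.mem_cons.1 ht with rfl | ht
      · exact h
      · exact hmax t ht
    · refine ⟨a, by simp, fun t ht => ?_⟩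
      rcases Finset.mem_cons.1 ht with rfl | ht
      · exact RLe.refl _
      · exact Or.inr (hr.lt_of_le_of_lt (hmax t ht) h)

theorem IsLeading.unique [Zero K] (hr : IsStrictTotal r) {c : σ → K} {s t : σ}
    (hs : IsLeading r c s) (ht : IsLeading r c t) : s = t :=
  hr.le_antisymm (ht.2 s hs.1) (hs.2 t ht.1)

theorem leadOpt_eq_some [Zero K] (hr : IsStrictTotal r) {c : σ → K} {s : σ} :
    leadOpt r c = some s ↔ IsLeading r c s := by
  unfold leadOpt
  constructor
  · intro h
    split_ifs at h with hh
    · simp only [Option.some.injEq] at h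
      exact h ▸ hh.choose_spec
  · intro h
    have hh : ∃ s, IsLeading r c s := ⟨s, h⟩
    rw [dif_pos hh]
    exact congrArg some (IsLeading.unique hr hh.choose_spec h)

theorem exists_isLeading [Zero K] (hr : IsStrictTotal r) {c : σ → K}
    (hfin : (Function.support c).Finite) (hc : c ≠ 0) : ∃ s, IsLeading r c s := by
  have hne : hfin.toFinset.Nonempty := by
    rw [Set.Finite.toFinset_nonempty]
    exact Function.support_nonempty_iff.2 hc
  obtain ⟨s, hs, hmax⟩ := hr.exists_max _ hne
  exact ⟨s, by simpa using hs, fun t ht => hmax t (by simpa using ht)⟩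

end Order

/-! ### Divisibility of monomials and Dickson's lemma -/

section Dickson

variable {n : ℕ} {ι : Type*}

/-- The monomial `a^(α + β) e_i` for `s = a^β e_i`. -/
def shift (α : Expo n) (s : Expo n × ι) : Expo n × ι := (α + s.1, s.2)

@[simp] theorem shift_fst (α : Expo n) (s : Expo n × ι) : (shift α s).1 = α + s.1 := rfl

@[simp] theorem shift_snd (α : Expo n) (s : Expo n × ι) : (shift α s).2 = s.2 := rfl

@[simp] theorem shift_zero (s : Expo n × ι) : shift 0 s = s := by simp [shift]

theorem shift_shift (α β : Expo n) (s : Expo n × ι) :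
    shift α (shift β s) = shift (α + β) s := by simp [shift, add_assoc]

theorem shift_left_injective (s : Expo n × ι) : Function.Injective fun α => shift α s := by
  intro α β h
  exact add_right_cancel (Prod.ext_iff.1 h).1

/-- Divisibility of monomials of a free module. -/
def MDvd (t s : Expo n × ι) : Prop := ∃ α, shift α t = s

theorem mdvd_iff {t s : Expo n × ι} : MDvd t s ↔ t.1 ≤ s.1 ∧ t.2 = s.2 := by
  constructor
  · rintro ⟨α, rfl⟩
    exact ⟨le_add_of_nonneg_left zero_le, rfl⟩
  · rintro ⟨h, h'⟩
    exact ⟨s.1 - t.1, Prod.ext (tsub_add_cancel_of_le h) h'⟩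

theorem MDvd.refl (s : Expo n × ι) : MDvd s s := ⟨0, shift_zero s⟩

theorem MDvd.trans {s t u : Expo n × ι} (h : MDvd s t) (h' : MDvd t u) : MDvd s u := by
  rw [mdvd_iff] at *
  exact ⟨h.1.trans h'.1, h.2.trans h'.2⟩

theorem wellQuasiOrdered_mdvd [Finite ι] :
    WellQuasiOrdered (MDvd : Expo n × ι → Expo n × ι → Prop) := by
  have h1 : WellQuasiOrdered ((· ≤ ·) : Expo n → Expo n → Prop) := wellQuasiOrdered_le
  have h2 : WellQuasiOrdered ((· = ·) : ι → ι → Prop) := Finite.wellQuasiOrdered _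
  intro f
  obtain ⟨i, j, hij, h⟩ := h1.prod h2 f
  exact ⟨i, j, hij, mdvd_iff.2 h⟩

/-- `l'` arises from `l` by appending a monomial that is not divisible by members of `l`. -/
def DicksonExt (l' l : List (Expo n × ι)) : Prop := ∃ s, l' = l ++ [s] ∧ ∀ t ∈ l, ¬ MDvd t s

/-- In an infinite chain of extensions the appended monomials form a sequence in which, by Dickson's
lemma, an earlier one divides a later one; the earlier one is still in the list at that time. This
is the termination argument of both Gröbner algorithms. -/
theorem wellFounded_dicksonExt [Finite ι] :
    WellFounded (DicksonExt : List (Expo n × ι) → List (Expo n × ι) → Prop) := by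
  rw [wellFounded_iff_isEmpty_descending_chain]
  refine ⟨fun ⟨f, hf⟩ => ?_⟩
  choose s hs hnd using hf
  obtain ⟨i, j, hij, h⟩ := wellQuasiOrdered_mdvd (n := n) (ι := ι) s
  refine hnd j (s i) ?_ h
  clear h
  induction j, hij using Nat.le_induction with
  | base => rw [hs]; simp
  | succ j _ ih => rw [hs]; simp [ih]

/-- A proper divisor in the same component has a strictly smaller exponent sum, so descent by
divisors ends. -/
theorem exists_minimal_mdvd (S : Set (Expo n × ι)) {s : Expo n × ι} (hs : s ∈ S) :
    ∃ t ∈ S, MDvd t s ∧ ∀ u ∈ S, MDvd u t → u = t := by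
  induction h : ∑ i, s.1 i using Nat.strong_induction_on generalizing s with
  | _ k ih =>
    by_cases hmin : ∀ u ∈ S, MDvd u s → u = s
    · exact ⟨s, hs, MDvd.refl s, hmin⟩
    · push Not at hmin
      obtain ⟨u, hu, hus, hne⟩ := hmin
      have hlt : ∑ i, u.1 i < ∑ i, s.1 i := by
        rw [mdvd_iff] at hus
        refine lt_of_le_of_ne (Finset.sum_le_sum fun i _ => hus.1 i) fun heq => hne ?_
        refine Prod.ext (funext fun i => ?_) hus.2
        exact (Finset.sum_eq_sum_iff_of_le fun i _ => hus.1 i).1 heq i (Finset.mem_univ _)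
      obtain ⟨t, ht, htu, hmin⟩ := ih _ (h ▸ hlt) hu rfl
      exact ⟨t, ht, htu.trans hus, hmin⟩

theorem finite_of_mdvd_antichain [Finite ι] (S : Set (Expo n × ι))
    (h : ∀ s ∈ S, ∀ t ∈ S, MDvd s t → s = t) : S.Finite := by
  by_contra hinf
  let f := Set.Infinite.natEmbedding S hinf
  obtain ⟨i, j, hij, hd⟩ := wellQuasiOrdered_mdvd (n := n) (ι := ι) fun k => (f k : Expo n × ι)
  have := h _ (f i).2 _ (f j).2 hd
  exact hij.ne (f.injective (Subtype.ext this))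

end Dickson

/-! ### The monomial ordering of the algebra and orderings of free modules -/

section Algebra

variable {K A : Type*} [Field K] [Ring A] [Algebra K A] {n : ℕ} (P : GradedSolvPolyAlg K A n)

namespace GradedSolvPolyAlg

theorem wdeg_add (α β : Expo n) : P.wdeg (α + β) = P.wdeg α + P.wdeg β := by
  simp [wdeg, mul_add, Finset.sum_add_distrib]

@[simp] theorem wdeg_zero : P.wdeg 0 = 0 := by simp [wdeg]

theorem wdeg_eq_zero {α : Expo n} : P.wdeg α = 0 ↔ α = 0 := by
  constructor
  · intro h
    funext i
    have := (Finset.sum_eq_zero_iff.1 h) i (Finset.mem_univ _)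
    exact (Nat.mul_eq_zero.1 this).resolve_left (P.w_pos i).ne'
  · rintro rfl
    exact P.wdeg_zero

theorem le_wdeg (α : Expo n) (i : Fin n) : α i ≤ P.wdeg α :=
  (Nat.le_mul_of_pos_left _ (P.w_pos i)).trans
    (Finset.single_le_sum (f := fun i => P.w i * α i) (fun _ _ => Nat.zero_le _)
      (Finset.mem_univ i))

theorem finite_wdeg_le (q : ℕ) : {α : Expo n | P.wdeg α ≤ q}.Finite :=
  (Set.finite_Iic (fun _ => q : Expo n)).subset fun α (hα : P.wdeg α ≤ q) i =>
    (P.le_wdeg α i).trans hα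

@[simp] theorem basis_zero : P.basis 0 = 1 := by
  rw [P.basis_apply]
  simp only [stdMonomial, Pi.zero_apply, pow_zero]
  rw [List.prod_eq_one]
  simp

theorem isLeading_mul (α β : Expo n) :
    IsLeading P.lt (P.basis.repr (P.basis α * P.basis β)) (α + β) := by
  obtain ⟨κ, hκ, f, h, hf⟩ := P.solvable α β
  rw [h]
  rcases hf with rfl | ⟨μ, hμ, hlt⟩
  · simp only [add_zero, map_smul, Module.Basis.repr_self]
    refine ⟨by simp [hκ], fun t ht => ?_⟩
    by_contra hne
    push Not at hne
    exact ht (by simp [Ne.symm hne.1])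
  · have hlt' : ∀ t, P.basis.repr f t ≠ 0 → P.lt t (α + β) := fun t ht =>
      P.strictTotal.lt_of_le_of_lt (hμ.2 t ht) hlt
    have h0 : P.basis.repr f (α + β) = 0 := by
      by_contra hne
      exact P.strictTotal.irrefl _ (hlt' _ hne)
    refine ⟨by simp [hκ, h0], fun t ht => ?_⟩
    by_cases hne : t = α + β
    · exact Or.inl hne
    · refine Or.inr (hlt' t fun h1 => ht ?_)
      simp [h1, Ne.symm hne]

/-- The monomial $1$ is the middle factor of $1\cdot 1\cdot a^\gamma$, so the factor axiom applies.
-/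
theorem zero_lt {γ : Expo n} (hγ : γ ≠ 0) : P.lt 0 γ := by
  refine P.lt_of_factor 0 0 γ γ hγ hγ.symm ?_
  have := P.isLeading_mul 0 γ
  simpa using this

theorem add_lt_add {α β : Expo n} (γ : Expo n) (h : P.lt α β) : P.lt (γ + α) (γ + β) := by
  -- The multiplication axiom excludes the leading monomial $1$ on the larger side; nothing lies
  -- below $1$, so the larger exponent is nonzero and remains so after adding `γ`.
  have hβ : β ≠ 0 := by
    rintro rfl
    by_cases hα : α = 0
    · exact P.strictTotal.irrefl _ (hα ▸ h)
    · exact P.strictTotal.asymm h (P.zero_lt hα)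
  refine P.lt_mul α β γ 0 _ _ h ?_ ?_ fun h0 => hβ ?_
  · simpa using P.isLeading_mul γ α
  · simpa using P.isLeading_mul γ β
  · funext i
    have := congrFun h0 i
    simp only [Pi.add_apply, Pi.zero_apply] at this ⊢
    omega

theorem add_lt_add_right {α β : Expo n} (γ : Expo n) (h : P.lt α β) :
    P.lt (α + γ) (β + γ) := by
  rw [add_comm α, add_comm β]
  exact P.add_lt_add γ h

theorem wdeg_le_of_lt {α β : Expo n} (h : P.lt α β) : P.wdeg α ≤ P.wdeg β := P.graded α β h

end GradedSolvPolyAlg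

/-- The degree of the monomial `a^α e_i` in the free module with degrees `b`. -/
def mdeg {ι : Type*} (b : ι → ℕ) (s : Expo n × ι) : ℕ := P.wdeg s.1 + b s.2

theorem mdeg_shift {ι : Type*} (b : ι → ℕ) (α : Expo n) (s : Expo n × ι) :
    mdeg P b (shift α s) = P.wdeg α + mdeg P b s := by
  simp [mdeg, P.wdeg_add, add_assoc]

theorem finite_mdeg_le {ι : Type*} [Finite ι] (b : ι → ℕ) (q : ℕ) :
    {s : Expo n × ι | mdeg P b s ≤ q}.Finite := by
  refine ((P.finite_wdeg_le q).prod (Set.finite_univ (α := ι))).subset fun s hs => ?_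
  exact ⟨(Nat.le_add_right _ _).trans hs, trivial⟩

/-! ### Graded left monomial orderings of free modules -/

section FreeOrder

variable {ι : Type*} {b : ι → ℕ} {r : Expo n × ι → Expo n × ι → Prop}

theorem coef_single_basis (α β : Expo n) (i j : ι) :
    P.coef (Pi.single i (P.basis α)) (β, j) = if (α, i) = (β, j) then 1 else 0 := by
  unfold GradedSolvPolyAlg.coef
  by_cases hij : j = i
  · subst hij
    simp [Finsupp.single_apply]
  · simp [hij, Ne.symm hij]

theorem coef_basis_smul_mon (γ : Expo n) (s t : Expo n × ι) :
    P.coef (P.basis γ • P.mon s) t =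
      if t.2 = s.2 then P.basis.repr (P.basis γ * P.basis s.1) t.1 else 0 := by
  unfold GradedSolvPolyAlg.coef GradedSolvPolyAlg.mon
  by_cases h : t.2 = s.2
  · simp [h]
  · simp [h]

variable {P}

/-- Only compatibility with `P.lt` is assumed, because this is also needed to verify the axiom `act`
for orderings still under construction. -/
theorem isLeading_smul_mon_of_compat
    (h : ∀ (α β : Expo n) (i : ι), P.lt α β → r (α, i) (β, i)) (γ : Expo n)
    (s : Expo n × ι) : IsLeading r (P.coef (P.basis γ • P.mon s)) (shift γ s) := by
  have hl := P.isLeading_mul γ s.1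
  refine ⟨by rw [coef_basis_smul_mon]; simpa using hl.1, fun t ht => ?_⟩
  rw [coef_basis_smul_mon] at ht
  split_ifs at ht with h2
  · obtain ⟨t1, t2⟩ := t
    obtain rfl : t2 = s.2 := h2
    rcases hl.2 t1 ht with h1 | h1
    · exact Or.inl (Prod.ext h1 rfl)
    · exact Or.inr (h _ _ _ h1)
  · exact absurd rfl ht

theorem IsGradedLeftMonomialOrdering.isLeading_smul_mon
    (hr : IsGradedLeftMonomialOrdering P b r) (γ : Expo n) (s : Expo n × ι) :
    IsLeading r (P.coef (P.basis γ • P.mon s)) (shift γ s) :=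
  isLeading_smul_mon_of_compat hr.compat γ s

theorem IsGradedLeftMonomialOrdering.shift_lt (hr : IsGradedLeftMonomialOrdering P b r)
    (γ : Expo n) {s t : Expo n × ι} (h : r s t) : r (shift γ s) (shift γ t) :=
  hr.act γ s t _ _ h (hr.isLeading_smul_mon γ s) (hr.isLeading_smul_mon γ t)

theorem IsGradedLeftMonomialOrdering.shift_left_lt (hr : IsGradedLeftMonomialOrdering P b r)
    {α β : Expo n} (h : P.lt α β) (s : Expo n × ι) : r (shift α s) (shift β s) :=
  hr.compat _ _ _ (P.add_lt_add_right _ h)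

theorem IsGradedLeftMonomialOrdering.mdeg_le (hr : IsGradedLeftMonomialOrdering P b r)
    {s t : Expo n × ι} (h : RLe r s t) : mdeg P b s ≤ mdeg P b t := by
  rcases h with rfl | h
  · exact le_rfl
  · exact hr.graded s t h

/-- Positive weights leave finitely many monomials of bounded degree, and gradedness puts all
predecessors of a monomial among them. A minimum is found as a maximum for the reversed ordering. -/
theorem IsGradedLeftMonomialOrdering.wf [Finite ι] (hr : IsGradedLeftMonomialOrdering P b r) :
    WellFounded r := by
  have : IsTrans _ r := ⟨hr.strictTotal.trans⟩
  have : Std.Irrefl r := ⟨hr.strictTotal.irrefl⟩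
  rw [WellFounded.wellFounded_iff_has_min]
  intro S ⟨s, hs⟩
  have hfin : ({t | mdeg P b t ≤ mdeg P b s} ∩ S).Finite :=
    (finite_mdeg_le P b _).inter_of_left _
  have htot : IsStrictTotal (fun s t => r t s) := by
    refine ⟨hr.strictTotal.irrefl, fun s t u h h' => hr.strictTotal.trans _ _ _ h' h, ?_⟩
    intro s t
    rcases hr.strictTotal.total s t with h | h | h
    · exact Or.inr (Or.inr h)
    · exact Or.inr (Or.inl h)
    · exact Or.inl h
  obtain ⟨m, hm, hmin⟩ := htot.exists_max hfin.toFinset ⟨s, by simp [hs]⟩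
  simp only [Set.Finite.mem_toFinset, Set.mem_inter_iff, Set.mem_ofPred_eq] at hm hmin
  refine ⟨m, hm.2, fun x hx hlt => ?_⟩
  rcases hmin x ⟨(hr.mdeg_le (Or.inr hlt)).trans hm.1, hx⟩ with rfl | h
  · exact hr.strictTotal.irrefl _ hlt
  · exact hr.strictTotal.asymm h hlt

/-- Compare degrees first, then exponents by `P.lt`, then basis vectors in an arbitrary enumeration.
All three comparisons are invariant under multiplication by a monomial. -/
theorem exists_isGradedLeftMonomialOrdering [Finite ι] (P : GradedSolvPolyAlg K A n)
    (b : ι → ℕ) : ∃ r, IsGradedLeftMonomialOrdering P b r := by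
  obtain ⟨k, ⟨e⟩⟩ := Finite.exists_equiv_fin ι
  let r : Expo n × ι → Expo n × ι → Prop := fun s t =>
    mdeg P b s < mdeg P b t ∨ (mdeg P b s = mdeg P b t ∧
      (P.lt s.1 t.1 ∨ (s.1 = t.1 ∧ e s.2 < e t.2)))
  have hst : IsStrictTotal r := by
    refine ⟨?_, ?_, ?_⟩
    · rintro s (h | ⟨-, h | ⟨-, h⟩⟩)
      · exact lt_irrefl _ h
      · exact P.strictTotal.irrefl _ h
      · exact lt_irrefl _ h
    · rintro s t u (h | ⟨h, h1⟩) (h' | ⟨h', h1'⟩)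
      · exact Or.inl (h.trans h')
      · exact Or.inl (h' ▸ h)
      · exact Or.inl (h ▸ h')
      · refine Or.inr ⟨h.trans h', ?_⟩
        rcases h1 with h1 | ⟨h1, h2⟩ <;> rcases h1' with h1' | ⟨h1', h2'⟩
        · exact Or.inl (P.strictTotal.trans _ _ _ h1 h1')
        · exact Or.inl (h1' ▸ h1)
        · exact Or.inl (h1 ▸ h1')
        · exact Or.inr ⟨h1.trans h1', h2.trans h2'⟩
    · intro s t
      rcases lt_trichotomy (mdeg P b s) (mdeg P b t) with h | h | h
      · exact Or.inl (Or.inl h)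
      · rcases P.strictTotal.total s.1 t.1 with h1 | h1 | h1
        · exact Or.inl (Or.inr ⟨h, Or.inl h1⟩)
        · rcases lt_trichotomy (e s.2) (e t.2) with h2 | h2 | h2
          · exact Or.inl (Or.inr ⟨h, Or.inr ⟨h1, h2⟩⟩)
          · exact Or.inr (Or.inl (Prod.ext h1 (e.injective h2)))
          · exact Or.inr (Or.inr (Or.inr ⟨h.symm, Or.inr ⟨h1.symm, h2⟩⟩))
        · exact Or.inr (Or.inr (Or.inr ⟨h.symm, Or.inl h1⟩))
      · exact Or.inr (Or.inr (Or.inl h))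
  have hcompat : ∀ (α β : Expo n) (i : ι), P.lt α β → r (α, i) (β, i) := by
    intro α β i h
    rcases (P.wdeg_le_of_lt h).lt_or_eq with h1 | h1
    · exact Or.inl (by simpa [mdeg] using h1)
    · exact Or.inr ⟨by simpa [mdeg] using h1, Or.inl h⟩
  have hlead := isLeading_smul_mon_of_compat hcompat
  refine ⟨r, hst, ?_, hcompat, ?_⟩
  · intro γ s t s' t' h hs ht
    rw [IsLeading.unique hst hs (hlead γ s), IsLeading.unique hst ht (hlead γ t)]
    rcases h with h | ⟨h, h1⟩
    · left
      simpa [mdeg_shift] using h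
    · refine Or.inr ⟨by simpa [mdeg_shift] using h, ?_⟩
      rcases h1 with h1 | ⟨h1, h2⟩
      · exact Or.inl (P.add_lt_add _ h1)
      · exact Or.inr ⟨by simp [h1], h2⟩
  · rintro s t (h | ⟨h, -⟩)
    · exact h.le
    · exact h.le

end FreeOrder

end Algebra

/-! ### Division and S-polynomials in modules with a monomial basis -/

variable {K : Type*} [Field K] {n : ℕ} {ι V : Type*} [AddCommGroup V] [Module K V]

/-- The properties of a module with a monomial basis and an action of monomials that the theory of
Gröbner bases depends on. -/
structure MonomialModule.Admissible (X : MonomialModule K n ι V)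
    (r : Expo n × ι → Expo n × ι → Prop) where
  repr : V ≃ₗ[K] (Expo n × ι →₀ K)
  coef_eq : ∀ v s, X.coef v s = repr v s
  mon_eq : ∀ s, X.mon s = repr.symm (Finsupp.single s 1)
  actL : Expo n → V →ₗ[K] V
  act_eq : ∀ α v, X.act α v = actL α v
  strictTotal : IsStrictTotal r
  wf : WellFounded r
  shift_lt : ∀ γ s t, r s t → r (shift γ s) (shift γ t)
  le_shift : ∀ γ s, RLe r s (shift γ s)
  lead : ∀ α s, IsLeading r (X.coef (X.act α (X.mon s))) (shift α s)
  act_act : ∀ α β, ∃ c : Expo n →₀ K, c (α + β) ≠ 0 ∧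
    (∀ γ, c γ ≠ 0 → γ = α + β ∨ ∀ s : Expo n × ι, r (shift γ s) (shift (α + β) s)) ∧
    ∀ v, X.act α (X.act β v) = X.evalAct c v

namespace MonomialModule

variable {X : MonomialModule K n ι V} {r : Expo n × ι → Expo n × ι → Prop}

namespace Admissible

theorem coef_zero (hX : X.Admissible r) (s) : X.coef 0 s = 0 := by simp [hX.coef_eq]

theorem coef_add (hX : X.Admissible r) (v w s) :
    X.coef (v + w) s = X.coef v s + X.coef w s := by simp [hX.coef_eq]

theorem coef_sub (hX : X.Admissible r) (v w s) :
    X.coef (v - w) s = X.coef v s - X.coef w s := by simp [hX.coef_eq]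

theorem coef_smul (hX : X.Admissible r) (c : K) (v s) :
    X.coef (c • v) s = c * X.coef v s := by simp [hX.coef_eq]

theorem coef_mon (hX : X.Admissible r) (s t) :
    X.coef (X.mon s) t = if s = t then 1 else 0 := by
  simp [hX.coef_eq, hX.mon_eq, Finsupp.single_apply]

theorem ext (hX : X.Admissible r) {v w : V} (h : ∀ s, X.coef v s = X.coef w s) : v = w := by
  apply hX.repr.injective
  ext s
  rw [← hX.coef_eq, ← hX.coef_eq, h]

/-- The elements whose monomials lie in `D`. -/
def suppIn (hX : X.Admissible r) (D : Set (Expo n × ι)) : Submodule K V :=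
  (Finsupp.supported K K D).comap hX.repr.toLinearMap

theorem mem_suppIn (hX : X.Admissible r) {D : Set (Expo n × ι)} {v : V} :
    v ∈ hX.suppIn D ↔ ∀ t, X.coef v t ≠ 0 → t ∈ D := by
  simp only [suppIn, Submodule.mem_comap, Finsupp.mem_supported, Set.subset_def,
    Finset.mem_coe, Finsupp.mem_support_iff, hX.coef_eq]
  rfl

theorem exists_isLeading (hX : X.Admissible r) {v : V} (hv : v ≠ 0) :
    ∃ s, IsLeading r (X.coef v) s := by
  refine SolvPoly.exists_isLeading hX.strictTotal ?_ fun h => hv ?_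
  · refine (hX.repr v).support.finite_toSet.subset fun s hs => ?_
    simpa [hX.coef_eq] using hs
  · exact hX.ext fun s => by rw [h, hX.coef_zero]; rfl

theorem ne_zero_of_isLeading (hX : X.Admissible r) {v : V} {s}
    (h : IsLeading r (X.coef v) s) : v ≠ 0 := by
  rintro rfl
  exact h.1 (hX.coef_zero s)

theorem lm_eq_some (hX : X.Admissible r) {v : V} {s} :
    X.lm r v = some s ↔ IsLeading r (X.coef v) s := leadOpt_eq_some hX.strictTotal

theorem divides_iff (hX : X.Admissible r) {v : V} {s α} :
    X.Divides r v s α ↔ ∃ t, IsLeading r (X.coef v) t ∧ shift α t = s := by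
  simp only [Divides, hX.lm_eq_some, shift, Prod.ext_iff]
  exact exists_congr fun t => and_congr_right fun _ => and_comm

theorem coef_act (hX : X.Admissible r) (α : Expo n) (v : V) (u : Expo n × ι) :
    X.coef (X.act α v) u =
      ∑ t ∈ (hX.repr v).support, X.coef v t * X.coef (X.act α (X.mon t)) u := by
  have hv : v = ∑ t ∈ (hX.repr v).support, X.coef v t • X.mon t := by
    apply hX.repr.injective
    simp only [map_sum, map_smul, hX.mon_eq, LinearEquiv.apply_symm_apply, hX.coef_eq,
      Finsupp.smul_single, smul_eq_mul, mul_one]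
    exact (Finsupp.sum_single _).symm
  conv_lhs => rw [hv]
  simp [hX.coef_eq, hX.act_eq, Finsupp.finsetSum_apply]

/-- Shifting is strictly monotone, so at `shift α s` only the leading term of `v` contributes and no
cancellation is possible. -/
theorem lead_act (hX : X.Admissible r) {v : V} {s} (α : Expo n)
    (h : IsLeading r (X.coef v) s) : IsLeading r (X.coef (X.act α v)) (shift α s) := by
  constructor
  · rw [hX.coef_act, Finset.sum_eq_single s]
    · exact mul_ne_zero h.1 (hX.lead α s).1
    · intro t ht hne
      rw [Finsupp.mem_support_iff, ← hX.coef_eq] at ht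
      have hlt := hX.shift_lt α _ _ ((h.2 t ht).resolve_left hne)
      by_contra hne'
      have := (hX.lead α t).2 _ (right_ne_zero_of_mul hne')
      exact hX.strictTotal.irrefl _ (hX.strictTotal.lt_of_lt_of_le hlt this)
    · intro hs
      rw [Finsupp.notMem_support_iff, ← hX.coef_eq] at hs
      exact absurd hs h.1
  · intro u hu
    rw [hX.coef_act] at hu
    obtain ⟨t, -, ht⟩ := Finset.exists_ne_zero_of_sum_ne_zero hu
    refine hX.strictTotal.le_trans ((hX.lead α t).2 _ (right_ne_zero_of_mul ht)) ?_
    rcases h.2 t (left_ne_zero_of_mul ht) with rfl | h1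
    · exact RLe.refl _
    · exact Or.inr (hX.shift_lt _ _ _ h1)

/-- The cancellation common to division steps, S-polynomials and Schreyer syzygies: `hab` removes
the term at `s`, and everything else was already below it. -/
theorem coef_sub_lead (hX : X.Admissible r) {v w : V} {s} (hv : IsLeading r (X.coef v) s)
    (hw : IsLeading r (X.coef w) s) {a b : K} (hab : a * X.coef v s = b * X.coef w s) {t}
    (ht : X.coef (a • v - b • w) t ≠ 0) : r t s := by
  rw [hX.coef_sub, hX.coef_smul, hX.coef_smul] at ht
  by_cases hts : t = s
  · subst hts
    exact absurd (sub_eq_zero.2 hab) ht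
  · by_cases h : X.coef v t = 0
    · exact (hw.2 t fun h' => ht (by simp [h, h'])).resolve_left hts
    · exact (hv.2 t h).resolve_left hts

theorem lead_mon (hX : X.Admissible r) (s) : IsLeading r (X.coef (X.mon s)) s := by
  refine ⟨by simp [hX.coef_mon], fun t ht => ?_⟩
  rw [hX.coef_mon] at ht
  left
  by_contra hne
  exact ht (if_neg (Ne.symm hne))

/-- Well-founded induction on the leading monomial of the dividend, which drops at every step. -/
theorem exists_divL (hX : X.Admissible r) (Ξ : List V) (ω : V) :
    ∃ q η, X.DivL r Ξ ω q η := by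
  have key : ∀ s, ∀ ω, IsLeading r (X.coef ω) s → ∃ q η, X.DivL r Ξ ω q η := by
    intro s
    induction s using hX.wf.induction with
    | _ s ih =>
      intro ω hω
      -- Covers both kinds of steps: `v` is a multiple of a divisor, or the monomial moved to the
      -- remainder.
      have next : ∀ v, IsLeading r (X.coef v) s → ∀ κ, X.coef ω s = κ * X.coef v s →
          ∃ q η, X.DivL r Ξ (ω - κ • v) q η := by
        intro v hv κ hκ
        by_cases h0 : ω - κ • v = 0
        · exact ⟨_, _, h0 ▸ DivL.zero⟩
        · obtain ⟨t, ht⟩ := hX.exists_isLeading h0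
          refine ih t ?_ _ ht
          refine hX.coef_sub_lead (a := 1) (b := κ) hω hv (by rw [one_mul, hκ]) ?_
          rw [one_smul]
          exact ht.1
      by_cases hd : ∃ k : ℕ, ∃ ξ, Ξ[k]? = some ξ ∧ ∃ α, X.Divides r ξ s α
      -- The least index with a divisor realises the rule that the first possible member is used.
      · obtain ⟨ξ, hξ, α, hα⟩ := Nat.find_spec hd
        obtain ⟨t, ht, hts⟩ := hX.divides_iff.1 hα
        have hl : IsLeading r (X.coef (X.act α ξ)) s := hts ▸ hX.lead_act α ht
        obtain ⟨q, η, hq⟩ := next _ hl ((X.coef (X.act α ξ) s)⁻¹ * X.coef ω s) (by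
          rw [mul_right_comm, inv_mul_cancel₀ hl.1, one_mul])
        refine ⟨_, _, DivL.reduce ω η ξ q s _ α _ (hX.lm_eq_some.2 hω) hξ hα ?_ rfl hq⟩
        intro l hl ζ hζ β hβ
        exact Nat.find_min hd hl ⟨ζ, hζ, β, hβ⟩
      · obtain ⟨q, η, hq⟩ := next _ (hX.lead_mon s) (X.coef ω s) (by simp [hX.coef_mon])
        refine ⟨_, _, DivL.skip ω η q s (hX.lm_eq_some.2 hω) ?_ hq⟩
        intro ζ hζ β hβ
        obtain ⟨k, hk⟩ := List.mem_iff_getElem?.1 hζ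
        exact hd ⟨k, ζ, hk, β, hβ⟩
  by_cases h : ω = 0
  · exact ⟨_, _, h ▸ DivL.zero⟩
  · obtain ⟨s, hs⟩ := hX.exists_isLeading h
    exact key s ω hs

theorem evalAct_add (X : MonomialModule K n ι V) (f g : Expo n →₀ K) (v : V) :
    X.evalAct (f + g) v = X.evalAct f v + X.evalAct g v :=
  Finsupp.sum_add_index' (by simp) (by simp [add_smul])

theorem evalAct_single (X : MonomialModule K n ι V) (α : Expo n) (c : K) (v : V) :
    X.evalAct (Finsupp.single α c) v = c • X.act α v :=
  Finsupp.sum_single_index (by simp)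

@[simp] theorem evalAct_zero (X : MonomialModule K n ι V) (v : V) : X.evalAct 0 v = 0 :=
  Finsupp.sum_zero_index

theorem divL_sum {Ξ : List V} {ω η : V} {q : ℕ → Expo n →₀ K} (h : X.DivL r Ξ ω q η) :
    ω = ∑ k : Fin Ξ.length, X.evalAct (q k) (Ξ.get k) + η := by
  induction h with
  | zero => simp
  | reduce ω η ξ q s k α κ _ hξ _ _ _ _ ih =>
    obtain ⟨hk, hξ⟩ := List.getElem?_eq_some_iff.1 hξ
    have hsum : ∑ l : Fin Ξ.length, X.evalAct
        (Function.update q k (q k + Finsupp.single α κ) l) (Ξ.get l) =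
        ∑ l : Fin Ξ.length, X.evalAct (q l) (Ξ.get l) + κ • X.act α ξ := by
      rw [← Finset.add_sum_erase _ _ (Finset.mem_univ (⟨k, hk⟩ : Fin Ξ.length)),
        ← Finset.add_sum_erase _ (fun l : Fin Ξ.length => X.evalAct (q l) (Ξ.get l))
          (Finset.mem_univ (⟨k, hk⟩ : Fin Ξ.length))]
      have : ∑ l ∈ Finset.univ.erase (⟨k, hk⟩ : Fin Ξ.length), X.evalAct
          (Function.update q k (q k + Finsupp.single α κ) l) (Ξ.get l) =
          ∑ l ∈ Finset.univ.erase (⟨k, hk⟩ : Fin Ξ.length), X.evalAct (q l) (Ξ.get l) := by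
        refine Finset.sum_congr rfl fun l hl => ?_
        rw [Function.update_of_ne]
        exact fun h => Finset.ne_of_mem_erase hl (Fin.ext h)
      rw [this]
      simp only [Function.update_self, evalAct_add, evalAct_single, List.get_eq_getElem, hξ]
      abel
    rw [hsum, add_right_comm, ← ih]
    abel
  | skip ω η q s _ _ _ ih =>
    rw [← add_assoc, ← ih]
    abel

theorem divL_remainder (hX : X.Admissible r) {Ξ : List V} {ω η : V} {q : ℕ → Expo n →₀ K}
    (h : X.DivL r Ξ ω q η) :
    ∀ t, X.coef η t ≠ 0 → ∀ ξ ∈ Ξ, ∀ β, ¬ X.Divides r ξ t β := by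
  induction h with
  | zero => exact fun t ht => absurd (hX.coef_zero t) ht
  | reduce _ _ _ _ _ _ _ _ _ _ _ _ _ _ ih => exact ih
  | skip ω η q s _ hs _ ih =>
    intro t ht
    by_cases hts : s = t
    · exact hts ▸ hs
    · refine ih t ?_
      simpa [hX.coef_add, hX.coef_smul, hX.coef_mon, hts] using ht

/-- Every intermediate dividend stays supported in `D`, since `hD` says so for the multiples that
are subtracted. The set is kept general because it is applied to monomials below a bound, to the
monomials of one fixed degree, and to the empty set. -/
theorem divL_supp (hX : X.Admissible r) {Ξ : List V} {D : Set (Expo n × ι)}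
    (hD : ∀ s ∈ D, ∀ ξ ∈ Ξ, ∀ α, X.Divides r ξ s α → X.act α ξ ∈ hX.suppIn D) {ω η : V}
    {q : ℕ → Expo n →₀ K} (h : X.DivL r Ξ ω q η) (hω : ω ∈ hX.suppIn D) :
    η ∈ hX.suppIn D ∧ ∀ k α, q k α ≠ 0 → ∃ ξ s, Ξ[k]? = some ξ ∧ s ∈ D ∧
      X.Divides r ξ s α := by
  induction h with
  | zero => exact ⟨hω, fun k α h => absurd rfl h⟩
  | reduce ω η ξ q s k α κ hs hξ hα _ _ _ ih =>
    have hsD : s ∈ D := hX.mem_suppIn.1 hω s (hX.lm_eq_some.1 hs).1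
    obtain ⟨h1, h2⟩ := ih (Submodule.sub_mem _ hω (Submodule.smul_mem _ _
      (hD s hsD ξ (List.mem_of_getElem? hξ) α hα)))
    refine ⟨h1, fun l β hβ => ?_⟩
    by_cases hl : l = k
    · subst hl
      rw [Function.update_self] at hβ
      by_cases hαβ : α = β
      · exact ⟨ξ, s, hξ, hsD, hαβ ▸ hα⟩
      · refine h2 l β ?_
        simpa [Finsupp.single_apply, hαβ] using hβ
    · rw [Function.update_of_ne hl] at hβ
      exact h2 l β hβ
  | skip ω η q s hs _ _ ih =>
    have hsD : s ∈ D := hX.mem_suppIn.1 hω s (hX.lm_eq_some.1 hs).1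
    have hm : X.coef ω s • X.mon s ∈ hX.suppIn D := by
      refine Submodule.smul_mem _ _ (hX.mem_suppIn.2 fun t ht => ?_)
      rw [hX.coef_mon] at ht
      by_cases hst : s = t
      · exact hst ▸ hsD
      · exact absurd (if_neg hst) ht
    obtain ⟨h1, h2⟩ := ih (Submodule.sub_mem _ hω hm)
    exact ⟨Submodule.add_mem _ h1 hm, h2⟩

/-- Down-sets are compatible with division. -/
theorem act_mem_suppIn_of_isLower (hX : X.Admissible r) {D : Set (Expo n × ι)}
    (hD : ∀ s t, r t s → s ∈ D → t ∈ D) {s} (hs : s ∈ D) {ξ : V} {α : Expo n}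
    (h : X.Divides r ξ s α) : X.act α ξ ∈ hX.suppIn D := by
  obtain ⟨t, ht, rfl⟩ := hX.divides_iff.1 h
  refine hX.mem_suppIn.2 fun u hu => ?_
  rcases (hX.lead_act α ht).2 u hu with rfl | h'
  · exact hs
  · exact hD _ _ h' hs

/-- The span of the products `a^α g`, `g ∈ G`, with leading monomial in `D`. -/
def repSpan (X : MonomialModule K n ι V) (r : Expo n × ι → Expo n × ι → Prop) (G : Set V)
    (D : Set (Expo n × ι)) : Submodule K V :=
  Submodule.span K {x | ∃ g ∈ G, ∃ α s, X.Divides r g s α ∧ s ∈ D ∧ x = X.act α g}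

theorem repSpan_mono {G G' : Set V} {D D' : Set (Expo n × ι)} (hG : G ⊆ G') (hD : D ⊆ D') :
    repSpan X r G D ≤ repSpan X r G' D' := by
  refine Submodule.span_mono ?_
  rintro x ⟨g, hg, α, s, hα, hs, rfl⟩
  exact ⟨g, hG hg, α, s, hα, hD hs, rfl⟩

theorem evalAct_mem (X : MonomialModule K n ι V) {S : Submodule K V} {f : Expo n →₀ K} {v : V}
    (h : ∀ α, f α ≠ 0 → X.act α v ∈ S) : X.evalAct f v ∈ S :=
  Submodule.sum_mem _ fun α hα => Submodule.smul_mem _ _ (h α (Finsupp.mem_support_iff.1 hα))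

theorem divL_sub_mem (hX : X.Admissible r) {Ξ : List V} {D : Set (Expo n × ι)}
    (hD : ∀ s ∈ D, ∀ ξ ∈ Ξ, ∀ α, X.Divides r ξ s α → X.act α ξ ∈ hX.suppIn D) {ω η : V}
    {q : ℕ → Expo n →₀ K} (h : X.DivL r Ξ ω q η) (hω : ω ∈ hX.suppIn D) :
    ω - η ∈ repSpan X r {x | x ∈ Ξ} D := by
  rw [divL_sum h, add_sub_cancel_right]
  refine Submodule.sum_mem _ fun k _ => evalAct_mem X fun α hα => ?_
  obtain ⟨ξ, s, hξ, hs, hd⟩ := (hX.divL_supp hD h hω).2 k α hα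
  obtain ⟨hk, hξ⟩ := List.getElem?_eq_some_iff.1 hξ
  refine Submodule.subset_span ⟨ξ, hξ ▸ List.getElem_mem hk, α, s, hd, hs, ?_⟩
  simp [← hξ]

/-! #### S-polynomials -/

theorem cof_eq (hX : X.Admissible r) {ξ ζ : V} {s t} (hs : IsLeading r (X.coef ξ) s)
    (ht : IsLeading r (X.coef ζ) t) (hst : s.2 = t.2) :
    X.cof r ξ ζ = Finsupp.single (s.1 ⊔ t.1 - s.1)
      (X.coef (X.act (s.1 ⊔ t.1 - s.1) ξ) (s.1 ⊔ t.1, s.2))⁻¹ := by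
  simp [cof, hX.lm_eq_some.2 hs, hX.lm_eq_some.2 ht, hst]

theorem cof_eq_zero (hX : X.Admissible r) {ξ ζ : V} {s t} (hs : IsLeading r (X.coef ξ) s)
    (ht : IsLeading r (X.coef ζ) t) (hst : s.2 ≠ t.2) : X.cof r ξ ζ = 0 := by
  simp [cof, hX.lm_eq_some.2 hs, hX.lm_eq_some.2 ht, hst]

theorem sPoly_eq_zero (hX : X.Admissible r) {ξ ζ : V} {s t} (hs : IsLeading r (X.coef ξ) s)
    (ht : IsLeading r (X.coef ζ) t) (hst : s.2 ≠ t.2) : X.sPoly r ξ ζ = 0 := by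
  simp [sPoly, hX.cof_eq_zero hs ht hst, hX.cof_eq_zero ht hs hst.symm]

theorem sPoly_swap (ξ ζ : V) : X.sPoly r ζ ξ = - X.sPoly r ξ ζ := by simp [sPoly]

theorem shift_sup_sub_left (s t : Expo n × ι) :
    shift (s.1 ⊔ t.1 - s.1) s = (s.1 ⊔ t.1, s.2) :=
  Prod.ext (tsub_add_cancel_of_le le_sup_left) rfl

theorem shift_sup_sub_right {s t : Expo n × ι} (h : s.2 = t.2) :
    shift (s.1 ⊔ t.1 - t.1) t = (s.1 ⊔ t.1, s.2) :=
  Prod.ext (tsub_add_cancel_of_le le_sup_right) h.symm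

/-- For leading monomials in the same component, the S-polynomial is a combination of
two multiples with cancelling leading terms. -/
theorem sPoly_spec (hX : X.Admissible r) {ξ ζ : V} {s t} (hs : IsLeading r (X.coef ξ) s)
    (ht : IsLeading r (X.coef ζ) t) (hst : s.2 = t.2) :
    ∃ a b : K, a ≠ 0 ∧ b ≠ 0 ∧ X.cof r ξ ζ = Finsupp.single (s.1 ⊔ t.1 - s.1) a ∧
      X.cof r ζ ξ = Finsupp.single (s.1 ⊔ t.1 - t.1) b ∧
      X.sPoly r ξ ζ = a • X.act (s.1 ⊔ t.1 - s.1) ξ - b • X.act (s.1 ⊔ t.1 - t.1) ζ ∧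
      X.sPoly r ξ ζ ∈ hX.suppIn {u | r u (s.1 ⊔ t.1, s.2)} := by
  have h1 := hX.lead_act (s.1 ⊔ t.1 - s.1) hs
  have h2 := hX.lead_act (s.1 ⊔ t.1 - t.1) ht
  rw [shift_sup_sub_left] at h1
  rw [shift_sup_sub_right hst] at h2
  have hc1 := hX.cof_eq hs ht hst
  have hc2 := hX.cof_eq ht hs hst.symm
  rw [sup_comm t.1, ← hst] at hc2
  have hS : X.sPoly r ξ ζ = (X.coef (X.act (s.1 ⊔ t.1 - s.1) ξ) (s.1 ⊔ t.1, s.2))⁻¹ •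
      X.act (s.1 ⊔ t.1 - s.1) ξ - (X.coef (X.act (s.1 ⊔ t.1 - t.1) ζ) (s.1 ⊔ t.1, s.2))⁻¹ •
      X.act (s.1 ⊔ t.1 - t.1) ζ := by
    rw [sPoly, hc1, hc2, evalAct_single, evalAct_single]
  refine ⟨_, _, inv_ne_zero h1.1, inv_ne_zero h2.1, hc1, hc2, hS, ?_⟩
  refine hX.mem_suppIn.2 fun u hu => ?_
  rw [hS] at hu
  exact hX.coef_sub_lead h1 h2 (by rw [inv_mul_cancel₀ h1.1, inv_mul_cancel₀ h2.1]) hu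

end Admissible

/-! #### Buchberger's criterion and Schreyer's theorem, in a common form -/

section Buchberger

variable {Z κ : Type*} [AddCommGroup Z] [Module K Z]

/-- The span of the elements `mono k α`, standing for `a^α ε_k`, for which the monomial
`a^α (lead k)` lies in `D`. -/
def monoSpan (K : Type*) [Field K] {n : ℕ} {ι Z κ : Type*} [AddCommGroup Z] [Module K Z]
    (lead : κ → Expo n × ι) (mono : κ → Expo n → Z) (D : Set (Expo n × ι)) : Submodule K Z :=
  Submodule.span K {z | ∃ k α, shift α (lead k) ∈ D ∧ z = mono k α}

variable {lead : κ → Expo n × ι} {mono : κ → Expo n → Z}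

theorem monoSpan_mono {D D' : Set (Expo n × ι)} (h : D ⊆ D') :
    monoSpan K lead mono D ≤ monoSpan K lead mono D' := by
  refine Submodule.span_mono ?_
  rintro z ⟨k, α, hk, rfl⟩
  exact ⟨k, α, h hk, rfl⟩

theorem mem_monoSpan {D : Set (Expo n × ι)} {k : κ} {α : Expo n}
    (h : shift α (lead k) ∈ D) : mono k α ∈ monoSpan K lead mono D :=
  Submodule.subset_span ⟨k, α, h, rfl⟩

theorem exists_mem_monoSpan_le (hr : IsStrictTotal r) {D : Set (Expo n × ι)} {z : Z}
    (hz : z ∈ monoSpan K lead mono D) :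
    z = 0 ∨ ∃ s ∈ D, z ∈ monoSpan K lead mono {t | RLe r t s} := by
  induction hz using Submodule.span_induction with
  | mem z hz =>
    obtain ⟨k, α, hk, rfl⟩ := hz
    exact Or.inr ⟨_, hk, mem_monoSpan (RLe.refl _)⟩
  | zero => exact Or.inl rfl
  | add x y _ _ hx hy =>
    rcases hx with rfl | ⟨s, hs, hx⟩
    · simpa using hy
    · rcases hy with rfl | ⟨t, ht, hy⟩
      · exact Or.inr ⟨s, hs, by simpa using hx⟩
      · right
        rcases hr.le_or_lt s t with h | h
        · refine ⟨t, ht, Submodule.add_mem _ (monoSpan_mono ?_ hx) hy⟩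
          exact fun u hu => hr.le_trans hu h
        · refine ⟨s, hs, Submodule.add_mem _ hx (monoSpan_mono ?_ hy)⟩
          exact fun u hu => hr.le_trans hu (Or.inr h)
  | smul c x _ hx =>
    rcases hx with rfl | ⟨s, hs, hx⟩
    · exact Or.inl (smul_zero c)
    · exact Or.inr ⟨s, hs, Submodule.smul_mem _ _ hx⟩

theorem Admissible.map_monoSpan_le (hX : X.Admissible r) {φ : Z →ₗ[K] V}
    (hlead : ∀ k α, IsLeading r (X.coef (φ (mono k α))) (shift α (lead k)))
    {D : Set (Expo n × ι)} (hD : ∀ s t, r t s → s ∈ D → t ∈ D) :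
    monoSpan K lead mono D ≤ (hX.suppIn D).comap φ := by
  refine Submodule.span_le.2 ?_
  rintro z ⟨k, α, hk, rfl⟩
  refine hX.mem_suppIn.2 fun t ht => ?_
  rcases (hlead k α).2 t ht with rfl | h
  · exact hk
  · exact hD _ _ h hk

theorem Admissible.isLower_lt (hX : X.Admissible r) (s : Expo n × ι) :
    ∀ u t, r t u → u ∈ {t | r t s} → t ∈ {t | r t s} :=
  fun _ _ h h' => hX.strictTotal.trans _ _ _ h h'

/-- Let `φ : Z → V` send the elements `mono k α` to elements with leading monomials
`a^α (lead k)`, and let `T` be stable under the action of the monomials. If for all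
`j`, `k` for which the least common multiple of the leading monomials lies in `D` the S-pair
belongs to `T` up to smaller terms, then each element of `Z` involving only terms in `D` is
congruent modulo `T` to one whose terms do not exceed the leading monomial of its image. -/
theorem Admissible.exists_standard_rep (hX : X.Admissible r) (φ : Z →ₗ[K] V)
    (hlead : ∀ k α, IsLeading r (X.coef (φ (mono k α))) (shift α (lead k)))
    (actZ : Expo n → Z →ₗ[K] Z)
    (hact : ∀ α β, ∃ c : Expo n →₀ K, c (α + β) ≠ 0 ∧
      (∀ γ, c γ ≠ 0 → γ = α + β ∨ ∀ s : Expo n × ι, r (shift γ s) (shift (α + β) s)) ∧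
      ∀ k, actZ α (mono k β) = c.sum fun γ μ => μ • mono k γ)
    (T : Submodule K Z) (hT : ∀ δ, ∀ z ∈ T, actZ δ z ∈ T)
    {D : Set (Expo n × ι)} (hD : ∀ s t, r t s → s ∈ D → t ∈ D)
    (hS : ∀ j k, (lead j).2 = (lead k).2 → ((lead j).1 ⊔ (lead k).1, (lead j).2) ∈ D →
      ∃ a b : K, a ≠ 0 ∧ b ≠ 0 ∧ a • mono j ((lead j).1 ⊔ (lead k).1 - (lead j).1) -
        b • mono k ((lead j).1 ⊔ (lead k).1 - (lead k).1) ∈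
          T ⊔ monoSpan K lead mono {t | r t ((lead j).1 ⊔ (lead k).1, (lead j).2)})
    {z : Z} (hz : z ∈ monoSpan K lead mono D) :
    ∃ z', z - z' ∈ T ∧ (z' = 0 ∨ ∃ s, IsLeading r (X.coef (φ z')) s ∧
      z' ∈ monoSpan K lead mono {t | RLe r t s}) := by
  have hr := hX.strictTotal
  -- the action on small terms
  have hactLt : ∀ δ s, ∀ z ∈ monoSpan K lead mono {t | r t s},
      actZ δ z ∈ monoSpan K lead mono {t | r t (shift δ s)} := by
    intro δ s
    suffices h : monoSpan K lead mono {t | r t s} ≤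
        (monoSpan K lead mono {t | r t (shift δ s)}).comap (actZ δ) from fun z hz => h hz
    refine Submodule.span_le.2 ?_
    rintro z ⟨k, β, hk, rfl⟩
    obtain ⟨c, -, hc, hck⟩ := hact δ β
    simp only [Submodule.comap_coe, Set.mem_preimage, SetLike.mem_coe, hck]
    refine Submodule.sum_mem _ fun γ hγ => Submodule.smul_mem _ _ (mem_monoSpan ?_)
    have h1 : r (shift (δ + β) (lead k)) (shift δ s) := by
      rw [← shift_shift]
      exact hX.shift_lt _ _ _ hk
    rcases hc γ (Finsupp.mem_support_iff.1 hγ) with rfl | h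
    · exact h1
    · exact hr.trans _ _ _ (h _) h1
  have hactTop : ∀ δ k β, ∃ c : K, c ≠ 0 ∧ actZ δ (mono k β) - c • mono k (δ + β) ∈
      monoSpan K lead mono {t | r t (shift (δ + β) (lead k))} := by
    intro δ k β
    obtain ⟨c, hc0, hc, hck⟩ := hact δ β
    refine ⟨c (δ + β), hc0, ?_⟩
    rw [hck, Finsupp.sum, ← Finset.add_sum_erase _ _ (Finsupp.mem_support_iff.2 hc0),
      add_sub_cancel_left]
    refine Submodule.sum_mem _ fun γ hγ => Submodule.smul_mem _ _ (mem_monoSpan ?_)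
    rw [Finset.mem_erase, Finsupp.mem_support_iff] at hγ
    exact ((hc γ hγ.2).resolve_left hγ.1) _
  -- two terms with the same monomial are proportional up to smaller terms
  have hprop : ∀ s ∈ D, ∀ j k α β, shift α (lead j) = s → shift β (lead k) = s →
      ∃ c : K, mono j α - c • mono k β ∈ T ⊔ monoSpan K lead mono {t | r t s} := by
    intro s hs j k α β hj hk
    have hj' := Prod.ext_iff.1 hj
    have hk' := Prod.ext_iff.1 hk
    simp only [shift_fst, shift_snd] at hj' hk'
    have h2 : (lead j).2 = (lead k).2 := hj'.2.trans hk'.2.symm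
    set m := (lead j).1 ⊔ (lead k).1 with hm
    have hms : m ≤ s.1 := sup_le (hj'.1 ▸ le_add_self) (hk'.1 ▸ le_add_self)
    have hδ : shift (s.1 - m) (m, (lead j).2) = s := Prod.ext (tsub_add_cancel_of_le hms) hj'.2
    -- The least common multiple divides `s`, hence does not exceed it, and `D` is a down-set.
    have hlD : (m, (lead j).2) ∈ D := by
      have := hX.le_shift (s.1 - m) (m, (lead j).2)
      rw [hδ] at this
      rcases this with h | h
      · exact h ▸ hs
      · exact hD _ _ h hs
    obtain ⟨a, b, ha, hb, hab⟩ := hS j k h2 hlD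
    rw [← hm] at hab
    have hα : s.1 - m + (m - (lead j).1) = α := by
      rw [tsub_add_tsub_cancel hms le_sup_left, ← hj'.1, add_tsub_cancel_right]
    have hβ : s.1 - m + (m - (lead k).1) = β := by
      rw [tsub_add_tsub_cancel hms le_sup_right, ← hk'.1, add_tsub_cancel_right]
    obtain ⟨u, hu, hu'⟩ := hactTop (s.1 - m) j (m - (lead j).1)
    obtain ⟨v, hv, hv'⟩ := hactTop (s.1 - m) k (m - (lead k).1)
    rw [hα, hj] at hu'
    rw [hβ, hk] at hv'
    -- Multiply the S-pair relation by the quotient of `s` by the least common multiple: `T` is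
    -- stable, and terms below the least common multiple become terms below `s`.
    have hmain : actZ (s.1 - m) (a • mono j (m - (lead j).1) - b • mono k (m - (lead k).1)) ∈
        T ⊔ monoSpan K lead mono {t | r t s} := by
      obtain ⟨τ, hτ, w, hw, hτw⟩ := Submodule.mem_sup.1 hab
      rw [← hτw, map_add]
      have := hactLt (s.1 - m) _ w hw
      rw [hδ] at this
      exact Submodule.add_mem_sup (hT _ _ hτ) this
    have hau : a * u ≠ 0 := mul_ne_zero ha hu
    refine ⟨(a * u)⁻¹ * (b * v), ?_⟩
    have h3 : (a * u) • mono j α - (b * v) • mono k β ∈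
        T ⊔ monoSpan K lead mono {t | r t s} := by
      have e : (a * u) • mono j α - (b * v) • mono k β =
          actZ (s.1 - m) (a • mono j (m - (lead j).1) - b • mono k (m - (lead k).1)) -
          a • (actZ (s.1 - m) (mono j (m - (lead j).1)) - u • mono j α) +
          b • (actZ (s.1 - m) (mono k (m - (lead k).1)) - v • mono k β) := by
        simp only [map_sub, map_smul, smul_sub, mul_smul]
        abel
      rw [e]
      exact Submodule.add_mem _ (Submodule.sub_mem _ hmain
        (Submodule.smul_mem _ _ (Submodule.mem_sup_right hu')))
        (Submodule.smul_mem _ _ (Submodule.mem_sup_right hv'))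
    have h4 := Submodule.smul_mem _ (a * u)⁻¹ h3
    rwa [smul_sub, smul_smul, inv_mul_cancel₀ hau, one_smul, smul_smul] at h4
  -- induction
  have key : ∀ s, s ∈ D → ∀ z ∈ monoSpan K lead mono {t | RLe r t s},
      ∃ z', z - z' ∈ T ∧ (z' = 0 ∨ ∃ s, IsLeading r (X.coef (φ z')) s ∧
        z' ∈ monoSpan K lead mono {t | RLe r t s}) := by
    intro s
    induction s using hX.wf.induction with
    | _ s ih =>
    intro hs z hz
    have hsmall : ∀ u ∈ monoSpan K lead mono {t | r t s}, ∃ z', u - z' ∈ T ∧ (z' = 0 ∨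
        ∃ s, IsLeading r (X.coef (φ z')) s ∧ z' ∈ monoSpan K lead mono {t | RLe r t s}) := by
      intro u hu
      rcases exists_mem_monoSpan_le hr hu with rfl | ⟨t, ht, hut⟩
      · exact ⟨0, by simp, Or.inl rfl⟩
      · exact ih t ht (hD _ _ ht hs) u hut
    by_cases hex : ∃ k α, shift α (lead k) = s
    · obtain ⟨k, β, hk⟩ := hex
      -- One fixed term with monomial `s` serves for all: modulo `T` and smaller terms, the others
      -- are scalar multiples of it.
      have hle : monoSpan K lead mono {t | RLe r t s} ≤
          Submodule.span K {mono k β} ⊔ (T ⊔ monoSpan K lead mono {t | r t s}) := by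
        refine Submodule.span_le.2 ?_
        rintro z ⟨j, α, hj | hj, rfl⟩
        · obtain ⟨c, hc⟩ := hprop s hs j k α β hj hk
          have := Submodule.add_mem_sup (Submodule.smul_mem _ c
            (Submodule.mem_span_singleton_self (R := K) (mono k β))) hc
          simpa using this
        · exact Submodule.mem_sup_right (Submodule.mem_sup_right (mem_monoSpan hj))
      obtain ⟨x, hx, y, hy, rfl⟩ := Submodule.mem_sup.1 (hle hz)
      obtain ⟨τ, hτ, u, hu, rfl⟩ := Submodule.mem_sup.1 hy
      obtain ⟨c, rfl⟩ := Submodule.mem_span_singleton.1 hx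
      -- If the total coefficient at `s` vanishes, only smaller terms remain and the induction
      -- applies. Otherwise nothing cancels at `s`, so `s` is the leading monomial of the image and
      -- the representation is already standard.
      by_cases hc : c = 0
      · obtain ⟨z', h1, h2⟩ := hsmall u hu
        refine ⟨z', ?_, h2⟩
        have e : c • mono k β + (τ + u) - z' = τ + (u - z') := by
          simp only [hc, zero_smul]
          abel
        rw [e]
        exact Submodule.add_mem _ hτ h1
      · refine ⟨c • mono k β + u, ?_, Or.inr ⟨s, ?_, ?_⟩⟩
        · have e : c • mono k β + (τ + u) - (c • mono k β + u) = τ := by abel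
          rwa [e]
        · have hu' : φ u ∈ hX.suppIn {t | r t s} :=
            hX.map_monoSpan_le hlead (hX.isLower_lt s) hu
          have h0 : X.coef (φ u) s = 0 := by
            by_contra h
            exact hr.irrefl _ (hX.mem_suppIn.1 hu' s h)
          have hl := hlead k β
          rw [hk] at hl
          rw [map_add, map_smul]
          refine ⟨?_, fun t ht => ?_⟩
          · rw [hX.coef_add, hX.coef_smul, h0, add_zero]
            exact mul_ne_zero hc hl.1
          · by_cases h1 : X.coef (φ u) t = 0
            · rw [hX.coef_add, hX.coef_smul, h1, add_zero] at ht
              exact hl.2 t (right_ne_zero_of_mul ht)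
            · exact Or.inr (hX.mem_suppIn.1 hu' t h1)
        · exact Submodule.add_mem _ (Submodule.smul_mem _ _ (mem_monoSpan (Or.inl hk)))
            (monoSpan_mono (fun t ht => Or.inr ht) hu)
    · refine hsmall z ?_
      refine Submodule.span_mono ?_ hz
      rintro z ⟨j, α, hj | hj, rfl⟩
      · exact absurd ⟨j, α, hj⟩ hex
      · exact ⟨j, α, hj, rfl⟩
  rcases exists_mem_monoSpan_le hr hz with rfl | ⟨s, hs, hzs⟩
  · exact ⟨0, by simp, Or.inl rfl⟩
  · exact key s hs z hzs

end Buchberger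

namespace Admissible

/-- Without a divisor of `s`, all products in the representation would have leading monomials
strictly below `s`, and `s` could not occur in `x`. -/
theorem exists_mdvd_of_mem_repSpan (hX : X.Admissible r) {G : Set V} {x : V} {s}
    (hs : IsLeading r (X.coef x) s) (hx : x ∈ repSpan X r G {t | RLe r t s}) :
    ∃ g ∈ G, ∃ α, X.Divides r g s α := by
  by_contra hno
  have : repSpan X r G {t | RLe r t s} ≤ hX.suppIn {t | r t s} := by
    refine Submodule.span_le.2 ?_
    rintro y ⟨g, hg, α, t, hd, ht | ht, rfl⟩
    · exact absurd ⟨g, hg, α, ht ▸ hd⟩ hno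
    · exact hX.act_mem_suppIn_of_isLower (hX.isLower_lt s) ht hd
  exact hX.strictTotal.irrefl _ (hX.mem_suppIn.1 (this hx) s hs.1)

/-- The S-polynomial of `g` and `h` has a representation with terms smaller than the least
common multiple of the leading monomials. -/
def SPairReduces (X : MonomialModule K n ι V) (r : Expo n × ι → Expo n × ι → Prop)
    (G : Set V) (g h : V) : Prop :=
  ∀ s t, IsLeading r (X.coef g) s → IsLeading r (X.coef h) t → s.2 = t.2 →
    X.sPoly r g h ∈ repSpan X r G {u | r u (s.1 ⊔ t.1, s.2)}

theorem SPairReduces.mono {G G' : Set V} {g h : V} (hG : G ⊆ G')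
    (H : SPairReduces X r G g h) : SPairReduces X r G' g h :=
  fun s t hs ht hst => repSpan_mono hG le_rfl (H s t hs ht hst)

/-- The S-polynomial lives below the least common multiple, hence so do all terms of the division. A
nonzero remainder is admitted if it belongs to the enlarged set: it is then its own multiple by
$a^0$, which is why $a^0$ has to act as the identity. -/
theorem sPairReduces_of_divL (hX : X.Admissible r) {Ξ : List V} {g h η : V}
    {q : ℕ → Expo n →₀ K} (hd : X.DivL r Ξ (X.sPoly r g h) q η) {G : Set V}
    (hΞ : {x | x ∈ Ξ} ⊆ G) (hη : η = 0 ∨ η ∈ G ∧ ∀ v, X.act 0 v = v) :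
    SPairReduces X r G g h := by
  intro s t hs ht hst
  obtain ⟨-, -, -, -, -, -, -, hsupp⟩ := hX.sPoly_spec hs ht hst
  have hD : ∀ s' ∈ {u | r u (s.1 ⊔ t.1, s.2)}, ∀ ξ ∈ Ξ, ∀ α, X.Divides r ξ s' α →
      X.act α ξ ∈ hX.suppIn {u | r u (s.1 ⊔ t.1, s.2)} :=
    fun _ hs' _ _ _ h => hX.act_mem_suppIn_of_isLower (hX.isLower_lt _) hs' h
  have h1 := repSpan_mono hΞ le_rfl (hX.divL_sub_mem hD hd hsupp)
  rcases hη with rfl | ⟨hη, h0⟩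
  · simpa using h1
  · by_cases hz : η = 0
    · simpa [hz] using h1
    · obtain ⟨u, hu⟩ := hX.exists_isLeading hz
      have hu' := hX.mem_suppIn.1 (hX.divL_supp hD hd hsupp).1 u hu.1
      have : η ∈ repSpan X r G {u | r u (s.1 ⊔ t.1, s.2)} :=
        Submodule.subset_span ⟨η, hη, 0, u, hX.divides_iff.2 ⟨u, hu, shift_zero u⟩, hu',
          (h0 η).symm⟩
      simpa using Submodule.add_mem _ h1 this

/-- Buchberger's criterion, truncated to a down-set of monomials. -/
theorem buchberger (hX : X.Admissible r) {G : List V} (hG : ∀ g ∈ G, g ≠ 0)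
    {D : Set (Expo n × ι)} (hD : ∀ s t, r t s → s ∈ D → t ∈ D)
    (hS : ∀ (i j : ℕ) g h, i < j → G[i]? = some g → G[j]? = some h →
      (∀ s t, IsLeading r (X.coef g) s → IsLeading r (X.coef h) t → s.2 = t.2 →
        (s.1 ⊔ t.1, s.2) ∈ D) → SPairReduces X r {x | x ∈ G} g h)
    {x : V} (hx : x ∈ repSpan X r {x | x ∈ G} D) (hx0 : x ≠ 0) :
    ∃ s, IsLeading r (X.coef x) s ∧ x ∈ repSpan X r {x | x ∈ G} {t | RLe r t s} := by
  have hr := hX.strictTotal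
  choose lead hlead using fun k : Fin G.length =>
    hX.exists_isLeading (hG (G.get k) (List.get_mem G k))
  have hspan : ∀ D, monoSpan K lead (fun k α => X.act α (G.get k)) D =
      repSpan X r {x | x ∈ G} D := by
    intro D
    unfold monoSpan repSpan
    congr 1
    ext z
    constructor
    · rintro ⟨k, α, hk, rfl⟩
      exact ⟨_, List.get_mem G k, α, _, hX.divides_iff.2 ⟨_, hlead k, rfl⟩, hk, rfl⟩
    · rintro ⟨g, hg, α, s, hd, hs, rfl⟩
      obtain ⟨k, rfl⟩ := List.get_of_mem hg
      obtain ⟨t, ht, rfl⟩ := hX.divides_iff.1 hd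
      rw [IsLeading.unique hr ht (hlead k)] at hs
      exact ⟨k, α, hs, rfl⟩
  -- The hypothesis covers ordered pairs only; equal indices give zero, and reversed ones only
  -- change the sign.
  have hS' : ∀ j k, (lead j).2 = (lead k).2 →
      ((lead j).1 ⊔ (lead k).1, (lead j).2) ∈ D → X.sPoly r (G.get j) (G.get k) ∈
        monoSpan K lead (fun k α => X.act α (G.get k))
          {t | r t ((lead j).1 ⊔ (lead k).1, (lead j).2)} := by
    intro j k h2 hl
    rw [hspan]
    rcases lt_trichotomy j k with h | rfl | h
    · refine hS j k _ _ h (by simp) (by simp) ?_ _ _ (hlead j) (hlead k) h2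
      intro s t hs ht _
      rwa [IsLeading.unique hr hs (hlead j), IsLeading.unique hr ht (hlead k)]
    · simp [sPoly]
    · rw [sPoly_swap, h2, sup_comm (lead j).1]
      refine Submodule.neg_mem _ (hS k j _ _ h (by simp) (by simp) ?_ _ _ (hlead k) (hlead j)
        h2.symm)
      intro s t hs ht _
      rwa [IsLeading.unique hr hs (hlead k), IsLeading.unique hr ht (hlead j), sup_comm, ← h2]
  rw [← hspan] at hx
  -- With `Z = V`, the identity map and `T = ⊥`, the element may not be changed at all, so it has a
  -- standard representation itself.
  obtain ⟨z, hz, hz'⟩ := hX.exists_standard_rep (lead := lead) LinearMap.id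
    (fun k α => hX.lead_act α (hlead k)) hX.actL
    (fun α β => by
      obtain ⟨c, hc, hc', h⟩ := hX.act_act α β
      exact ⟨c, hc, hc', fun k => by rw [← hX.act_eq, h]; rfl⟩)
    ⊥ (by simp) hD
    (fun j k h2 hl => by
      obtain ⟨a, b, ha, hb, -, -, hab, -⟩ := hX.sPoly_spec (hlead j) (hlead k) h2
      refine ⟨a, b, ha, hb, ?_⟩
      rw [← hab, bot_sup_eq]
      exact hS' j k h2 hl) hx
  obtain rfl : x = z := by simpa [sub_eq_zero] using hz
  obtain ⟨s, hs, hs'⟩ := hz'.resolve_left hx0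
  exact ⟨s, hs, hspan _ ▸ hs'⟩

end Admissible

end MonomialModule

/-! ### The filtered free module and its associated graded module are admissible -/

variable {K A : Type*} [Field K] [Ring A] [Algebra K A] {n : ℕ} (P : GradedSolvPolyAlg K A n)

theorem GradedSolvPolyAlg.sum_repr (x : A) :
    (P.basis.repr x).sum (fun γ μ => μ • P.basis γ) = x :=
  P.basis.linearCombination_repr x

theorem GradedSolvPolyAlg.toA_repr (x : A) : P.toA (P.basis.repr x) = x := P.sum_repr x

@[simp] theorem GradedSolvPolyAlg.toA_single (α : Expo n) (κ : K) :
    P.toA (Finsupp.single α κ) = κ • P.basis α := Finsupp.sum_single_index (by simp)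

/-! ### The free module over the algebra -/

section Free

variable {ι : Type*}

theorem evalAct_freeMod (f : Expo n →₀ K) (v : ι → A) :
    (freeMod P ι).evalAct f v = P.toA f • v := by
  simp only [MonomialModule.evalAct, GradedSolvPolyAlg.toA, freeMod, Finsupp.sum,
    Finset.sum_smul, smul_assoc]

/-- The coordinates of the elements of a free module with respect to the monomials. -/
def freeRepr (ι : Type*) [Finite ι] : (ι → A) ≃ₗ[K] (Expo n × ι →₀ K) :=
  (LinearEquiv.piCongrRight fun _ : ι => P.basis.repr) ≪≫ₗ
    (Finsupp.linearEquivFunOnFinite K (Expo n →₀ K) ι).symm ≪≫ₗ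
    (Finsupp.curryLinearEquiv K).symm ≪≫ₗ Finsupp.domLCongr (Equiv.prodComm ι (Expo n))

theorem freeRepr_apply [Finite ι] (v : ι → A) (s : Expo n × ι) :
    freeRepr P ι v s = P.coef v s := by
  obtain ⟨α, i⟩ := s
  simp [freeRepr, Finsupp.domLCongr_apply, GradedSolvPolyAlg.coef, Finsupp.curryLinearEquiv]

theorem coef_mon (s t : Expo n × ι) : P.coef (P.mon s) t = if s = t then 1 else 0 :=
  coef_single_basis P s.1 t.1 s.2 t.2

variable {P} {b : ι → ℕ} {r : Expo n × ι → Expo n × ι → Prop}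

theorem IsGradedLeftMonomialOrdering.le_shift (hr : IsGradedLeftMonomialOrdering P b r)
    (γ : Expo n) (s : Expo n × ι) : RLe r s (shift γ s) := by
  by_cases h : γ = 0
  · left
    simp [h]
  · right
    have := hr.shift_left_lt (P.zero_lt h) s
    rwa [shift_zero] at this

/-- The free module with a graded left monomial ordering. -/
def freeAdm [Finite ι] (hr : IsGradedLeftMonomialOrdering P b r) :
    (freeMod P ι).Admissible r where
  repr := freeRepr P ι
  coef_eq v s := (freeRepr_apply P v s).symm
  mon_eq s := by
    rw [LinearEquiv.eq_symm_apply]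
    ext t
    rw [freeRepr_apply, Finsupp.single_apply]
    exact coef_mon P s t
  actL α := LinearMap.pi fun i => LinearMap.mulLeft K (P.basis α) ∘ₗ LinearMap.proj i
  act_eq α v := rfl
  strictTotal := hr.strictTotal
  wf := hr.wf
  shift_lt γ s t h := hr.shift_lt γ h
  le_shift := hr.le_shift
  lead := hr.isLeading_smul_mon
  act_act α β := by
    have h := P.isLeading_mul α β
    refine ⟨P.basis.repr (P.basis α * P.basis β), h.1, fun γ hγ => ?_, fun v => ?_⟩
    · exact (h.2 γ hγ).imp_right fun h s => hr.shift_left_lt h s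
    · rw [evalAct_freeMod, P.toA_repr]
      exact (mul_smul _ _ v).symm

@[simp] theorem act_zero_freeMod (v : ι → A) : (freeMod P ι).act 0 v = v := by
  simp [freeMod]

end Free

/-! ### Multiplication in the associated graded algebra -/

section Graded

theorem repr_mul_ne_zero {α β γ : Expo n}
    (h : P.basis.repr (P.basis α * P.basis β) γ ≠ 0) :
    P.wdeg γ ≤ P.wdeg α + P.wdeg β := by
  rw [← P.wdeg_add]
  rcases (P.isLeading_mul α β).2 γ h with rfl | h'
  · exact le_rfl
  · exact P.wdeg_le_of_lt h'

/-- The product of monomials in the associated graded algebra. -/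
def gmul (α β : Expo n) : Expo n →₀ K :=
  (P.basis.repr (P.basis α * P.basis β)).filter fun γ => P.wdeg γ = P.wdeg α + P.wdeg β

theorem gmul_apply (α β γ : Expo n) : gmul P α β γ =
    if P.wdeg γ = P.wdeg α + P.wdeg β then P.basis.repr (P.basis α * P.basis β) γ else 0 :=
  Finsupp.filter_apply _ _ _

theorem wdeg_of_gmul_ne_zero {α β γ : Expo n} (h : gmul P α β γ ≠ 0) :
    P.wdeg γ = P.wdeg α + P.wdeg β := by
  rw [gmul_apply] at h
  by_contra hne
  exact h (if_neg hne)

theorem gmul_support_subset (α β : Expo n) :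
    (gmul P α β).support ⊆ (P.basis.repr (P.basis α * P.basis β)).support := by
  intro γ hγ
  rw [Finsupp.mem_support_iff] at hγ ⊢
  intro h
  exact hγ (by rw [gmul_apply, h, ite_self])

/-- One half of associativity of the graded product. Terms that lose degree in the first
multiplication cannot regain it, so the iterated graded product is the full-degree part of $a^\alpha
a^\beta a^\mu$. `gmul_sum_right` gives the same value for the other bracketing. -/
theorem gmul_sum_left (α β μ ν : Expo n) :
    (gmul P β μ).sum (fun γ c => c * gmul P α γ ν) =
      if P.wdeg ν = P.wdeg α + P.wdeg β + P.wdeg μ then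
        P.basis.repr (P.basis α * P.basis β * P.basis μ) ν else 0 := by
  have hS : (gmul P β μ).sum (fun γ c => c * gmul P α γ ν) =
      ∑ γ ∈ (P.basis.repr (P.basis β * P.basis μ)).support, gmul P β μ γ * gmul P α γ ν :=
    Finset.sum_subset (gmul_support_subset P β μ) fun γ _ h => by
      simp [Finsupp.notMem_support_iff.1 h]
  have hR : P.basis.repr (P.basis α * P.basis β * P.basis μ) ν =
      ∑ γ ∈ (P.basis.repr (P.basis β * P.basis μ)).support,
        P.basis.repr (P.basis β * P.basis μ) γ * P.basis.repr (P.basis α * P.basis γ) ν := by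
    rw [mul_assoc]
    conv_lhs => rw [← P.sum_repr (P.basis β * P.basis μ)]
    simp [Finsupp.sum, Finset.mul_sum, Finsupp.finsetSum_apply]
  rw [hS, hR]
  split_ifs with hν
  · refine Finset.sum_congr rfl fun γ _ => ?_
    by_cases h : P.wdeg γ = P.wdeg β + P.wdeg μ
    · rw [gmul_apply, gmul_apply, if_pos h, if_pos (by omega)]
    · rw [gmul_apply, if_neg h, zero_mul]
      by_contra hne
      have h1 := repr_mul_ne_zero P (left_ne_zero_of_mul (Ne.symm hne))
      have h2 := repr_mul_ne_zero P (right_ne_zero_of_mul (Ne.symm hne))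
      omega
  · refine Finset.sum_eq_zero fun γ _ => ?_
    by_contra hne
    have h1 := wdeg_of_gmul_ne_zero P (left_ne_zero_of_mul hne)
    have h2 := wdeg_of_gmul_ne_zero P (right_ne_zero_of_mul hne)
    omega

theorem gmul_sum_right (α β μ ν : Expo n) :
    (gmul P α β).sum (fun γ c => c * gmul P γ μ ν) =
      if P.wdeg ν = P.wdeg α + P.wdeg β + P.wdeg μ then
        P.basis.repr (P.basis α * P.basis β * P.basis μ) ν else 0 := by
  have hS : (gmul P α β).sum (fun γ c => c * gmul P γ μ ν) =
      ∑ γ ∈ (P.basis.repr (P.basis α * P.basis β)).support, gmul P α β γ * gmul P γ μ ν :=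
    Finset.sum_subset (gmul_support_subset P α β) fun γ _ h => by
      simp [Finsupp.notMem_support_iff.1 h]
  have hR : P.basis.repr (P.basis α * P.basis β * P.basis μ) ν =
      ∑ γ ∈ (P.basis.repr (P.basis α * P.basis β)).support,
        P.basis.repr (P.basis α * P.basis β) γ * P.basis.repr (P.basis γ * P.basis μ) ν := by
    conv_lhs => rw [← P.sum_repr (P.basis α * P.basis β)]
    simp [Finsupp.sum, Finset.sum_mul, Finsupp.finsetSum_apply]
  rw [hS, hR]
  split_ifs with hν
  · refine Finset.sum_congr rfl fun γ _ => ?_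
    by_cases h : P.wdeg γ = P.wdeg α + P.wdeg β
    · rw [gmul_apply, gmul_apply, if_pos h, if_pos (by omega)]
    · rw [gmul_apply, if_neg h, zero_mul]
      by_contra hne
      have h1 := repr_mul_ne_zero P (left_ne_zero_of_mul (Ne.symm hne))
      have h2 := repr_mul_ne_zero P (right_ne_zero_of_mul (Ne.symm hne))
      omega
  · refine Finset.sum_eq_zero fun γ _ => ?_
    by_contra hne
    have h1 := wdeg_of_gmul_ne_zero P (left_ne_zero_of_mul hne)
    have h2 := wdeg_of_gmul_ne_zero P (right_ne_zero_of_mul hne)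
    omega

variable (ι : Type*)

/-- The action of a monomial on the associated graded module, as a linear map. -/
def grActL (α : Expo n) : (Expo n × ι →₀ K) →ₗ[K] (Expo n × ι →₀ K) :=
  Finsupp.lsum K fun s => LinearMap.toSpanSingleton K _
    ((gmul P α s.1).mapDomain fun γ => (γ, s.2))

variable {ι}

theorem act_grMod (α : Expo n) (x : Expo n × ι →₀ K) :
    (grMod P ι).act α x = grActL P ι α x := by
  simp only [grMod, grActL, Finsupp.lsum_apply, Finsupp.mapDomain]
  refine Finsupp.sum_congr fun s _ => ?_
  rw [LinearMap.toSpanSingleton_apply, Finsupp.smul_sum]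
  simp only [Finsupp.smul_single, smul_eq_mul]
  rfl

theorem grActL_single_apply (α : Expo n) (s t : Expo n × ι) :
    grActL P ι α (Finsupp.single s 1) t = if t.2 = s.2 then gmul P α s.1 t.1 else 0 := by
  simp only [grActL, Finsupp.lsum_single, LinearMap.toSpanSingleton_apply, one_smul]
  have hinj : Function.Injective fun γ : Expo n => (γ, s.2) := fun γ δ h =>
    (Prod.ext_iff.1 h).1
  split_ifs with h
  · have : t = (fun γ : Expo n => (γ, s.2)) t.1 := Prod.ext rfl h
    conv_lhs => rw [this]
    exact Finsupp.mapDomain_apply hinj _ _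
  · refine Finsupp.mapDomain_of_notMem_range _ _ ?_
    rintro ⟨γ, rfl⟩
    exact h rfl

variable {P} {b : ι → ℕ} {r : Expo n × ι → Expo n × ι → Prop}

theorem grActL_apply (α : Expo n) (x : Expo n × ι →₀ K) (t : Expo n × ι) :
    grActL P ι α x t = x.sum fun s κ => κ * (if t.2 = s.2 then gmul P α s.1 t.1 else 0) := by
  conv_lhs => rw [← Finsupp.sum_single x]
  simp only [Finsupp.sum, map_sum, Finsupp.finsetSum_apply]
  refine Finset.sum_congr rfl fun s _ => ?_
  rw [← grActL_single_apply, ← mul_one (x s), ← smul_eq_mul, ← Finsupp.smul_single, map_smul]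
  simp

/-- The associated graded module with a graded left monomial ordering. -/
def grAdm (hr : IsGradedLeftMonomialOrdering P b r) [Finite ι] :
    (grMod P ι).Admissible r where
  repr := LinearEquiv.refl K _
  coef_eq v s := rfl
  mon_eq s := rfl
  actL := grActL P ι
  act_eq := act_grMod P
  strictTotal := hr.strictTotal
  wf := hr.wf
  shift_lt γ s t h := hr.shift_lt γ h
  le_shift := hr.le_shift
  lead α s := by
    have hl := P.isLeading_mul α s.1
    change IsLeading r (fun t => (grMod P ι).act α (Finsupp.single s 1) t) _
    simp only [act_grMod, grActL_single_apply]
    refine ⟨?_, fun t ht => ?_⟩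
    · simp only [shift_snd, if_true, shift_fst, gmul_apply, P.wdeg_add]
      exact hl.1
    · beta_reduce at ht
      split_ifs at ht with h
      · rw [gmul_apply] at ht
        split_ifs at ht with h'
        · obtain ⟨t1, t2⟩ := t
          obtain rfl : t2 = s.2 := h
          rcases hl.2 t1 ht with h1 | h1
          · exact Or.inl (Prod.ext h1 rfl)
          · exact Or.inr (hr.compat _ _ _ h1)
        · exact absurd rfl ht
      · exact absurd rfl ht
  act_act α β := by
    have hl := P.isLeading_mul α β
    refine ⟨gmul P α β, ?_, fun γ hγ => ?_, fun v => ?_⟩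
    · rw [gmul_apply, if_pos (P.wdeg_add α β)]
      exact hl.1
    · rw [gmul_apply] at hγ
      split_ifs at hγ with h
      · exact (hl.2 γ hγ).imp_right fun h s => hr.shift_left_lt h s
      · exact absurd rfl hγ
    · simp only [MonomialModule.evalAct, act_grMod]
      -- Both maps are linear, so it suffices to compare them on monomials. In the matching
      -- component this is associativity of the graded product; elsewhere both sides vanish.
      have : grActL P ι α ∘ₗ grActL P ι β =
          (gmul P α β).sum fun δ κ => κ • grActL P ι δ := by
        refine Finsupp.lhom_ext' fun s => LinearMap.ext_ring ?_
        ext t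
        simp only [LinearMap.comp_apply, Finsupp.lsingle_apply, Finsupp.sum,
          LinearMap.sum_apply, LinearMap.smul_apply, Finsupp.finsetSum_apply,
          Finsupp.smul_apply, grActL_single_apply, smul_eq_mul]
        split_ifs with h
        · have h1 := gmul_sum_right P α β s.1 t.1
          have h2 := gmul_sum_left P α β s.1 t.1
          rw [Finsupp.sum] at h1
          rw [h1, ← h2, grActL_apply]
          have hinj : Function.Injective fun γ : Expo n => (γ, s.2) := fun γ δ h =>
            (Prod.ext_iff.1 h).1
          simp only [grActL, Finsupp.lsum_single, LinearMap.toSpanSingleton_apply, one_smul]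
          rw [Finsupp.sum_mapDomain_index_inj hinj]
          simp [h]
        · simp only [mul_zero, Finset.sum_const_zero]
          rw [grActL_apply]
          refine Finset.sum_eq_zero fun u hu => ?_
          rw [Finsupp.mem_support_iff, grActL_single_apply] at hu
          split_ifs at hu with hu'
          · simp [hu', h]
          · exact absurd rfl hu
      have h := LinearMap.congr_fun this v
      simpa [Finsupp.sum, LinearMap.sum_apply] using h

theorem gmul_zero_left (β : Expo n) : gmul P 0 β = Finsupp.single β 1 := by
  ext γ
  rw [gmul_apply]
  simp only [P.basis_zero, one_mul, Module.Basis.repr_self, P.wdeg_zero, zero_add,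
    Finsupp.single_apply]
  by_cases h : β = γ
  · simp [h]
  · simp [h]

@[simp] theorem act_zero_grMod (x : Expo n × ι →₀ K) : (grMod P ι).act 0 x = x := by
  rw [act_grMod]
  ext t
  rw [grActL_apply]
  simp only [gmul_zero_left]
  have : ∀ s : Expo n × ι, (if t.2 = s.2 then (Finsupp.single s.1 (1 : K)) t.1 else 0) =
      if s = t then 1 else 0 := by
    intro s
    by_cases h : s = t
    · simp [h]
    · rw [if_neg h]
      by_cases h2 : t.2 = s.2
      · rw [if_pos h2, Finsupp.single_apply, if_neg fun h1 => h (Prod.ext h1 h2.symm)]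
      · rw [if_neg h2]
  simp only [this]
  simp [eq_comm]

/-- The action of monomials on the associated graded module is compatible with degrees. -/
theorem act_grMod_homogeneous (b : ι → ℕ) {α : Expo n} {x : Expo n × ι →₀ K} {d : ℕ}
    (hx : ∀ t, x t ≠ 0 → mdeg P b t = d) {t : Expo n × ι}
    (ht : (grMod P ι).act α x t ≠ 0) : mdeg P b t = P.wdeg α + d := by
  rw [act_grMod, grActL_apply] at ht
  obtain ⟨s, hs, hne⟩ := Finset.exists_ne_zero_of_sum_ne_zero ht
  have hs' := hx s (Finsupp.mem_support_iff.1 hs)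
  have h := right_ne_zero_of_mul hne
  split_ifs at h with h2
  · have := wdeg_of_gmul_ne_zero P h
    simp only [mdeg] at hs' ⊢
    rw [h2]
    omega
  · exact absurd rfl h

end Graded

/-! ### Filtrations -/

variable {K A : Type*} [Field K] [Ring A] [Algebra K A] {n : ℕ} (P : GradedSolvPolyAlg K A n)

section FreeFil

theorem mem_fil {p : ℕ} {x : A} :
    x ∈ P.fil p ↔ ∀ γ, P.basis.repr x γ ≠ 0 → P.wdeg γ ≤ p := by
  have : {x | ∃ α, P.wdeg α ≤ p ∧ x = P.basis α} = P.basis '' {α | P.wdeg α ≤ p} := by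
    ext x
    simp [eq_comm]
  rw [GradedSolvPolyAlg.fil, this, Module.Basis.mem_span_image]
  simp [Set.subset_def]

theorem basis_mem_fil (α : Expo n) : P.basis α ∈ P.fil (P.wdeg α) :=
  Submodule.subset_span ⟨α, le_rfl, rfl⟩

/-- Positive weights leave only the monomial $1$ in degree zero. In the pivot arguments this makes
components of least possible degree scalars. -/
theorem fil_zero_eq {x : A} (h : x ∈ P.fil 0) : x = algebraMap K A (P.basis.repr x 0) := by
  have h0 : P.basis.repr x = Finsupp.single 0 (P.basis.repr x 0) := by
    ext γ
    rw [Finsupp.single_apply]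
    split_ifs with hγ
    · rw [hγ]
    · by_contra hne
      exact hγ (P.wdeg_eq_zero.1 (Nat.le_zero.1 ((mem_fil P).1 h γ hne))).symm
  conv_lhs => rw [← P.sum_repr x, h0, Finsupp.sum_single_index (by simp), P.basis_zero]
  rw [Algebra.algebraMap_eq_smul_one]

variable {ι : Type*} {b : ι → ℕ}

/-- The monomials of a free module as a basis. -/
def freeBasis (ι : Type*) [Finite ι] : Module.Basis (Expo n × ι) K (ι → A) :=
  Module.Basis.ofRepr (freeRepr P ι)

@[simp] theorem freeBasis_apply [Finite ι] (s : Expo n × ι) : freeBasis P ι s = P.mon s := by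
  rw [freeBasis, Module.Basis.coe_ofRepr, LinearEquiv.symm_apply_eq]
  ext t
  rw [freeRepr_apply, coef_mon, Finsupp.single_apply]

theorem freeFil_eq (q : ℕ) :
    P.freeFil b q = Submodule.span K (P.mon '' {s | mdeg P b s ≤ q}) := by
  rw [GradedSolvPolyAlg.freeFil]
  congr 1
  ext x
  simp only [Set.mem_image, Prod.exists, GradedSolvPolyAlg.mon, mdeg, Set.mem_ofPred_eq,
    eq_comm (a := x)]

variable [Finite ι]

theorem mem_freeFil {q : ℕ} {ξ : ι → A} :
    ξ ∈ P.freeFil b q ↔ ∀ s, P.coef ξ s ≠ 0 → mdeg P b s ≤ q := by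
  have : P.mon '' {s | mdeg P b s ≤ q} = freeBasis P ι '' {s | mdeg P b s ≤ q} := by
    simp
  rw [freeFil_eq, this, Module.Basis.mem_span_image]
  simp only [freeBasis, Set.subset_def, Finset.mem_coe, Finsupp.mem_support_iff,
    freeRepr_apply]
  rfl

omit [Finite ι] in
theorem coef_ext {ξ ζ : ι → A} (h : ∀ s, P.coef ξ s = P.coef ζ s) : ξ = ζ := by
  funext i
  apply P.basis.repr.injective
  ext γ
  exact h (γ, i)

omit [Finite ι] in
@[simp] theorem coef_zero (s : Expo n × ι) : P.coef 0 s = 0 := by simp [GradedSolvPolyAlg.coef]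

omit [Finite ι] in
theorem coef_add (ξ ζ : ι → A) (s : Expo n × ι) :
    P.coef (ξ + ζ) s = P.coef ξ s + P.coef ζ s := by simp [GradedSolvPolyAlg.coef]

omit [Finite ι] in
theorem coef_sub (ξ ζ : ι → A) (s : Expo n × ι) :
    P.coef (ξ - ζ) s = P.coef ξ s - P.coef ζ s := by simp [GradedSolvPolyAlg.coef]

omit [Finite ι] in
theorem coef_smul (c : K) (ξ : ι → A) (s : Expo n × ι) :
    P.coef (c • ξ) s = c * P.coef ξ s := by simp [GradedSolvPolyAlg.coef]

theorem freeFil_mono {p q : ℕ} (h : p ≤ q) : P.freeFil b p ≤ P.freeFil b q := fun _ hx =>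
  (mem_freeFil P).2 fun s hs => ((mem_freeFil P).1 hx s hs).trans h

theorem mem_freeFil_iff_apply {q : ℕ} {ξ : ι → A} :
    ξ ∈ P.freeFil b q ↔ ∀ i γ, P.basis.repr (ξ i) γ ≠ 0 → P.wdeg γ + b i ≤ q := by
  rw [mem_freeFil, Prod.forall, forall_comm]
  rfl

theorem apply_mem_fil {q : ℕ} {ξ : ι → A} (h : ξ ∈ P.freeFil b q) (i : ι) :
    ξ i ∈ P.fil (q - b i) := by
  refine (mem_fil P).2 fun γ hγ => ?_
  have := (mem_freeFil_iff_apply P).1 h i γ hγ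
  omega

theorem apply_eq_zero_of_mem_freeFil {q : ℕ} {ξ : ι → A} (h : ξ ∈ P.freeFil b q) {i : ι}
    (hi : q < b i) : ξ i = 0 := by
  apply P.basis.repr.injective
  ext γ
  by_contra hne
  have := (mem_freeFil_iff_apply P).1 h i γ (by simpa using hne)
  omega

omit [Finite ι] in
theorem coef_basis_smul_ne_zero {α : Expo n} {ξ : ι → A} {t : Expo n × ι}
    (h : P.coef (P.basis α • ξ) t ≠ 0) :
    ∃ s, P.coef ξ s ≠ 0 ∧ s.2 = t.2 ∧ P.wdeg t.1 ≤ P.wdeg α + P.wdeg s.1 := by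
  have hx : P.basis.repr (P.basis α * ξ t.2) t.1 =
      ∑ γ ∈ (P.basis.repr (ξ t.2)).support,
        P.basis.repr (ξ t.2) γ * P.basis.repr (P.basis α * P.basis γ) t.1 := by
    conv_lhs => rw [← P.sum_repr (ξ t.2)]
    simp [Finsupp.sum, Finset.mul_sum, Finsupp.finsetSum_apply]
  change P.basis.repr (P.basis α * ξ t.2) t.1 ≠ 0 at h
  rw [hx] at h
  obtain ⟨γ, -, hne⟩ := Finset.exists_ne_zero_of_sum_ne_zero h
  exact ⟨(γ, t.2), left_ne_zero_of_mul hne, rfl,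
    repr_mul_ne_zero P (right_ne_zero_of_mul hne)⟩

theorem basis_smul_mem_freeFil {α : Expo n} {p q : ℕ} {ξ : ι → A} (h : ξ ∈ P.freeFil b q)
    (hp : P.wdeg α + q ≤ p) : P.basis α • ξ ∈ P.freeFil b p := by
  refine (mem_freeFil P).2 fun t ht => ?_
  obtain ⟨s, hs, hst, hd⟩ := coef_basis_smul_ne_zero P ht
  have := (mem_freeFil P).1 h s hs
  simp only [mdeg] at this ⊢
  rw [← hst]
  omega

theorem smul_mem_freeFil {f : A} {p q m : ℕ} {ξ : ι → A} (hf : f ∈ P.fil p)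
    (h : ξ ∈ P.freeFil b q) (hm : p + q ≤ m) : f • ξ ∈ P.freeFil b m := by
  rw [← P.sum_repr f, Finsupp.sum, Finset.sum_smul]
  refine Submodule.sum_mem _ fun γ hγ => ?_
  rw [smul_assoc]
  refine Submodule.smul_mem _ _ (basis_smul_mem_freeFil P h ?_)
  have := (mem_fil P).1 hf γ (Finsupp.mem_support_iff.1 hγ)
  omega

theorem exists_mem_freeFil (ξ : ι → A) : ∃ q, ξ ∈ P.freeFil b q := by
  refine ⟨(freeRepr P ι ξ).support.sup (mdeg P b), (mem_freeFil P).2 fun s hs => ?_⟩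
  refine Finset.le_sup (Finsupp.mem_support_iff.2 ?_)
  rwa [freeRepr_apply]

theorem mem_freeFil_filDeg (ξ : ι → A) : ξ ∈ P.freeFil b (P.filDeg b ξ) :=
  Nat.sInf_mem (exists_mem_freeFil P ξ)

omit [Finite ι] in
theorem filDeg_le {ξ : ι → A} {q : ℕ} (h : ξ ∈ P.freeFil b q) : P.filDeg b ξ ≤ q :=
  Nat.sInf_le h

theorem mem_freeFil_iff_filDeg_le {ξ : ι → A} {q : ℕ} :
    ξ ∈ P.freeFil b q ↔ P.filDeg b ξ ≤ q :=
  ⟨filDeg_le P, fun h => freeFil_mono P h (mem_freeFil_filDeg P ξ)⟩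

variable {P} in
-- A graded ordering refines the degree, so no monomial of the element has larger degree than the
-- leading one. This links Gröbner bases to filtrations.
theorem filDeg_eq_mdeg {r : Expo n × ι → Expo n × ι → Prop}
    (hr : IsGradedLeftMonomialOrdering P b r) {ξ : ι → A} {s : Expo n × ι}
    (hs : IsLeading r (P.coef ξ) s) : P.filDeg b ξ = mdeg P b s := by
  refine le_antisymm (filDeg_le P ((mem_freeFil P).2 fun t ht => hr.mdeg_le (hs.2 t ht))) ?_
  exact (mem_freeFil P).1 (mem_freeFil_filDeg P ξ) s hs.1

theorem stdVec_mem_freeFil (i : ι) : stdVec A i ∈ P.freeFil b (b i) := by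
  have : stdVec A i = P.mon (0, i) := by simp [stdVec, GradedSolvPolyAlg.mon]
  rw [this, mem_freeFil]
  intro s hs
  rw [coef_mon] at hs
  have : (0, i) = s := by
    by_contra hne
    exact hs (if_neg hne)
  simp [mdeg, ← this]

end FreeFil

/-! ### F-bases -/

section FBasis

variable {M : Type*} [AddCommGroup M] [Module A M] [Module K M] [IsScalarTower K A M]
  {κ : Type*}

/-- The sum of the `F_p A · v k` with `p + dd k ≤ q`. -/
def mulSpan (v : κ → M) (dd : κ → ℕ) (q : ℕ) : Submodule K M :=
  Submodule.span K {x | ∃ k α, P.wdeg α + dd k ≤ q ∧ x = P.basis α • v k}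

variable {P}

omit [IsScalarTower K A M] in
theorem mem_mulSpan_basis {v : κ → M} {dd : κ → ℕ} {q : ℕ} {k : κ} {α : Expo n}
    (h : P.wdeg α + dd k ≤ q) : P.basis α • v k ∈ mulSpan P v dd q :=
  Submodule.subset_span ⟨k, α, h, rfl⟩

theorem smul_mem_mulSpan {v : κ → M} {dd : κ → ℕ} {p q : ℕ} {k : κ} {f : A}
    (hf : f ∈ P.fil p) (h : p + dd k ≤ q) : f • v k ∈ mulSpan P v dd q := by
  rw [← P.sum_repr f, Finsupp.sum, Finset.sum_smul]
  refine Submodule.sum_mem _ fun γ hγ => ?_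
  rw [smul_assoc]
  refine Submodule.smul_mem _ _ (mem_mulSpan_basis ?_)
  have := (mem_fil P).1 hf γ (Finsupp.mem_support_iff.1 hγ)
  omega

omit [IsScalarTower K A M] in
theorem mem_mulSpan_self {v : κ → M} {dd : κ → ℕ} {q : ℕ} {k : κ} (h : dd k ≤ q) :
    v k ∈ mulSpan P v dd q := by
  simpa using mem_mulSpan_basis (P := P) (v := v) (dd := dd) (q := q) (k := k) (α := 0) (by simpa)

omit [IsScalarTower K A M] in
theorem mulSpan_le_iff {v : κ → M} {dd : κ → ℕ} {q : ℕ} {S : Submodule K M} :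
    mulSpan P v dd q ≤ S ↔ ∀ k α, P.wdeg α + dd k ≤ q → P.basis α • v k ∈ S := by
  rw [mulSpan, Submodule.span_le]
  constructor
  · exact fun h k α hk => h ⟨k, α, hk, rfl⟩
  · rintro h x ⟨k, α, hk, rfl⟩
    exact h k α hk

omit [IsScalarTower K A M] in
theorem mulSpan_mono {v : κ → M} {dd dd' : κ → ℕ} {q q' : ℕ} (h : ∀ k, dd' k ≤ dd k)
    (hq : q ≤ q') : mulSpan P v dd q ≤ mulSpan P v dd' q' :=
  mulSpan_le_iff.2 fun k α hk => mem_mulSpan_basis (by have := h k; omega)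

/-- Read as lifting: the coefficients form an element of the filtered free module with degrees `dd`,
in the same filtration step. -/
theorem exists_coeff_of_mem_mulSpan [Fintype κ] {v : κ → M} {dd : κ → ℕ} {q : ℕ} {x : M}
    (hx : x ∈ mulSpan P v dd q) : ∃ f : κ → A, x = ∑ k, f k • v k ∧
      f ∈ P.freeFil dd q := by
  induction hx using Submodule.span_induction with
  | mem x hx =>
    obtain ⟨k, α, hk, rfl⟩ := hx
    refine ⟨Pi.single k (P.basis α), ?_, Submodule.subset_span ⟨α, k, hk, rfl⟩⟩
    rw [Finset.sum_eq_single k]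
    · simp
    · intro j _ hj
      simp [hj]
    · simp
  | zero => exact ⟨0, by simp, Submodule.zero_mem _⟩
  | add x y _ _ hx hy =>
    obtain ⟨f, rfl, hf⟩ := hx
    obtain ⟨g, rfl, hg⟩ := hy
    exact ⟨f + g, by simp [add_smul, Finset.sum_add_distrib], Submodule.add_mem _ hf hg⟩
  | smul c x _ hx =>
    obtain ⟨f, rfl, hf⟩ := hx
    exact ⟨c • f, by simp [Finset.smul_sum], Submodule.smul_mem _ _ hf⟩

theorem sum_smul_mem_mulSpan [Fintype κ] {v : κ → M} {dd : κ → ℕ} {q : ℕ} {f : κ → A}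
    (hf : f ∈ P.freeFil dd q) : ∑ k, f k • v k ∈ mulSpan P v dd q := by
  refine Submodule.sum_mem _ fun k _ => ?_
  by_cases h : q < dd k
  · rw [apply_eq_zero_of_mem_freeFil P hf h, zero_smul]
    exact Submodule.zero_mem _
  · exact smul_mem_mulSpan (apply_mem_fil P hf k) (by omega)

theorem iSup_fil_eq_mulSpan (v : κ → M) (nn : κ → ℕ) (q : ℕ) :
    (⨆ k, ⨆ p, ⨆ (_ : p + nn k ≤ q),
      (P.fil p).map ((LinearMap.toSpanSingleton A M (v k)).restrictScalars K)) =
    mulSpan P v nn q := by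
  apply le_antisymm
  · refine iSup_le fun k => iSup_le fun p => iSup_le fun h => ?_
    rw [Submodule.map_le_iff_le_comap]
    intro f hf
    exact smul_mem_mulSpan hf h
  · refine mulSpan_le_iff.2 fun k α hk => ?_
    refine Submodule.mem_iSup_of_mem k (Submodule.mem_iSup_of_mem (P.wdeg α)
      (Submodule.mem_iSup_of_mem hk ?_))
    exact ⟨P.basis α, basis_mem_fil P α, rfl⟩

theorem isFBasis_of {FM : ℕ → Submodule K M} [Finite κ] {v : κ → M} (dd : κ → ℕ)
    (hv : ∀ k, v k ≠ 0) (hmem : ∀ k α q, P.wdeg α + dd k ≤ q → P.basis α • v k ∈ FM q)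
    (hle : ∀ q, ∀ x ∈ FM q, x ∈ mulSpan P v dd q) : IsFBasis P FM v := by
  refine ⟨inferInstance, hv, dd, fun q => ?_⟩
  rw [iSup_fil_eq_mulSpan]
  exact le_antisymm (hle q) (mulSpan_le_iff.2 fun k α => hmem k α q)

/-- Taking $q = n_k$ in the definition of an F-basis shows $v_k\in F_{n_k}M$. So the unspecified
numbers may be lowered to any lower bounds for the degrees of the $v_k$. -/
theorem IsFBasis.mem_mulSpan {FM : ℕ → Submodule K M} {v : κ → M} (h : IsFBasis P FM v)
    {dd : κ → ℕ} (hdd : ∀ k q, v k ∈ FM q → dd k ≤ q) {q : ℕ} {x : M} (hx : x ∈ FM q) :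
    x ∈ mulSpan P v dd q := by
  obtain ⟨-, -, nn, hnn⟩ := h
  simp only [iSup_fil_eq_mulSpan] at hnn
  rw [hnn] at hx
  exact mulSpan_mono (fun k => hdd k _ (hnn _ ▸ mem_mulSpan_self le_rfl)) le_rfl hx

end FBasis

section StandardBasis

variable {P} {ι : Type*} [Finite ι] {b : ι → ℕ} {N : Submodule A (ι → A)} {κ : Type*}
  {v : κ → ι → A}

omit [Finite ι] in
theorem mulSpan_subtype (h : ∀ k, v k ∈ N) (dd : κ → ℕ) (q : ℕ) (x : N) :
    x ∈ mulSpan P (fun k => (⟨v k, h k⟩ : N)) dd q ↔ (x : ι → A) ∈ mulSpan P v dd q := by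
  have : mulSpan P v dd q = (mulSpan P (fun k => (⟨v k, h k⟩ : N)) dd q).map
      (N.subtype.restrictScalars K) := by
    rw [mulSpan, mulSpan, Submodule.map_span]
    congr 1
    ext y
    constructor
    · rintro ⟨k, α, hk, rfl⟩
      exact ⟨_, ⟨k, α, hk, rfl⟩, rfl⟩
    · rintro ⟨_, ⟨k, α, hk, rfl⟩, rfl⟩
      exact ⟨k, α, hk, rfl⟩
  rw [this]
  constructor
  · exact fun h => ⟨x, h, rfl⟩
  · rintro ⟨y, hy, hyx⟩
    rwa [← Subtype.ext (show (y : ι → A) = x from hyx)]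

/-- The numbers in the definition may be taken to be the filtered degrees, and the reverse inclusion
holds automatically. All later arguments use this form. -/
theorem isStandardBasis_iff : IsStandardBasis P (P.freeFil b) N v ↔
    Finite κ ∧ (∀ k, v k ∈ N ∧ v k ≠ 0) ∧ ∀ q, ∀ x ∈ N, x ∈ P.freeFil b q →
      x ∈ mulSpan P v (fun k => P.filDeg b (v k)) q := by
  constructor
  · rintro ⟨h, hF⟩
    refine ⟨hF.1, fun k => ⟨h k, fun h0 => hF.2.1 k (Subtype.ext h0)⟩, fun q x hx hxq => ?_⟩
    refine (mulSpan_subtype h _ q ⟨x, hx⟩).1 (hF.mem_mulSpan (fun k q hk => ?_) ?_)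
    · exact filDeg_le P hk
    · exact hxq
  · rintro ⟨hfin, hv, hle⟩
    refine ⟨fun k => (hv k).1, isFBasis_of (fun k => P.filDeg b (v k)) ?_ ?_ ?_⟩
    · exact fun k h0 => (hv k).2 (congrArg Subtype.val h0)
    · intro k α q hk
      exact basis_smul_mem_freeFil P (mem_freeFil_filDeg P (v k)) hk
    · intro q x hx
      exact (mulSpan_subtype _ _ _ _).2 (hle q x x.2 hx)

omit [Finite ι] in
theorem isMinimalStandardBasis_iff : IsMinimalStandardBasis P (P.freeFil b) N v ↔
    IsStandardBasis P (P.freeFil b) N v ∧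
      ∀ T : Set κ, T ≠ Set.univ → ¬ IsStandardBasis P (P.freeFil b) N fun k : T => v k := by
  constructor
  · rintro ⟨h, hF, hmin⟩
    exact ⟨⟨h, hF⟩, fun T hT ⟨_, hF'⟩ => hmin T hT hF'⟩
  · rintro ⟨⟨h, hF⟩, hmin⟩
    exact ⟨h, hF, fun T hT hF' => hmin T hT ⟨fun k => h k, hF'⟩⟩

/-- If the leading monomials of `v` generate those of `N`, then the elements of `N` are
combinations of the `v k` in which no term exceeds the leading monomial. -/
theorem mem_monoSpan_of_groebner {r : Expo n × ι → Expo n × ι → Prop}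
    (hr : IsGradedLeftMonomialOrdering P b r) {lead : κ → Expo n × ι} (hv : ∀ k, v k ∈ N)
    (hlead : ∀ k, IsLeading r (P.coef (v k)) (lead k))
    (hN : ∀ x ∈ N, ∀ s, IsLeading r (P.coef x) s → ∃ k, MDvd (lead k) s)
    {D : Set (Expo n × ι)} (hD : ∀ s t, r t s → s ∈ D → t ∈ D) {x : ι → A} (hx : x ∈ N)
    (hxD : ∀ t, P.coef x t ≠ 0 → t ∈ D) :
    x ∈ MonomialModule.monoSpan K lead (fun k α => P.basis α • v k) D := by
  have hX := freeAdm hr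
  have key : ∀ s ∈ D, ∀ x ∈ N, IsLeading r (P.coef x) s →
      x ∈ MonomialModule.monoSpan K lead (fun k α => P.basis α • v k) D := by
    intro s
    induction s using hr.wf.induction with
    | _ s ih =>
    intro hs x hx hl
    obtain ⟨k, α, hk⟩ := hN x hx s hl
    have hl' : IsLeading r (P.coef (P.basis α • v k)) s := hk ▸ hX.lead_act α (hlead k)
    set κ := P.coef x s * (P.coef (P.basis α • v k) s)⁻¹
    have hmem : P.basis α • v k ∈ MonomialModule.monoSpan K lead
        (fun k α => P.basis α • v k) D := MonomialModule.mem_monoSpan (hk ▸ hs)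
    have hN' : P.basis α • v k ∈ N := N.smul_mem _ (hv k)
    have hsub : x - κ • P.basis α • v k ∈ N := by
      rw [← smul_assoc]
      exact N.sub_mem hx (N.smul_mem _ (hv k))
    suffices h : x - κ • P.basis α • v k ∈
        MonomialModule.monoSpan K lead (fun k α => P.basis α • v k) D by
      simpa using Submodule.add_mem _ h (Submodule.smul_mem _ κ hmem)
    by_cases h0 : x - κ • P.basis α • v k = 0
    · rw [h0]
      exact Submodule.zero_mem _
    · obtain ⟨t, ht⟩ := hX.exists_isLeading h0
      have hts : r t s := by
        refine hX.coef_sub_lead (a := 1) (b := κ) hl hl' ?_ ?_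
        · change 1 * P.coef x s = P.coef x s * (P.coef (P.basis α • v k) s)⁻¹ *
            P.coef (P.basis α • v k) s
          rw [one_mul, mul_assoc, inv_mul_cancel₀ hl'.1, mul_one]
        · rw [one_smul]
          exact ht.1
      exact ih t hts (hD _ _ hts hs) _ hsub ht
  by_cases h0 : x = 0
  · rw [h0]
    exact Submodule.zero_mem _
  · obtain ⟨s, hs⟩ := hX.exists_isLeading h0
    exact key s (hxD s hs.1) x hx hs

omit [Finite ι] in
theorem monoSpan_le_mulSpan {lead : κ → Expo n × ι} (q : ℕ) :
    MonomialModule.monoSpan K lead (fun k α => P.basis α • v k) {t | mdeg P b t ≤ q} ≤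
      mulSpan P v (fun k => mdeg P b (lead k)) q := by
  refine Submodule.span_le.2 ?_
  rintro z ⟨k, α, hk, rfl⟩
  refine mem_mulSpan_basis ?_
  rw [← mdeg_shift]
  exact hk

/-- For a graded ordering the monomials of degree at most `q` form a down-set, so a representation
without terms above the leading monomial respects the filtration. -/
theorem isStandardBasis_of_groebner [Finite κ] {r : Expo n × ι → Expo n × ι → Prop}
    (hr : IsGradedLeftMonomialOrdering P b r) {lead : κ → Expo n × ι} (hv : ∀ k, v k ∈ N)
    (hlead : ∀ k, IsLeading r (P.coef (v k)) (lead k))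
    (hN : ∀ x ∈ N, ∀ s, IsLeading r (P.coef x) s → ∃ k, MDvd (lead k) s) :
    IsStandardBasis P (P.freeFil b) N v := by
  refine isStandardBasis_iff.2 ⟨inferInstance, fun k => ⟨hv k, ?_⟩, fun q x hx hxq => ?_⟩
  · exact (freeAdm hr).ne_zero_of_isLeading (hlead k)
  · simp only [filDeg_eq_mdeg hr (hlead _)]
    refine monoSpan_le_mulSpan q (mem_monoSpan_of_groebner hr hv hlead hN ?_ hx ?_)
    · exact fun s t hts hs => (hr.mdeg_le (Or.inr hts)).trans hs
    · exact (mem_freeFil P).1 hxq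

end StandardBasis

/-! ### Principal symbols -/

section Symbol

variable {ι : Type*} [Fintype ι] {b : ι → ℕ}

/-- The part of degree exactly `q`. -/
def topPart (b : ι → ℕ) (q : ℕ) : (ι → A) →ₗ[K] (Expo n × ι →₀ K) where
  toFun ξ := (freeRepr P ι ξ).filter fun s => mdeg P b s = q
  map_add' ξ ζ := by rw [map_add, Finsupp.filter_add]
  map_smul' c ξ := by rw [map_smul, Finsupp.filter_smul]; rfl

theorem topPart_apply (q : ℕ) (ξ : ι → A) (s : Expo n × ι) :
    topPart P b q ξ s = if mdeg P b s = q then P.coef ξ s else 0 := by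
  simp only [topPart, LinearMap.coe_mk, AddHom.coe_mk, Finsupp.filter_apply, freeRepr_apply]

theorem symbol_eq_topPart (ξ : ι → A) : symbol P b ξ = topPart P b (P.filDeg b ξ) ξ := by
  ext ⟨γ, i⟩
  rw [topPart_apply, symbol, Finsupp.finsetSum_apply, Finset.sum_eq_single i]
  · rw [Finsupp.mapDomain_apply fun γ δ h => (Prod.ext_iff.1 h).1, Finsupp.filter_apply]
    rfl
  · intro j _ hj
    refine Finsupp.mapDomain_of_notMem_range _ _ ?_
    rintro ⟨δ, h⟩
    exact hj (Prod.ext_iff.1 h).2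
  · simp

/-- Monomials of degree below `q` stay too low after multiplication, so only the part of degree `q`
matters. As `q` need not be the exact degree, both sides are linear on $F_qL$ and monomials suffice.
-/
theorem topPart_basis_smul {q : ℕ} {ξ : ι → A} (h : ξ ∈ P.freeFil b q) (α : Expo n) :
    topPart P b (P.wdeg α + q) (P.basis α • ξ) = (grMod P ι).act α (topPart P b q ξ) := by
  rw [act_grMod]
  rw [freeFil_eq] at h
  induction h using Submodule.span_induction with
  | mem ξ hξ =>
    obtain ⟨s, hs, rfl⟩ := hξ
    have hs : mdeg P b s ≤ q := hs
    have h1 : topPart P b q (P.mon s) = if mdeg P b s = q then Finsupp.single s 1 else 0 := by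
      ext t
      rw [topPart_apply, coef_mon]
      by_cases hst : s = t
      · subst hst
        by_cases hq : mdeg P b s = q <;> simp [hq]
      · by_cases hq : mdeg P b s = q <;> simp [hq, hst]
    ext t
    rw [topPart_apply, coef_basis_smul_mon, h1]
    split_ifs with ht h2 hq hq hq
    · rw [grActL_single_apply, if_pos h2, gmul_apply, if_pos]
      simp only [mdeg] at ht hq
      rw [h2] at ht
      omega
    · by_contra hne
      have := repr_mul_ne_zero P (by simpa using hne)
      simp only [mdeg] at ht hq hs
      rw [h2] at ht
      omega
    · rw [grActL_single_apply, if_neg h2]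
    · simp
    · rw [grActL_single_apply]
      split_ifs with h2
      · rw [gmul_apply, if_neg]
        intro h3
        apply ht
        simp only [mdeg] at hq ⊢
        rw [h2]
        omega
      · rfl
    · simp
  | zero => simp
  | add x y _ _ hx hy => simp only [smul_add, map_add, hx, hy]
  | smul c x _ hx =>
    have e : P.basis α • c • x = c • P.basis α • x := smul_comm _ _ _
    rw [e, LinearMap.map_smul, LinearMap.map_smul, LinearMap.map_smul, hx]

theorem mem_freeFil_pred {q : ℕ} {ξ : ι → A} (h : ξ ∈ P.freeFil b q)
    (h0 : topPart P b q ξ = 0) (s : Expo n × ι) (hs : P.coef ξ s ≠ 0) : mdeg P b s < q := by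
  refine lt_of_le_of_ne ((mem_freeFil P).1 h s hs) fun hq => hs ?_
  have := DFunLike.congr_fun h0 s
  rwa [topPart_apply, if_pos hq] at this

/-- The leading term for any graded ordering has the full degree and survives in the symbol. -/
theorem symbol_ne_zero {ξ : ι → A} (h : ξ ≠ 0) : symbol P b ξ ≠ 0 := by
  obtain ⟨r, hr⟩ := exists_isGradedLeftMonomialOrdering P b
  obtain ⟨s, hs⟩ := (freeAdm hr).exists_isLeading h
  intro h0
  have := DFunLike.congr_fun h0 s
  rw [symbol_eq_topPart, topPart_apply, if_pos (filDeg_eq_mdeg hr hs).symm] at this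
  exact hs.1 this

theorem mdeg_of_symbol_ne_zero {ξ : ι → A} {s : Expo n × ι} (h : symbol P b ξ s ≠ 0) :
    mdeg P b s = P.filDeg b ξ := by
  rw [symbol_eq_topPart, topPart_apply] at h
  by_contra hne
  exact h (if_neg hne)

omit [Fintype ι] in
theorem grDeg_eq {x : Expo n × ι →₀ K} {d : ℕ} (hx : ∀ t, x t ≠ 0 → mdeg P b t = d)
    (h0 : x ≠ 0) : grDeg P b x = d := by
  obtain ⟨s, hs⟩ := Finsupp.support_nonempty_iff.2 h0
  apply le_antisymm
  · exact Finset.sup_le fun t ht => (hx t (Finsupp.mem_support_iff.1 ht)).le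
  · rw [← hx s (Finsupp.mem_support_iff.1 hs)]
    exact Finset.le_sup (f := mdeg P b) hs

end Symbol

/-! ### Total correctness of nondeterministic algorithms -/

/-- The usual division of labour: the invariant gives the result, a well-founded measure gives
termination, and `hstuck` excludes deadlock. -/
theorem Always.of_invariant {S β : Type*} {R : S → S → Prop} {halt Q : S → Prop}
    (Inv : S → Prop) {rel : β → β → Prop} (hwf : WellFounded rel) (μ : S → β)
    (hstuck : ∀ s, Inv s → ¬ halt s → ∃ t, R s t)
    (hstep : ∀ s t, Inv s → R s t → Inv t ∧ rel (μ t) (μ s))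
    (hQ : ∀ s, Inv s → halt s → Q s) {s : S} (hs : Inv s) : Always R halt Q s := by
  induction h : μ s using hwf.induction generalizing s with
  | _ x ih =>
    by_cases hh : halt s
    · exact Always.done s hh (hQ s hs hh)
    · refine Always.step s hh (hstuck s hs hh) fun t ht => ?_
      obtain ⟨h1, h2⟩ := hstep s t hs ht
      exact ih _ (h ▸ h2) h1 rfl

/-- Since no run gets stuck, one can be followed to its end. In this way existence is extracted from
total correctness. -/
theorem Always.exists_final {S : Type*} {R : S → S → Prop} {halt Q : S → Prop} {s : S}
    (h : Always R halt Q s) : ∃ t, Q t := by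
  induction h with
  | done s _ hQ => exact ⟨s, hQ⟩
  | step s _ hex _ ih =>
    obtain ⟨t, ht⟩ := hex
    exact ih t ht

/-! ### Monomial modules: lists of generators -/

namespace MonomialModule

variable {K : Type*} [Field K] {n : ℕ} {ι V : Type*} [AddCommGroup V] [Module K V]
  {X : MonomialModule K n ι V} {r : Expo n × ι → Expo n × ι → Prop}

theorem mem_pairsTo {G : List V} {k : ℕ} {p : ℕ × ℕ} : p ∈ X.pairsTo r G k ↔
    p.1 < p.2 ∧ p.2 = k ∧ X.sPoly r (G.getD p.1 0) (G.getD p.2 0) ≠ 0 := by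
  simp only [pairsTo, Finset.mem_filter, Finset.mem_image, Finset.mem_range]
  constructor
  · rintro ⟨⟨i, hi, rfl⟩, h⟩
    exact ⟨hi, rfl, h⟩
  · rintro ⟨h1, h2, h3⟩
    exact ⟨⟨p.1, h2 ▸ h1, Prod.ext rfl h2.symm⟩, h3⟩

namespace Admissible

/-- A division remainder contains no divisible monomial, in particular its leading monomial is a new
one in Dickson's sense. -/
theorem dicksonExt_append (hX : X.Admissible r) {G : List V} {η : V} (hη : η ≠ 0)
    (h : ∀ t, X.coef η t ≠ 0 → ∀ ξ ∈ G, ∀ β, ¬ X.Divides r ξ t β) :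
    DicksonExt ((G ++ [η]).filterMap (X.lm r)) (G.filterMap (X.lm r)) := by
  obtain ⟨s, hs⟩ := hX.exists_isLeading hη
  refine ⟨s, ?_, fun t ht => ?_⟩
  · rw [List.filterMap_append, List.filterMap_cons, hX.lm_eq_some.2 hs]
    rfl
  · rintro ⟨α, hα⟩
    obtain ⟨ξ, hξ, hξt⟩ := List.mem_filterMap.1 ht
    exact h s hs.1 ξ hξ α (hX.divides_iff.2 ⟨t, hX.lm_eq_some.1 hξt, hα⟩)

theorem sPairReduces_of_eq_zero {G : Set V} {g h : V} (h0 : X.sPoly r g h = 0) :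
    SPairReduces X r G g h := fun s t _ _ _ => by
  rw [h0]
  exact Submodule.zero_mem _

end Admissible

end MonomialModule

theorem sum_get_map {α β M : Type*} [AddCommMonoid M] (l : List α) (f : α → β)
    (F : ℕ → β → M) : ∑ k : Fin (l.map f).length, F k ((l.map f).get k) =
      ∑ k : Fin l.length, F k (f (l.get k)) := by
  refine Fintype.sum_equiv (finCongr (List.length_map f)) _ _ fun k => ?_
  simp

/-! ### The Gröbner basis algorithm -/

variable {K A : Type*} [Field K] [Ring A] [Algebra K A] {n : ℕ} {P : GradedSolvPolyAlg K A n}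
  {ι : Type*} {b : ι → ℕ} {r : Expo n × ι → Expo n × ι → Prop}

open MonomialModule.Admissible

/-- A Gröbner basis in the sense of Buchberger's criterion of the module generated by `U`, with
expressions of its elements in terms of `U`. -/
structure IsBuchbergerBasis (P : GradedSolvPolyAlg K A n) (r : Expo n × ι → Expo n × ι → Prop)
    (U : List (ι → A)) (G : List ((ι → A) × (Fin U.length → A))) : Prop where
  ne_zero : ∀ g ∈ G, g.1 ≠ 0
  row : ∀ g ∈ G, g.1 = Fintype.linearCombination A U.get g.2
  mem : ∀ u ∈ U, u ∈ G.map Prod.fst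
  reduces : ∀ (i j : ℕ) g h, i < j → (G.map Prod.fst)[i]? = some g →
    (G.map Prod.fst)[j]? = some h → SPairReduces (freeMod P ι) r {x | x ∈ G.map Prod.fst} g h

/-- The invariant of the Gröbner basis algorithm. -/
structure LGBInv (P : GradedSolvPolyAlg K A n) (r : Expo n × ι → Expo n × ι → Prop)
    (U : List (ι → A)) (s : LGBState A ι U.length) : Prop where
  ne_zero : ∀ g ∈ s.gens, g.1 ≠ 0
  row : ∀ g ∈ s.gens, g.1 = Fintype.linearCombination A U.get g.2
  mem : ∀ u ∈ U, u ∈ s.gens.map Prod.fst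
  valid : ∀ p ∈ s.pairs, p.2 < s.gens.length ∧ p.1 < p.2
  reduces : ∀ (i j : ℕ) g h, i < j → (s.gens.map Prod.fst)[i]? = some g →
    (s.gens.map Prod.fst)[j]? = some h →
    (i, j) ∈ s.pairs ∨ SPairReduces (freeMod P ι) r {x | x ∈ s.gens.map Prod.fst} g h

theorem lgbInv_start (U : List (ι → A)) (hU : ∀ u ∈ U, u ≠ 0) :
    LGBInv P r U (lgbStart P r U) := by
  have hmap : (lgbStart P r U).gens.map Prod.fst = U := by
    simp only [lgbStart, List.map_ofFn]
    exact List.ofFn_get U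
  refine ⟨?_, ?_, ?_, ?_, ?_⟩
  · intro g hg
    have := List.mem_map_of_mem (f := Prod.fst) hg
    rw [hmap] at this
    exact hU _ this
  · intro g hg
    obtain ⟨k, rfl⟩ := List.mem_ofFn.1 hg
    simp [stdVec, Fintype.linearCombination_apply_single]
  · rw [hmap]
    exact fun u hu => hu
  · intro p hp
    simp only [lgbStart, Finset.mem_biUnion, Finset.mem_range,
      MonomialModule.mem_pairsTo] at hp
    obtain ⟨k, hk, h1, h2, -⟩ := hp
    simp only [lgbStart, List.length_ofFn]
    exact ⟨h2 ▸ hk, h1⟩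
  · intro i j g h hij hg hh
    rw [hmap] at hg hh
    by_cases h0 : (freeMod P ι).sPoly r g h = 0
    · exact Or.inr (sPairReduces_of_eq_zero h0)
    · left
      simp only [lgbStart, Finset.mem_biUnion, Finset.mem_range, MonomialModule.mem_pairsTo]
      refine ⟨j, (List.getElem?_eq_some_iff.1 hh).1, hij, rfl, ?_⟩
      simpa [List.getD_eq_getElem?_getD, hg, hh] using h0

theorem linearCombination_rowComb {m : ℕ} (φ : (Fin m → A) →ₗ[A] (ι → A))
    {gens : List ((ι → A) × (Fin m → A))} (hg : ∀ g ∈ gens, g.1 = φ g.2)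
    (q : ℕ → Expo n →₀ K) :
    φ (rowComb P gens q) = ∑ k : Fin gens.length, P.toA (q k) • (gens.get k).1 := by
  rw [rowComb, map_sum]
  refine Finset.sum_congr rfl fun k _ => ?_
  rw [map_smul, hg _ (List.get_mem gens k)]

theorem divL_sum_freeMod {m : ℕ} {gens : List ((ι → A) × (Fin m → A))} {ω η : ι → A}
    {q : ℕ → Expo n →₀ K} (h : (freeMod P ι).DivL r (gens.map Prod.fst) ω q η) :
    ω = ∑ k : Fin gens.length, P.toA (q k) • (gens.get k).1 + η := by
  rw [divL_sum h]
  congr 1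
  rw [sum_get_map gens Prod.fst fun k v => (freeMod P ι).evalAct (q k) v]
  simp only [evalAct_freeMod]

theorem sPoly_freeMod (g h : ι → A) : (freeMod P ι).sPoly r g h =
    P.toA ((freeMod P ι).cof r g h) • g - P.toA ((freeMod P ι).cof r h g) • h := by
  rw [MonomialModule.sPoly, evalAct_freeMod, evalAct_freeMod]

variable [Finite ι]

/-- The measure is lexicographic: a nonzero remainder extends the list of leading monomials in
Dickson's sense, a zero remainder shortens the list of pending pairs. -/
theorem lgbInv_step (hr : IsGradedLeftMonomialOrdering P b r) {U : List (ι → A)}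
    {s t : LGBState A ι U.length} (hs : LGBInv P r U s) (hst : LGBStep P r s t) :
    LGBInv P r U t ∧ Prod.Lex DicksonExt (· < ·)
      ((t.gens.map Prod.fst).filterMap ((freeMod P ι).lm r), t.pairs.card)
      ((s.gens.map Prod.fst).filterMap ((freeMod P ι).lm r), s.pairs.card) := by
  have hX := freeAdm hr
  obtain ⟨i, j, g, h, q, η, hp, hg, hh, hd⟩ := hst
  -- The treated pair now reduces, and all others keep their status. The set `G` is left open to
  -- serve the branches with and without a new generator.
  have hsp : ∀ G : Set (ι → A), {x | x ∈ s.gens.map Prod.fst} ⊆ G → (η = 0 ∨ η ∈ G) →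
      ∀ (i' j' : ℕ) g' h', i' < j' → (s.gens.map Prod.fst)[i']? = some g' →
      (s.gens.map Prod.fst)[j']? = some h' → (i', j') ∈ s.pairs.erase (i, j) ∨
        SPairReduces (freeMod P ι) r G g' h' := by
    intro G hG hη i' j' g' h' hij hg' hh'
    rcases hs.reduces i' j' g' h' hij hg' hh' with h1 | h1
    · by_cases he : (i', j') = (i, j)
      · right
        obtain ⟨rfl, rfl⟩ := Prod.mk.inj he
        rw [List.getElem?_map, hg] at hg'
        rw [List.getElem?_map, hh] at hh'
        obtain rfl : g.1 = g' := by simpa using hg'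
        obtain rfl : h.1 = h' := by simpa using hh'
        exact hX.sPairReduces_of_divL hd hG (hη.imp_right fun h => ⟨h, act_zero_freeMod⟩)
      · exact Or.inl (Finset.mem_erase.2 ⟨he, h1⟩)
    · exact Or.inr (h1.mono hG)
  unfold lgbNext
  split_ifs with hη
  · refine ⟨⟨hs.ne_zero, hs.row, hs.mem, ?_, ?_⟩, ?_⟩
    · exact fun p hp => hs.valid p (Finset.mem_of_mem_erase hp)
    · exact hsp _ le_rfl (Or.inl hη)
    · exact Prod.Lex.right _ (Finset.card_erase_lt_of_mem hp)
  · have hmap : ∀ w, (s.gens ++ [(η, w)]).map Prod.fst = s.gens.map Prod.fst ++ [η] := by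
      simp
    refine ⟨⟨?_, ?_, ?_, ?_, ?_⟩, ?_⟩
    · intro g' hg'
      rcases List.mem_append.1 hg' with hg' | hg'
      · exact hs.ne_zero g' hg'
      · rw [List.mem_singleton.1 hg']
        exact hη
    · intro g' hg'
      rcases List.mem_append.1 hg' with hg' | hg'
      · exact hs.row g' hg'
      · rw [List.mem_singleton.1 hg']
        -- The new row is the S-polynomial minus the quotient combination, written in the original
        -- generators; the division identity shows that its value is the remainder.
        have h1 := divL_sum_freeMod hd
        rw [sPoly_freeMod] at h1
        simp only [map_sub, map_smul, linearCombination_rowComb _ hs.row,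
          ← hs.row g (List.mem_of_getElem? hg), ← hs.row h (List.mem_of_getElem? hh)]
        rw [h1, add_sub_cancel_left]
    · intro u hu
      rw [hmap]
      exact List.mem_append_left _ (hs.mem u hu)
    · intro p hp
      simp only [List.length_append, List.length_singleton]
      rcases Finset.mem_union.1 hp with hp | hp
      · have := hs.valid p (Finset.mem_of_mem_erase hp)
        omega
      · have := MonomialModule.mem_pairsTo.1 hp
        omega
    · intro i' j' g' h' hij hg' hh'
      simp only [hmap] at hg' hh' ⊢
      have hsub : {x | x ∈ s.gens.map Prod.fst} ⊆ {x | x ∈ s.gens.map Prod.fst ++ [η]} :=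
        fun x hx => List.mem_append_left _ hx
      have hlen := (List.getElem?_eq_some_iff.1 hh').1
      simp only [List.length_append, List.length_map, List.length_singleton] at hlen
      by_cases hj : j' < s.gens.length
      · rw [List.getElem?_append_left (by simpa using hij.trans hj)] at hg'
        rw [List.getElem?_append_left (by simpa using hj)] at hh'
        refine (hsp _ hsub (Or.inr (by simp)) i' j' g' h' hij hg' hh').imp_left fun h1 => ?_
        exact Finset.mem_union_left _ h1
      · obtain rfl : j' = s.gens.length := by omega
        by_cases h0 : (freeMod P ι).sPoly r g' h' = 0
        · exact Or.inr (sPairReduces_of_eq_zero h0)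
        · left
          refine Finset.mem_union_right _ (MonomialModule.mem_pairsTo.2 ⟨hij, rfl, ?_⟩)
          simpa only [List.getD_eq_getElem?_getD, hg', hh', Option.getD_some] using h0
    · simp only [hmap]
      exact Prod.Lex.left _ _ (hX.dicksonExt_append hη (hX.divL_remainder hd))

theorem runLGB_of (hr : IsGradedLeftMonomialOrdering P b r) {U : List (ι → A)}
    (hU : ∀ u ∈ U, u ≠ 0) {Q : List ((ι → A) × (Fin U.length → A)) → Prop}
    (hQ : ∀ G, IsBuchbergerBasis P r U G → Q G) : RunLGB P r U Q := by
  refine Always.of_invariant (LGBInv P r U)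
    (WellFounded.prod_lex wellFounded_dicksonExt wellFounded_lt)
    (fun s => ((s.gens.map Prod.fst).filterMap ((freeMod P ι).lm r), s.pairs.card))
    ?_ (fun s t hs hst => lgbInv_step hr hs hst) ?_ (lgbInv_start U hU)
  · intro s hs hne
    obtain ⟨⟨i, j⟩, hp⟩ := Finset.nonempty_iff_ne_empty.2 hne
    obtain ⟨h1, h2⟩ := hs.valid _ hp
    obtain ⟨q, η, hd⟩ := (freeAdm hr).exists_divL (s.gens.map Prod.fst)
      ((freeMod P ι).sPoly r (s.gens[i]'(h2.trans h1)).1 (s.gens[j]'h1).1)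
    exact ⟨_, LGBStep.mk s i j _ _ q η hp (List.getElem?_eq_getElem _)
      (List.getElem?_eq_getElem _) hd⟩
  · intro s hs hemp
    refine hQ _ ⟨hs.ne_zero, hs.row, hs.mem, fun i j g h hij hg hh => ?_⟩
    refine (hs.reduces i j g h hij hg hh).resolve_left ?_
    rw [hemp]
    exact Finset.notMem_empty _

/-! #### Properties of the computed bases -/

namespace IsBuchbergerBasis

variable {U : List (ι → A)} {G : List ((ι → A) × (Fin U.length → A))}

omit [Finite ι] in
theorem mem_span (h : IsBuchbergerBasis P r U G) {g} (hg : g ∈ G) :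
    g.1 ∈ Submodule.span A {x | x ∈ U} := by
  rw [h.row g hg, Fintype.linearCombination_apply]
  exact Submodule.sum_mem _ fun k _ => Submodule.smul_mem _ _
    (Submodule.subset_span (List.get_mem U k))

theorem mem_repSpan (h : IsBuchbergerBasis P r U G) (hr : IsGradedLeftMonomialOrdering P b r)
    {x : ι → A} (hx : x ∈ Submodule.span A {x | x ∈ U}) :
    x ∈ repSpan (freeMod P ι) r {x | x ∈ G.map Prod.fst} Set.univ := by
  -- The target is only a $K$-subspace, so the induction over an $A$-span is run for all multiples
  -- at once.
  suffices H : ∀ f : A, f • x ∈ repSpan (freeMod P ι) r {x | x ∈ G.map Prod.fst} Set.univ by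
    simpa using H 1
  induction hx using Submodule.span_induction with
  | mem u hu =>
    intro f
    have hu' := h.mem u hu
    obtain ⟨g, hg, rfl⟩ := List.mem_map.1 hu'
    obtain ⟨t, ht⟩ := (freeAdm hr).exists_isLeading (h.ne_zero g hg)
    rw [← P.sum_repr f, Finsupp.sum, Finset.sum_smul]
    refine Submodule.sum_mem _ fun γ _ => ?_
    rw [smul_assoc]
    refine Submodule.smul_mem _ _ (Submodule.subset_span ⟨g.1, hu', γ, shift γ t, ?_,
      Set.mem_univ _, rfl⟩)
    exact (freeAdm hr).divides_iff.2 ⟨t, ht, rfl⟩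
  | zero =>
    intro f
    rw [smul_zero]
    exact Submodule.zero_mem _
  | add x y _ _ hx hy =>
    intro f
    rw [smul_add]
    exact Submodule.add_mem _ (hx f) (hy f)
  | smul a x _ hx =>
    intro f
    rw [smul_smul]
    exact hx _

theorem exists_divides (h : IsBuchbergerBasis P r U G)
    (hr : IsGradedLeftMonomialOrdering P b r) {x : ι → A}
    (hx : x ∈ Submodule.span A {x | x ∈ U}) {s} (hs : IsLeading r (P.coef x) s) :
    ∃ g ∈ G, ∃ α, (freeMod P ι).Divides r g.1 s α := by
  have hX := freeAdm hr
  obtain ⟨t, ht, ht'⟩ := hX.buchberger (G := G.map Prod.fst) (D := Set.univ)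
    (fun g hg => by
      obtain ⟨g, hg', rfl⟩ := List.mem_map.1 hg
      exact h.ne_zero g hg')
    (fun _ _ _ _ => Set.mem_univ _)
    (fun i j g g' hij hg hg' _ => h.reduces i j g g' hij hg hg')
    (h.mem_repSpan hr hx) (hX.ne_zero_of_isLeading hs)
  obtain rfl := IsLeading.unique hr.strictTotal hs ht
  obtain ⟨g, hg, α, hα⟩ := hX.exists_mdvd_of_mem_repSpan hs ht'
  obtain ⟨g, hg', rfl⟩ := List.mem_map.1 hg
  exact ⟨g, hg', α, hα⟩

theorem isLeftGroebnerBasis (h : IsBuchbergerBasis P r U G)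
    (hr : IsGradedLeftMonomialOrdering P b r) :
    IsLeftGroebnerBasis P r (Submodule.span A {x | x ∈ U}) (G.map Prod.fst) := by
  refine ⟨fun g hg => ?_, fun ξ hξ hξ0 => ?_⟩
  · obtain ⟨g, hg', rfl⟩ := List.mem_map.1 hg
    exact ⟨h.ne_zero g hg', h.mem_span hg'⟩
  · obtain ⟨s, hs⟩ := (freeAdm hr).exists_isLeading hξ0
    obtain ⟨g, hg, α, hα⟩ := h.exists_divides hr hξ hs
    obtain ⟨t, ht, rfl⟩ := (freeAdm hr).divides_iff.1 hα
    exact ⟨g.1, List.mem_map_of_mem hg, _, t, α, hs, ht, hr.isLeading_smul_mon α t⟩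

theorem isStandardBasis (h : IsBuchbergerBasis P r U G)
    (hr : IsGradedLeftMonomialOrdering P b r) :
    IsStandardBasis P (P.freeFil b) (Submodule.span A {x | x ∈ U}) (G.map Prod.fst).get := by
  have hX := freeAdm hr
  have hmem : ∀ k : Fin (G.map Prod.fst).length, ∃ g ∈ G, g.1 = (G.map Prod.fst).get k :=
    fun k => List.mem_map.1 (List.get_mem _ k)
  have hne : ∀ k, (G.map Prod.fst).get k ≠ 0 := fun k => by
    obtain ⟨g, hg, hk⟩ := hmem k
    exact hk ▸ h.ne_zero g hg
  choose lead hlead using fun k => hX.exists_isLeading (hne k)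
  refine isStandardBasis_of_groebner hr (fun k => ?_) hlead fun x hx s hs => ?_
  · obtain ⟨g, hg, hk⟩ := hmem k
    exact hk ▸ h.mem_span hg
  · obtain ⟨g, hg, α, hα⟩ := h.exists_divides hr hx hs
    obtain ⟨k, hk⟩ := List.get_of_mem (List.mem_map_of_mem (f := Prod.fst) hg)
    obtain ⟨t, ht, hts⟩ := hX.divides_iff.1 hα
    refine ⟨k, α, ?_⟩
    rw [← hk] at ht
    rw [← hts, IsLeading.unique hr.strictTotal (hlead k) ht]

/-- The remainder lies in the module again, so a nonzero one would have a divisible leading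
monomial. -/
theorem divL_eq_zero (h : IsBuchbergerBasis P r U G) (hr : IsGradedLeftMonomialOrdering P b r)
    {x η : ι → A} (hx : x ∈ Submodule.span A {x | x ∈ U}) {q : ℕ → Expo n →₀ K}
    (hd : (freeMod P ι).DivL r (G.map Prod.fst) x q η) : η = 0 := by
  have hX := freeAdm hr
  by_contra hη
  obtain ⟨s, hs⟩ := hX.exists_isLeading hη
  have hmem : η ∈ Submodule.span A {x | x ∈ U} := by
    rw [divL_sum_freeMod hd] at hx
    refine (Submodule.add_mem_iff_right _ ?_).1 hx
    exact Submodule.sum_mem _ fun k _ => Submodule.smul_mem _ _ (h.mem_span (List.get_mem G k))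
  obtain ⟨g, hg, α, hα⟩ := h.exists_divides hr hmem hs
  exact hX.divL_remainder hd s hs.1 g.1 (List.mem_map_of_mem hg) α hα

theorem exists_divL_zero (h : IsBuchbergerBasis P r U G)
    (hr : IsGradedLeftMonomialOrdering P b r) {x : ι → A}
    (hx : x ∈ Submodule.span A {x | x ∈ U}) :
    ∃ q, (freeMod P ι).DivL r (G.map Prod.fst) x q 0 := by
  obtain ⟨q, η, hd⟩ := (freeAdm hr).exists_divL (G.map Prod.fst) x
  obtain rfl := h.divL_eq_zero hr hx hd
  exact ⟨q, hd⟩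

theorem exists_isSyzygyOutput (h : IsBuchbergerBasis P r U G)
    (hr : IsGradedLeftMonomialOrdering P b r) : ∃ S, IsSyzygyOutput P r U G S := by
  choose q hq using fun k : Fin U.length =>
    h.exists_divL_zero hr (Submodule.subset_span (List.get_mem U k))
  have hS : ∀ i j : Fin G.length, (freeMod P ι).sPoly r (G.get i).1 (G.get j).1 ∈
      Submodule.span A {x | x ∈ U} := fun i j => by
    rw [sPoly_freeMod]
    exact Submodule.sub_mem _ (Submodule.smul_mem _ _ (h.mem_span (List.get_mem G i)))
      (Submodule.smul_mem _ _ (h.mem_span (List.get_mem G j)))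
  choose f hf using fun i j => h.exists_divL_zero hr (hS i j)
  exact ⟨_, q, f, hq, fun i j _ => hf i j, rfl⟩

/-- The syzygy of the Gröbner basis that results from the division of an S-polynomial. -/
def sSyzygy (P : GradedSolvPolyAlg K A n) (r : Expo n × ι → Expo n × ι → Prop) {m : ℕ}
    (G : List ((ι → A) × (Fin m → A))) (i j : Fin G.length) (q : ℕ → Expo n →₀ K) :
    Fin G.length → A :=
  Pi.single i (P.toA ((freeMod P ι).cof r (G.get i).1 (G.get j).1)) -
    Pi.single j (P.toA ((freeMod P ι).cof r (G.get j).1 (G.get i).1)) -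
    (fun l : Fin G.length => P.toA (q l) : Fin G.length → A)

/-- Schreyer's theorem: the syzygies of a Gröbner basis are generated by those that
result from the S-polynomials. -/
theorem ker_le_span_sSyzygy (h : IsBuchbergerBasis P r U G)
    (hr : IsGradedLeftMonomialOrdering P b r)
    {f : Fin G.length → Fin G.length → ℕ → Expo n →₀ K}
    (hf : ∀ i j, i < j → (freeMod P ι).DivL r (G.map Prod.fst)
      ((freeMod P ι).sPoly r (G.get i).1 (G.get j).1) (f i j) 0) :
    LinearMap.ker (Fintype.linearCombination A fun k => (G.get k).1) ≤
      Submodule.span A {z | ∃ i j, i < j ∧ z = sSyzygy P r G i j (f i j)} := by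
  have hX := freeAdm hr
  set φ := Fintype.linearCombination A fun k => (G.get k).1 with hφ
  choose lead hlead using fun k => hX.exists_isLeading (h.ne_zero (G.get k) (List.get_mem G k))
  set mono : Fin G.length → Expo n → (Fin G.length → A) := fun k α =>
    Pi.single k (P.basis α) with hmono
  have hφmono : ∀ k α, φ (mono k α) = P.basis α • (G.get k).1 := fun k α => by
    simp [hφ, hmono, Fintype.linearCombination_apply_single]
  set T := Submodule.span A {z | ∃ i j, i < j ∧ z = sSyzygy P r G i j (f i j)} with hT
  have hTker : ∀ z ∈ T, φ z = 0 := by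
    intro z hz
    refine (Submodule.span_le (p := LinearMap.ker φ)).2 ?_ hz
    rintro z ⟨i, j, hij, rfl⟩
    have h1 := divL_sum_freeMod (hf i j hij)
    rw [sPoly_freeMod, add_zero] at h1
    have h2 : φ (fun l => P.toA (f i j l)) =
      ∑ k : Fin G.length, P.toA (f i j k) • (G.get k).1 := rfl
    simp only [SetLike.mem_coe, LinearMap.mem_ker, sSyzygy, map_sub, h2]
    rw [← h1]
    simp [hφ, Fintype.linearCombination_apply_single]
  have hpair : ∀ i j, i < j → (lead i).2 = (lead j).2 →
      ∃ a b : K, a ≠ 0 ∧ b ≠ 0 ∧ a • mono i ((lead i).1 ⊔ (lead j).1 - (lead i).1) -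
        b • mono j ((lead i).1 ⊔ (lead j).1 - (lead j).1) ∈ T.restrictScalars K ⊔
          MonomialModule.monoSpan K lead mono
            {t | r t ((lead i).1 ⊔ (lead j).1, (lead i).2)} := by
    intro i j hij h2
    obtain ⟨a, b, ha, hb, hca, hcb, -, hsupp⟩ := hX.sPoly_spec (hlead i) (hlead j) h2
    refine ⟨a, b, ha, hb, ?_⟩
    -- The S-pair is its syzygy plus the vector of division quotients.
    have e : a • mono i ((lead i).1 ⊔ (lead j).1 - (lead i).1) -
        b • mono j ((lead i).1 ⊔ (lead j).1 - (lead j).1) =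
        sSyzygy P r G i j (f i j) +
          (fun l : Fin G.length => P.toA (f i j l) : Fin G.length → A) := by
      rw [sSyzygy, hca, hcb, sub_add_cancel, hmono]
      simp only [P.toA_single, Pi.single_smul]
    rw [e]
    refine Submodule.add_mem_sup (Submodule.subset_span ⟨i, j, hij, rfl⟩) ?_
    have e2 : (fun l : Fin G.length => P.toA (f i j l)) = ∑ l : Fin G.length,
        ((f i j l).sum fun γ κ => κ • mono l γ) := by
      rw [← Finset.univ_sum_single fun l : Fin G.length => P.toA (f i j l)]
      refine Finset.sum_congr rfl fun l _ => ?_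
      rw [GradedSolvPolyAlg.toA, Finsupp.sum, ← AddMonoidHom.single_apply, map_sum]
      refine Finset.sum_congr rfl fun γ _ => ?_
      rw [AddMonoidHom.single_apply, Pi.single_smul]
    rw [e2]
    refine Submodule.sum_mem _ fun l _ => Submodule.sum_mem _ fun γ hγ =>
      Submodule.smul_mem _ _ ?_
    -- Every quotient term was used to cancel a monomial below the least common multiple, so as a
    -- formal term it is small.
    obtain ⟨ξ, t, hξ, ht, hdv⟩ := (hX.divL_supp (fun _ hs' _ _ _ h =>
      hX.act_mem_suppIn_of_isLower (hX.isLower_lt _) hs' h) (hf i j hij) hsupp).2 l γ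
        (Finsupp.mem_support_iff.1 hγ)
    obtain ⟨u, hu, rfl⟩ := hX.divides_iff.1 hdv
    have hξl : ξ = (G.get l).1 := by
      rw [List.getElem?_map, List.getElem?_eq_getElem l.2] at hξ
      simpa using hξ.symm
    rw [hξl] at hu
    rw [IsLeading.unique hr.strictTotal hu (hlead l)] at ht
    exact MonomialModule.mem_monoSpan ht
  intro z hz
  have hz' : z ∈ MonomialModule.monoSpan K lead mono Set.univ := by
    rw [← Finset.univ_sum_single z]
    refine Submodule.sum_mem _ fun k _ => ?_
    rw [← P.sum_repr (z k), Finsupp.sum, ← AddMonoidHom.single_apply, map_sum]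
    refine Submodule.sum_mem _ fun γ _ => ?_
    rw [AddMonoidHom.single_apply, Pi.single_smul]
    exact Submodule.smul_mem _ _ (MonomialModule.mem_monoSpan (Set.mem_univ _))
  obtain ⟨w, hw, hw'⟩ := hX.exists_standard_rep (lead := lead) (mono := mono)
    (φ.restrictScalars K)
    (fun k α => by
      rw [LinearMap.restrictScalars_apply, hφmono]
      exact hX.lead_act α (hlead k))
    (fun δ => Algebra.lsmul K K (Fin G.length → A) (P.basis δ))
    (fun α β => by
      have hl := P.isLeading_mul α β
      refine ⟨P.basis.repr (P.basis α * P.basis β), hl.1, fun γ hγ => ?_, fun k => ?_⟩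
      · exact (hl.2 γ hγ).imp_right fun h s => hr.shift_left_lt h s
      · rw [Algebra.lsmul_coe, hmono]
        simp only [← Pi.single_smul]
        rw [smul_eq_mul]
        conv_lhs => rw [← P.sum_repr (P.basis α * P.basis β)]
        rw [Finsupp.sum, ← AddMonoidHom.single_apply, map_sum]
        rfl)
    (T.restrictScalars K)
    (fun δ z hz => T.smul_mem (P.basis δ) hz)
    (D := Set.univ) (fun _ _ _ _ => Set.mem_univ _)
    (fun i j h2 _ => by
      rcases lt_trichotomy i j with hij | rfl | hij
      · exact hpair i j hij h2
      · refine ⟨1, 1, one_ne_zero, one_ne_zero, ?_⟩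
        rw [sub_self]
        exact Submodule.zero_mem _
      · obtain ⟨a, b, ha, hb, hab⟩ := hpair j i hij h2.symm
        refine ⟨b, a, hb, ha, ?_⟩
        have := Submodule.neg_mem _ hab
        rwa [neg_sub, sup_comm (lead j).1, ← h2] at this) hz'
  -- `T` consists of syzygies, so `w` is one as well. Its value then has no leading monomial, which
  -- leaves `w = 0` and puts `z` in `T`.
  have hφw : φ w = 0 := by
    have := hTker _ hw
    rwa [map_sub, LinearMap.mem_ker.1 hz, zero_sub, neg_eq_zero] at this
  rcases hw' with rfl | ⟨s, hs, -⟩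
  · simpa using hw
  · exact absurd hφw (hX.ne_zero_of_isLeading hs)

omit [Finite ι] in
theorem span_filter_ne_zero {M : Type*} [AddCommGroup M] [Module A M]
    [∀ x : M, Decidable (x ≠ 0)] (L : List M) :
    Submodule.span A {x | x ∈ L.filter fun x => x ≠ 0} = Submodule.span A {x | x ∈ L} := by
  apply le_antisymm
  · exact Submodule.span_mono fun x hx => (List.mem_filter.1 hx).1
  · refine Submodule.span_le.2 fun x hx => ?_
    by_cases h0 : x = 0
    · rw [h0]
      exact Submodule.zero_mem _
    · exact Submodule.subset_span (List.mem_filter.2 ⟨hx, by simpa using h0⟩)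

/-- With $\mathcal G=VU$ and $U=Q\mathcal G$, a syzygy $z$ of $U$ gives the syzygy $zQ$ of $\mathcal
G$, and $z=(zQ)V-z(QV-E)$. Schreyer's theorem covers the first summand, and the rows of $QV-E$ the
second. -/
theorem span_isSyzygyOutput (h : IsBuchbergerBasis P r U G)
    (hr : IsGradedLeftMonomialOrdering P b r) {S : List (Fin U.length → A)}
    (hS : IsSyzygyOutput P r U G S) : Submodule.span A {x | x ∈ S} =
      LinearMap.ker (Fintype.linearCombination A U.get) := by
  obtain ⟨q, f, hq, hf, rfl⟩ := hS
  set φ := Fintype.linearCombination A U.get with hφ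
  set ψ := Fintype.linearCombination A fun k => (G.get k).2 with hψ
  have hrow : ∀ c : ℕ → Expo n →₀ K, rowComb P G c = ψ fun l => P.toA (c l) := fun c => rfl
  have hφψ : ∀ z, φ (ψ z) = Fintype.linearCombination A (fun k => (G.get k).1) z := by
    intro z
    simp only [hψ, Fintype.linearCombination_apply, map_sum, map_smul]
    exact Finset.sum_congr rfl fun k _ => by rw [← h.row _ (List.get_mem G k)]
  have hO : ∀ i j, rowComb P G (f i j)
      - P.toA ((freeMod P ι).cof r (G.get i).1 (G.get j).1) • (G.get i).2
      + P.toA ((freeMod P ι).cof r (G.get j).1 (G.get i).1) • (G.get j).2 =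
      - ψ (sSyzygy P r G i j (f i j)) := by
    intro i j
    rw [sSyzygy, map_sub, map_sub, hrow]
    simp only [hψ, Fintype.linearCombination_apply_single]
    abel
  have hD : ∀ k, φ (rowComb P G (q k) - stdVec A k) = 0 := by
    intro k
    have h1 := divL_sum_freeMod (hq k)
    rw [add_zero] at h1
    rw [map_sub, linearCombination_rowComb φ h.row, ← h1]
    simp [hφ, stdVec, Fintype.linearCombination_apply_single]
  simp only [hO]
  rw [span_filter_ne_zero]
  apply le_antisymm
  · refine Submodule.span_le.2 ?_
    intro x hx
    rw [SetLike.mem_coe, LinearMap.mem_ker]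
    rcases List.mem_append.1 hx with hx | hx
    · obtain ⟨⟨i, j⟩, hij, rfl⟩ := List.mem_map.1 hx
      have hij : i < j := by simpa using (List.mem_filter.1 hij).2
      have h1 := divL_sum_freeMod (hf i j hij)
      rw [sPoly_freeMod, add_zero] at h1
      have h2 : Fintype.linearCombination A (fun k => (G.get k).1)
        (fun l : Fin G.length => P.toA (f i j l)) =
          ∑ k : Fin G.length, P.toA (f i j k) • (G.get k).1 := rfl
      rw [map_neg, hφψ, neg_eq_zero, sSyzygy, map_sub, map_sub, h2, ← h1]
      simp [Fintype.linearCombination_apply_single]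
    · obtain ⟨k, -, rfl⟩ := List.mem_map.1 hx
      exact hD k
  · intro z hz
    -- Replacing the span by an arbitrary submodule containing both kinds of rows separates the
    -- algebra from membership in the list.
    suffices H : ∀ S : Submodule A (Fin U.length → A),
        (∀ i j, i < j → - ψ (sSyzygy P r G i j (f i j)) ∈ S) →
        (∀ k, rowComb P G (q k) - stdVec A k ∈ S) → z ∈ S by
      refine H _ (fun i j hij => Submodule.subset_span (List.mem_append_left _
        (List.mem_map.2 ⟨(i, j), List.mem_filter.2 ⟨?_, by simpa using hij⟩, rfl⟩)))
        (fun k => Submodule.subset_span (List.mem_append_right _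
          (List.mem_map.2 ⟨k, List.mem_finRange k, rfl⟩)))
      exact List.mem_product.2 ⟨List.mem_finRange i, List.mem_finRange j⟩
    intro S hψS hDS
    set y : Fin G.length → A := ∑ k, z k • fun l : Fin G.length => P.toA (q k l) with hy
    have hzy : z = ψ y - ∑ k, z k • (rowComb P G (q k) - stdVec A k) := by
      have e : ∑ k, z k • stdVec A k = z := by
        conv_rhs => rw [← Finset.univ_sum_single z]
        refine Finset.sum_congr rfl fun k _ => ?_
        ext l
        by_cases hkl : l = k
        · subst hkl
          simp [stdVec]
        · simp [stdVec, hkl]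
      simp only [hy, map_sum, map_smul, ← hrow, smul_sub, Finset.sum_sub_distrib, e]
      abel
    have hyker : y ∈ LinearMap.ker (Fintype.linearCombination A fun k => (G.get k).1) := by
      rw [LinearMap.mem_ker, ← hφψ]
      have h1 := LinearMap.mem_ker.1 hz
      have h2 : φ (∑ k, z k • (rowComb P G (q k) - stdVec A k)) = 0 := by
        simp only [map_sum, map_smul, hD, smul_zero, Finset.sum_const_zero]
      rwa [hzy, map_sub, h2, sub_zero] at h1
    have hyT := h.ker_le_span_sSyzygy hr hf hyker
    rw [hzy]
    refine Submodule.sub_mem _ ?_ (Submodule.sum_mem _ fun k _ => Submodule.smul_mem _ _ (hDS k))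
    have hle : Submodule.span A {z | ∃ i j, i < j ∧ z = sSyzygy P r G i j (f i j)} ≤
        S.comap ψ := by
      refine Submodule.span_le.2 ?_
      rintro z ⟨i, j, hij, rfl⟩
      have := Submodule.neg_mem _ (hψS i j hij)
      rwa [neg_neg] at this
    exact hle hyT

end IsBuchbergerBasis

/-! ### Minimal homogeneous generating sets -/

section HomogeneousGenerators

variable {K A : Type*} [Field K] [Ring A] [Algebra K A] {n : ℕ} {P : GradedSolvPolyAlg K A n}
  {ι : Type*} {b : ι → ℕ} {r : Expo n × ι → Expo n × ι → Prop}

open MonomialModule.Admissible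

/-- All monomials of `x` have degree `d`. -/
def IsHomog (P : GradedSolvPolyAlg K A n) (b : ι → ℕ) (d : ℕ) (x : Expo n × ι →₀ K) : Prop :=
  ∀ t, x t ≠ 0 → mdeg P b t = d

theorem IsHomog.grDeg_eq {d : ℕ} {x : Expo n × ι →₀ K} (h : IsHomog P b d x) (h0 : x ≠ 0) :
    grDeg P b x = d := SolvPoly.grDeg_eq P h h0

theorem IsHomog.act {d : ℕ} {x : Expo n × ι →₀ K} (h : IsHomog P b d x) (α : Expo n) :
    IsHomog P b (P.wdeg α + d) ((grMod P ι).act α x) :=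
  fun _ ht => act_grMod_homogeneous b h ht

theorem IsHomog.sub {d : ℕ} {x y : Expo n × ι →₀ K} (hx : IsHomog P b d x)
    (hy : IsHomog P b d y) : IsHomog P b d (x - y) := by
  intro t ht
  by_cases h : x t = 0
  · exact hy t fun h' => ht (by simp [h, h'])
  · exact hx t h

/-- The graded submodule generated by `S`. -/
def grSpan (P : GradedSolvPolyAlg K A n) (S : Set (Expo n × ι →₀ K)) :
    Submodule K (Expo n × ι →₀ K) :=
  Submodule.span K {x | ∃ u ∈ S, ∃ α, x = (grMod P ι).act α u}

theorem act_mem_grSpan {S : Set (Expo n × ι →₀ K)} {u : Expo n × ι →₀ K} (h : u ∈ S)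
    (α : Expo n) : (grMod P ι).act α u ∈ grSpan P S :=
  Submodule.subset_span ⟨u, h, α, rfl⟩

theorem mem_grSpan {S : Set (Expo n × ι →₀ K)} {u : Expo n × ι →₀ K} (h : u ∈ S) :
    u ∈ grSpan P S := by
  simpa using act_mem_grSpan (P := P) h 0

theorem grSpan_mono {S S' : Set (Expo n × ι →₀ K)} (h : S ⊆ S') : grSpan P S ≤ grSpan P S' :=
  Submodule.span_mono fun _ ⟨u, hu, hx⟩ => ⟨u, h hu, hx⟩

/-- `grSpan` is merely a $K$-span of monomial multiples; expanding products of monomials shows that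
it is stable under the action. -/
theorem grSpan_le_grSpan [Finite ι] (hr : IsGradedLeftMonomialOrdering P b r)
    {S S' : Set (Expo n × ι →₀ K)} (h : ∀ u ∈ S, u ∈ grSpan P S') :
    grSpan P S ≤ grSpan P S' := by
  have hact : ∀ α, ∀ x ∈ grSpan P S', (grMod P ι).act α x ∈ grSpan P S' := by
    intro α x hx
    rw [act_grMod]
    revert x
    suffices H : grSpan P S' ≤ (grSpan P S').comap (grActL P ι α) from fun x hx => H hx
    refine Submodule.span_le.2 ?_
    rintro _ ⟨u, hu, β, rfl⟩
    obtain ⟨c, -, -, hc⟩ := (grAdm hr).act_act α β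
    rw [Submodule.comap_coe, Set.mem_preimage, ← act_grMod, hc]
    exact evalAct_mem _ fun γ _ => act_mem_grSpan hu γ
  refine Submodule.span_le.2 ?_
  rintro _ ⟨u, hu, α, rfl⟩
  exact hact α u (h u hu)

/-- Homogeneous elements of a graded submodule only involve generators times monomials of the
right degree. -/
theorem mem_span_of_isHomog {S : Set (Expo n × ι →₀ K)} {dd : (Expo n × ι →₀ K) → ℕ}
    (hS : ∀ u ∈ S, IsHomog P b (dd u) u) {d : ℕ} {x : Expo n × ι →₀ K} (hx : x ∈ grSpan P S)
    (hd : IsHomog P b d x) :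
    x ∈ Submodule.span K {y | ∃ u ∈ S, ∃ α, P.wdeg α + dd u = d ∧ y = (grMod P ι).act α u} := by
  -- The projection to degree `d` fixes `x` and either keeps or kills each multiple of a generator.
  let π : (Expo n × ι →₀ K) →ₗ[K] (Expo n × ι →₀ K) :=
    { toFun := fun x => x.filter fun s => mdeg P b s = d
      map_add' := fun x y => Finsupp.filter_add
      map_smul' := fun c x => Finsupp.filter_smul }
  have hπx : π x = x := Finsupp.filter_eq_self_iff _ _ |>.2 fun t ht => hd t ht
  rw [← hπx]
  revert x
  suffices H : grSpan P S ≤ (Submodule.span K {y | ∃ u ∈ S, ∃ α, P.wdeg α + dd u = d ∧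
      y = (grMod P ι).act α u}).comap π from fun x hx _ _ => H hx
  refine Submodule.span_le.2 ?_
  rintro _ ⟨u, hu, α, rfl⟩
  have hh := (hS u hu).act α
  rw [Submodule.comap_coe, Set.mem_preimage]
  by_cases h : P.wdeg α + dd u = d
  · have : π ((grMod P ι).act α u) = (grMod P ι).act α u :=
      Finsupp.filter_eq_self_iff _ _ |>.2 fun t ht => (hh t ht).trans h
    rw [this]
    exact Submodule.subset_span ⟨u, hu, α, h, rfl⟩
  · have : π ((grMod P ι).act α u) = 0 :=
      Finsupp.filter_eq_zero_iff _ _ |>.2 fun t ht => by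
        by_contra hne
        exact h ((hh t hne).symm.trans ht)
    rw [this]
    exact Submodule.zero_mem _

/-- The members of the list `U` with index in `L`. -/
def pick {V : Type*} (U : List V) (L : List ℕ) : Set V := {u | ∃ k ∈ L, U[k]? = some u}

theorem pick_mono {V : Type*} {U : List V} {L L' : List ℕ} (h : L ⊆ L') :
    pick U L ⊆ pick U L' := fun _ ⟨k, hk, hu⟩ => ⟨k, h hk, hu⟩

/-- Each selected element is not contained in the submodule that is generated by the elements
selected earlier, whose degrees are not larger. -/
def IsIndependentSelection (P : GradedSolvPolyAlg K A n) (b : ι → ℕ)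
    (U : List (Expo n × ι →₀ K)) (sel : List ℕ) : Prop :=
  ∀ i k, sel[i]? = some k → ∃ u, U[k]? = some u ∧ u ∉ grSpan P (pick U (sel.take i)) ∧
    ∀ u' ∈ pick U (sel.take i), grDeg P b u' ≤ grDeg P b u

/-- The invariant of the algorithm for minimal homogeneous generating sets: the degrees below `c`
have been treated, up to the pairs and the elements of the current degree `c - 1`. -/
structure HGSInv (P : GradedSolvPolyAlg K A n) (b : ι → ℕ)
    (r : Expo n × ι → Expo n × ι → Prop) (U : List (Expo n × ι →₀ K))
    (s : HGSState (Expo n × ι →₀ K)) (c : ℕ) : Prop where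
  gens : ∀ g ∈ s.G, g ≠ 0 ∧ ∃ d < c, IsHomog P b d g
  gens_mem : ∀ g ∈ s.G, g ∈ grSpan P (pick U s.sel)
  sel_mem : ∀ u ∈ pick U s.sel, u ∈ grSpan P {g | g ∈ s.G}
  elems : ∀ k u, U[k]? = some u → k ∈ s.W ∨ k ∈ s.Wn ∨ u ∈ grSpan P {g | g ∈ s.G}
  degW : ∀ k ∈ s.W, k < U.length ∧ c ≤ grDeg P b (U.getD k 0)
  degWn : ∀ k ∈ s.Wn, k < U.length ∧ grDeg P b (U.getD k 0) + 1 = c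
  degS : ∀ p ∈ s.S, p.1 < p.2 ∧ p.2 < s.G.length ∧ c ≤ pairDeg P b r s.G p
  degSn : ∀ p ∈ s.Sn, p.1 < p.2 ∧ p.2 < s.G.length ∧ pairDeg P b r s.G p + 1 = c
  reduces : ∀ (i j : ℕ) g h, i < j → s.G[i]? = some g → s.G[j]? = some h →
    (i, j) ∈ s.S ∨ (i, j) ∈ s.Sn ∨ SPairReduces (grMod P ι) r {g | g ∈ s.G} g h
  indep : IsIndependentSelection P b U s.sel
  sel_deg : ∀ u ∈ pick U s.sel, grDeg P b u < c

theorem pairDeg_append {G : List (Expo n × ι →₀ K)} (η : Expo n × ι →₀ K) {p : ℕ × ℕ}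
    (h1 : p.1 < p.2) (h2 : p.2 < G.length) :
    pairDeg P b r (G ++ [η]) p = pairDeg P b r G p := by
  unfold pairDeg
  rw [List.getD_append _ _ _ _ (h1.trans h2), List.getD_append _ _ _ _ h2]

theorem pairDeg_eq {G : List (Expo n × ι →₀ K)} {i j : ℕ} {g h : Expo n × ι →₀ K}
    (hg : G[i]? = some g) (hh : G[j]? = some h) :
    pairDeg P b r G (i, j) = grDeg P b ((grMod P ι).sPoly r g h) := by
  simp [pairDeg, List.getD_eq_getElem?_getD, hg, hh]

variable [Finite ι]

theorem isHomog_sPoly (hr : IsGradedLeftMonomialOrdering P b r) {g h : Expo n × ι →₀ K}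
    {d d' : ℕ} (hg : IsHomog P b d g) (hh : IsHomog P b d' h) {s t : Expo n × ι}
    (hs : IsLeading r g s) (ht : IsLeading r h t) (hst : s.2 = t.2) :
    IsHomog P b (mdeg P b (s.1 ⊔ t.1, s.2)) ((grMod P ι).sPoly r g h) := by
  obtain ⟨x, y, -, -, -, -, hS, -⟩ := (grAdm hr).sPoly_spec hs ht hst
  have e1 : P.wdeg (s.1 ⊔ t.1 - s.1) + d = mdeg P b (s.1 ⊔ t.1, s.2) := by
    rw [← hg s hs.1, ← mdeg_shift, shift_sup_sub_left]
  have e2 : P.wdeg (s.1 ⊔ t.1 - t.1) + d' = mdeg P b (s.1 ⊔ t.1, s.2) := by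
    rw [← hh t ht.1, ← mdeg_shift, shift_sup_sub_right hst]
  rw [hS]
  refine IsHomog.sub (fun u hu => ?_) fun u hu => ?_
  · rw [← e1]
    exact hg.act _ u (right_ne_zero_of_mul hu)
  · rw [← e2]
    exact hh.act _ u (right_ne_zero_of_mul hu)

/-- Here `divL_supp` is used with the monomials of degree `d`, which is not a down-set: a multiple
of a homogeneous divisor matching one monomial of degree `d` lies entirely in that degree. -/
theorem isHomog_of_divL (hr : IsGradedLeftMonomialOrdering P b r)
    {Ξ : List (Expo n × ι →₀ K)} (hΞ : ∀ ξ ∈ Ξ, ∃ d, IsHomog P b d ξ)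
    {ω η : Expo n × ι →₀ K} {q : ℕ → Expo n →₀ K} (hd : (grMod P ι).DivL r Ξ ω q η) {d : ℕ}
    (hω : IsHomog P b d ω) : IsHomog P b d η := by
  have hX := grAdm hr
  have := (hX.divL_supp (D := {t | mdeg P b t = d}) (fun s hs ξ hξ α hα => ?_) hd
    (hX.mem_suppIn.2 hω)).1
  · exact hX.mem_suppIn.1 this
  · obtain ⟨d', hd'⟩ := hΞ ξ hξ
    obtain ⟨t, ht, rfl⟩ := hX.divides_iff.1 hα
    refine hX.mem_suppIn.2 fun u hu => ?_
    have hs : mdeg P b (shift α t) = d := hs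
    rw [mdeg_shift, hd' t ht.1] at hs
    exact (hd'.act α u hu).trans hs

omit [Finite ι] in
theorem divL_sub_mem_grSpan {Ξ : List (Expo n × ι →₀ K)}
    {ω η : Expo n × ι →₀ K} {q : ℕ → Expo n →₀ K} (hd : (grMod P ι).DivL r Ξ ω q η) :
    ω - η ∈ grSpan P {g | g ∈ Ξ} := by
  rw [divL_sum hd, add_sub_cancel_right]
  exact Submodule.sum_mem _ fun k _ => evalAct_mem _ fun γ _ =>
    act_mem_grSpan (List.get_mem Ξ k) γ

omit [Finite ι] in
theorem sPoly_mem_grSpan {Ξ : List (Expo n × ι →₀ K)} {g h : Expo n × ι →₀ K} (hg : g ∈ Ξ)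
    (hh : h ∈ Ξ) : (grMod P ι).sPoly r g h ∈ grSpan P {g | g ∈ Ξ} :=
  Submodule.sub_mem _ (evalAct_mem _ fun γ _ => act_mem_grSpan hg γ)
    (evalAct_mem _ fun γ _ => act_mem_grSpan hh γ)

namespace HGSInv

variable {U : List (Expo n × ι →₀ K)} {s : HGSState (Expo n × ι →₀ K)} {c : ℕ}

/-- The pairs that arise when a reduced element of the current degree is appended have
larger degree. -/
theorem degS_append (h : HGSInv P b r U s c) (hr : IsGradedLeftMonomialOrdering P b r)
    {η : Expo n × ι →₀ K} (hη0 : η ≠ 0) {d : ℕ} (hη : IsHomog P b d η) (hdc : d + 1 = c)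
    (hrem : ∀ t, η t ≠ 0 → ∀ ξ ∈ s.G, ∀ β, ¬ (grMod P ι).Divides r ξ t β) :
    ∀ p ∈ s.S ∪ (grMod P ι).pairsTo r (s.G ++ [η]) s.G.length,
      p.1 < p.2 ∧ p.2 < (s.G ++ [η]).length ∧ c ≤ pairDeg P b r (s.G ++ [η]) p := by
  have hX := grAdm hr
  intro p hp
  rw [List.length_append, List.length_singleton]
  rcases Finset.mem_union.1 hp with hp | hp
  · obtain ⟨h1, h2, h3⟩ := h.degS p hp
    exact ⟨h1, by omega, by rwa [pairDeg_append η h1 h2]⟩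
  · obtain ⟨h1, h2, h3⟩ := MonomialModule.mem_pairsTo.1 hp
    refine ⟨h1, by omega, ?_⟩
    have hp1 : p.1 < s.G.length := h2 ▸ h1
    have e1 : (s.G ++ [η]).getD p.1 0 = s.G[p.1] := by
      rw [List.getD_append _ _ _ _ hp1, List.getD_eq_getElem _ _ hp1]
    have e2 : (s.G ++ [η]).getD p.2 0 = η := by
      rw [h2, List.getD_append_right _ _ _ _ le_rfl]
      simp
    unfold pairDeg
    rw [e1, e2] at h3 ⊢
    obtain ⟨hg0, d', -, hg⟩ := h.gens _ (List.getElem_mem hp1)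
    obtain ⟨u, hu⟩ := hX.exists_isLeading hg0
    obtain ⟨v, hv⟩ := hX.exists_isLeading hη0
    have huv : u.2 = v.2 := by
      by_contra hne
      exact h3 (hX.sPoly_eq_zero hu hv hne)
    rw [(isHomog_sPoly hr hg hη hu hv huv).grDeg_eq h3, ← shift_sup_sub_right huv, mdeg_shift,
      hη v hv.1]
    -- If the least common multiple were the leading monomial of `η`, the older leading monomial
    -- would divide it, against irreducibility. So the pair has strictly larger degree than `η`.
    have hne : P.wdeg (u.1 ⊔ v.1 - v.1) ≠ 0 := by
      intro h0
      rw [P.wdeg_eq_zero, tsub_eq_zero_iff_le] at h0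
      obtain ⟨α, hα⟩ := mdvd_iff.2 ⟨le_sup_left.trans h0, huv⟩
      exact hrem v hv.1 _ (List.getElem_mem hp1) α (hX.divides_iff.2 ⟨u, hu, hα⟩)
    omega

omit [Finite ι] in
-- Common to the treatment of pairs and of given elements; `C` stands for the pairs still pending in
-- the current degree.
theorem reduces_append {G : List (Expo n × ι →₀ K)} {S : Finset (ℕ × ℕ)} {η : Expo n × ι →₀ K}
    {C : ℕ → ℕ → Prop}
    (hred : ∀ (i j : ℕ) g h, i < j → G[i]? = some g → G[j]? = some h →
      (i, j) ∈ S ∨ C i j ∨ SPairReduces (grMod P ι) r {g | g ∈ G ++ [η]} g h) :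
    ∀ (i j : ℕ) g h, i < j → (G ++ [η])[i]? = some g → (G ++ [η])[j]? = some h →
      (i, j) ∈ S ∪ (grMod P ι).pairsTo r (G ++ [η]) G.length ∨ C i j ∨
        SPairReduces (grMod P ι) r {g | g ∈ G ++ [η]} g h := by
  intro i j g h hij hg hh
  have hlen := (List.getElem?_eq_some_iff.1 hh).1
  rw [List.length_append, List.length_singleton] at hlen
  by_cases hj : j < G.length
  · rw [List.getElem?_append_left (hij.trans hj)] at hg
    rw [List.getElem?_append_left hj] at hh
    exact (hred i j g h hij hg hh).imp_left fun h1 => Finset.mem_union_left _ h1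
  · obtain rfl : j = G.length := by omega
    by_cases h0 : (grMod P ι).sPoly r g h = 0
    · exact Or.inr (Or.inr (sPairReduces_of_eq_zero h0))
    · left
      refine Finset.mem_union_right _ (MonomialModule.mem_pairsTo.2 ⟨hij, rfl, ?_⟩)
      simpa only [List.getD_eq_getElem?_getD, hg, hh, Option.getD_some] using h0

/-- When the pairs of the current degree have been treated, `G` is a Gröbner basis up to
this degree. -/
theorem exists_divides (h : HGSInv P b r U s c) (hr : IsGradedLeftMonomialOrdering P b r)
    (hSn : s.Sn = ∅) {x : Expo n × ι →₀ K} (hx : x ∈ grSpan P {g | g ∈ s.G}) {d : ℕ}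
    (hd : IsHomog P b d x) (hdc : d < c) {t : Expo n × ι} (ht : IsLeading r x t) :
    ∃ g ∈ s.G, ∃ α, (grMod P ι).Divides r g t α := by
  have hX := grAdm hr
  -- A homogeneous element needs only products of its own degree, so the truncation at `c` loses
  -- nothing.
  have hx' : x ∈ repSpan (grMod P ι) r {g | g ∈ s.G} {t | mdeg P b t < c} := by
    refine Submodule.span_mono ?_ (mem_span_of_isHomog (dd := grDeg P b) (fun g hg => ?_) hx hd)
    · rintro _ ⟨g, hg, α, hα, rfl⟩
      obtain ⟨hg0, d', -, hg'⟩ := h.gens g hg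
      obtain ⟨u, hu⟩ := hX.exists_isLeading hg0
      refine ⟨g, hg, α, shift α u, hX.divides_iff.2 ⟨u, hu, rfl⟩, ?_, rfl⟩
      rw [Set.mem_ofPred_eq, mdeg_shift, hg' u hu.1, ← hg'.grDeg_eq hg0, hα]
      exact hdc
    · obtain ⟨hg0, d', -, hg'⟩ := h.gens g hg
      rwa [hg'.grDeg_eq hg0]
  obtain ⟨u, hu, hu'⟩ := hX.buchberger (fun g hg => (h.gens g hg).1)
    (fun s t hts (hs : mdeg P b s < c) => (hr.mdeg_le (Or.inr hts)).trans_lt hs)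
    (fun i j g g' hij hg hg' hD => by
      rcases h.reduces i j g g' hij hg hg' with h1 | h1 | h1
      -- A pair still in `s.S` has degree at least `c`; unless its S-polynomial vanishes, its least
      -- common multiple lies outside the truncation.
      · intro u v hu hv huv
        by_cases h0 : (grMod P ι).sPoly r g g' = 0
        · exact sPairReduces_of_eq_zero h0 u v hu hv huv
        · obtain ⟨-, d1, -, hd1⟩ := h.gens g (List.mem_of_getElem? hg)
          obtain ⟨-, d2, -, hd2⟩ := h.gens g' (List.mem_of_getElem? hg')
          have h2 := (h.degS _ h1).2.2
          rw [pairDeg_eq hg hg', (isHomog_sPoly hr hd1 hd2 hu hv huv).grDeg_eq h0] at h2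
          exact absurd (hD u v hu hv huv) (not_lt.2 h2)
      · rw [hSn] at h1
        exact absurd h1 (Finset.notMem_empty _)
      · exact h1) hx' (hX.ne_zero_of_isLeading ht)
  obtain rfl := IsLeading.unique hr.strictTotal ht hu
  exact hX.exists_mdvd_of_mem_repSpan hu hu'

end HGSInv

/-- The measure that decreases in the algorithm for minimal homogeneous generating sets. -/
def hgsMeasure (P : GradedSolvPolyAlg K A n) (r : Expo n × ι → Expo n × ι → Prop)
    (s : HGSState (Expo n × ι →₀ K)) : List (Expo n × ι) × ℕ :=
  -- Future tasks count twice, so that moving tasks into the current degree lowers the measure.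
  (s.G.filterMap ((grMod P ι).lm r), 2 * (s.S.card + s.W.card) + s.Sn.card + s.Wn.card)

omit [Finite ι] in
-- Since `e` is the least degree that occurs, the tasks left behind have degree at least `e + 1`,
-- which becomes the new bound.
theorem HGSInv.round {U : List (Expo n × ι →₀ K)} {s : HGSState (Expo n × ι →₀ K)} {c : ℕ}
    (h : HGSInv P b r U s c) {e : ℕ} (hSn : s.Sn = ∅) (hWn : s.Wn = ∅)
    (he : IsLeast {x | (∃ p ∈ s.S, x = pairDeg P b r s.G p) ∨
        ∃ k ∈ s.W, x = grDeg P b (U.getD k 0)} e) :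
    HGSInv P b r U { s with
          S := s.S.filter fun p => pairDeg P b r s.G p ≠ e
          Sn := s.S.filter fun p => pairDeg P b r s.G p = e
          W := s.W.filter fun k => grDeg P b (U.getD k 0) ≠ e
          Wn := s.W.filter fun k => grDeg P b (U.getD k 0) = e } (e + 1) := by
  have hce : c ≤ e := by
    rcases he.1 with ⟨p, hp, rfl⟩ | ⟨k, hk, rfl⟩
    · exact (h.degS p hp).2.2
    · exact (h.degW k hk).2
  refine ⟨?_, h.gens_mem, h.sel_mem, ?_, ?_, ?_, ?_, ?_, ?_, h.indep, ?_⟩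
  · intro g hg
    obtain ⟨h1, d, h2, h3⟩ := h.gens g hg
    exact ⟨h1, d, by omega, h3⟩
  · intro k u hu
    rcases h.elems k u hu with h1 | h1 | h1
    · by_cases hk : grDeg P b (U.getD k 0) = e
      · exact Or.inr (Or.inl (Finset.mem_filter.2 ⟨h1, hk⟩))
      · exact Or.inl (Finset.mem_filter.2 ⟨h1, hk⟩)
    · rw [hWn] at h1
      exact absurd h1 (Finset.notMem_empty _)
    · exact Or.inr (Or.inr h1)
  · intro k hk
    obtain ⟨h1, h2⟩ := Finset.mem_filter.1 hk
    have h3 := he.2 (Or.inr ⟨k, h1, rfl⟩)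
    exact ⟨(h.degW k h1).1, by omega⟩
  · intro k hk
    obtain ⟨h1, h2⟩ := Finset.mem_filter.1 hk
    exact ⟨(h.degW k h1).1, by omega⟩
  · intro p hp
    obtain ⟨h1, h2⟩ := Finset.mem_filter.1 hp
    have h3 := he.2 (Or.inl ⟨p, h1, rfl⟩)
    obtain ⟨h4, h5, h6⟩ := h.degS p h1
    exact ⟨h4, h5, by dsimp only; omega⟩
  · intro p hp
    obtain ⟨h1, h2⟩ := Finset.mem_filter.1 hp
    obtain ⟨h4, h5, h6⟩ := h.degS p h1
    exact ⟨h4, h5, by dsimp only; omega⟩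
  · intro i j g g' hij hg hg'
    rcases h.reduces i j g g' hij hg hg' with h1 | h1 | h1
    · by_cases hk : pairDeg P b r s.G (i, j) = e
      · exact Or.inr (Or.inl (Finset.mem_filter.2 ⟨h1, hk⟩))
      · exact Or.inl (Finset.mem_filter.2 ⟨h1, hk⟩)
    · rw [hSn] at h1
      exact absurd h1 (Finset.notMem_empty _)
    · exact Or.inr (Or.inr h1)
  · exact fun u hu => (h.sel_deg u hu).trans_le (by omega)

theorem HGSInv.pair {U : List (Expo n × ι →₀ K)} {s : HGSState (Expo n × ι →₀ K)} {c : ℕ}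
    (h : HGSInv P b r U s c) (hr : IsGradedLeftMonomialOrdering P b r) {i j : ℕ}
    {g g' : Expo n × ι →₀ K} {q : ℕ → Expo n →₀ K} {η : Expo n × ι →₀ K} (hij : (i, j) ∈ s.Sn)
    (hg : s.G[i]? = some g) (hg' : s.G[j]? = some g')
    (hd : (grMod P ι).DivL r s.G ((grMod P ι).sPoly r g g') q η) :
    HGSInv P b r U (if η = 0 then { s with Sn := s.Sn.erase (i, j) }
        else
          { s with
            Sn := s.Sn.erase (i, j)
            S := s.S ∪ (grMod P ι).pairsTo r (s.G ++ [η]) s.G.length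
            G := s.G ++ [η] }) c := by
  have hX := grAdm hr
  have hsp : ∀ G : Set (Expo n × ι →₀ K), {x | x ∈ s.G} ⊆ G → (η = 0 ∨ η ∈ G) →
      ∀ (i' j' : ℕ) g1 g2, i' < j' → s.G[i']? = some g1 → s.G[j']? = some g2 →
      (i', j') ∈ s.S ∨ (i', j') ∈ s.Sn.erase (i, j) ∨
        SPairReduces (grMod P ι) r G g1 g2 := by
    intro G hG hη i' j' g1 g2 hij' hg1 hg2
    rcases h.reduces i' j' g1 g2 hij' hg1 hg2 with h1 | h1 | h1
    · exact Or.inl h1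
    · right
      by_cases he : (i', j') = (i, j)
      · right
        obtain ⟨rfl, rfl⟩ := Prod.mk.inj he
        obtain rfl : g = g1 := by simpa [hg] using hg1
        obtain rfl : g' = g2 := by simpa [hg'] using hg2
        exact hX.sPairReduces_of_divL hd hG (hη.imp_right fun h => ⟨h, act_zero_grMod⟩)
      · exact Or.inl (Finset.mem_erase.2 ⟨he, h1⟩)
    · exact Or.inr (Or.inr (h1.mono hG))
  split_ifs with hη
  · exact ⟨h.gens, h.gens_mem, h.sel_mem, h.elems, h.degW, h.degWn, h.degS,
      fun p hp => h.degSn p (Finset.mem_of_mem_erase hp), hsp _ le_rfl (Or.inl hη), h.indep,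
      h.sel_deg⟩
  -- Dividing zero leaves zero: use empty support. The S-polynomial must be nonzero for the recorded
  -- degree of the pair to be the degree of its least common multiple.
  · have hS0 : (grMod P ι).sPoly r g g' ≠ 0 := by
      intro h0
      rw [h0] at hd
      have h1 := divL_sub_mem_grSpan hd
      have h2 := (hX.divL_supp (D := ∅) (fun s hs => absurd hs (Set.notMem_empty s)) hd
        (Submodule.zero_mem _)).1
      exact hη (hX.ext fun t => by
        by_contra hne
        exact hX.mem_suppIn.1 h2 t (by rwa [hX.coef_zero] at hne))
    obtain ⟨hg0, d1, -, hd1⟩ := h.gens g (List.mem_of_getElem? hg)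
    obtain ⟨hg0', d2, -, hd2⟩ := h.gens g' (List.mem_of_getElem? hg')
    obtain ⟨u, hu⟩ := hX.exists_isLeading hg0
    obtain ⟨v, hv⟩ := hX.exists_isLeading hg0'
    have huv : u.2 = v.2 := by
      by_contra hne
      exact hS0 (hX.sPoly_eq_zero hu hv hne)
    have hhom := isHomog_sPoly hr hd1 hd2 hu hv huv
    have hc := (h.degSn _ hij).2.2
    rw [pairDeg_eq hg hg', hhom.grDeg_eq hS0] at hc
    have hηh := isHomog_of_divL hr (fun ξ hξ => (h.gens ξ hξ).2.imp fun _ h => h.2) hd hhom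
    have hrem := hX.divL_remainder hd
    have hsub : {x | x ∈ s.G} ⊆ {x | x ∈ s.G ++ [η]} := fun x hx => List.mem_append_left _ hx
    have hηmem : η ∈ grSpan P {g | g ∈ s.G} := by
      have h1 := Submodule.sub_mem _ (sPoly_mem_grSpan (P := P) (r := r)
        (List.mem_of_getElem? hg) (List.mem_of_getElem? hg')) (divL_sub_mem_grSpan hd)
      rwa [sub_sub_cancel] at h1
    refine ⟨?_, ?_, ?_, ?_, h.degW, h.degWn, h.degS_append hr hη hηh hc hrem, ?_, ?_,
      h.indep, h.sel_deg⟩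
    · intro x hx
      rcases List.mem_append.1 hx with hx | hx
      · exact h.gens x hx
      · rw [List.mem_singleton.1 hx]
        exact ⟨hη, _, by omega, hηh⟩
    · intro x hx
      rcases List.mem_append.1 hx with hx | hx
      · exact h.gens_mem x hx
      · rw [List.mem_singleton.1 hx]
        exact grSpan_le_grSpan hr h.gens_mem hηmem
    · exact fun u hu => grSpan_mono hsub (h.sel_mem u hu)
    · exact fun k u hk => (h.elems k u hk).imp_right fun h1 => h1.imp_right fun h1 =>
        grSpan_mono hsub h1
    · intro p hp
      obtain ⟨h1, h2, h3⟩ := h.degSn p (Finset.mem_of_mem_erase hp)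
      refine ⟨h1, ?_, by rwa [pairDeg_append η h1 h2]⟩
      rw [List.length_append]
      omega
    · exact HGSInv.reduces_append (C := fun i' j' => (i', j') ∈ s.Sn.erase (i, j))
        (hsp _ hsub (Or.inr (by simp)))

theorem HGSInv.elem {U : List (Expo n × ι →₀ K)} {s : HGSState (Expo n × ι →₀ K)} {c : ℕ}
    (h : HGSInv P b r U s c) (hr : IsGradedLeftMonomialOrdering P b r)
    (hU : ∀ u ∈ U, u ≠ 0 ∧ ∃ d, IsHomog P b d u) {k : ℕ}
    {ξ : Expo n × ι →₀ K} {q : ℕ → Expo n →₀ K} {η : Expo n × ι →₀ K} (hSn : s.Sn = ∅)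
    (hk : k ∈ s.Wn) (hξ : U[k]? = some ξ) (hd : (grMod P ι).DivL r s.G ξ q η) :
    HGSInv P b r U (if η = 0 then { s with Wn := s.Wn.erase k }
        else
          { s with
            Wn := s.Wn.erase k
            S := s.S ∪ (grMod P ι).pairsTo r (s.G ++ [η]) s.G.length
            G := s.G ++ [η]
            sel := s.sel ++ [k] }) c := by
  have hX := grAdm hr
  have hsubmem := divL_sub_mem_grSpan hd
  obtain ⟨hξ0, d, hξd⟩ := hU ξ (List.mem_of_getElem? hξ)
  have hc := (h.degWn k hk).2
  rw [List.getD_eq_getElem?_getD, hξ, Option.getD_some] at hc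
  have hdc : d + 1 = c := by rw [← hc, hξd.grDeg_eq hξ0]
  split_ifs with hη
  · refine ⟨h.gens, h.gens_mem, h.sel_mem, ?_, h.degW,
      fun l hl => h.degWn l (Finset.mem_of_mem_erase hl), h.degS, h.degSn, h.reduces, h.indep,
      h.sel_deg⟩
    intro l u hu
    by_cases hl : l = k
    · subst hl
      obtain rfl : ξ = u := by simpa [hξ] using hu
      rw [hη, sub_zero] at hsubmem
      exact Or.inr (Or.inr hsubmem)
    · exact (h.elems l u hu).imp_right fun h1 => h1.imp_left fun h1 =>
        Finset.mem_erase.2 ⟨hl, h1⟩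
  · have hηh := isHomog_of_divL hr (fun ξ hξ => (h.gens ξ hξ).2.imp fun _ h => h.2) hd hξd
    have hrem := hX.divL_remainder hd
    have hsub : {x | x ∈ s.G} ⊆ {x | x ∈ s.G ++ [η]} := fun x hx => List.mem_append_left _ hx
    have hpick : pick U s.sel ⊆ pick U (s.sel ++ [k]) :=
      pick_mono fun x hx => List.mem_append_left _ hx
    have hξmem : ξ ∈ grSpan P {x | x ∈ s.G ++ [η]} := by
      have h1 := Submodule.add_mem _ (grSpan_mono (P := P) hsub hsubmem)
        (mem_grSpan (P := P) (S := {x | x ∈ s.G ++ [η]}) (u := η) (by simp))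
      rwa [sub_add_cancel] at h1
    have hpick' : ∀ u ∈ pick U (s.sel ++ [k]), u ∈ pick U s.sel ∨ u = ξ := by
      rintro u ⟨l, hl, hu⟩
      rcases List.mem_append.1 hl with hl | hl
      · exact Or.inl ⟨l, hl, hu⟩
      · rw [List.mem_singleton.1 hl, hξ] at hu
        exact Or.inr (by simpa using hu.symm)
    -- If `ξ` were generated by the earlier selections, its remainder would lie in the module
    -- generated by `s.G`. With no pairs of this degree left, `s.G` is a Gröbner basis up to here,
    -- so the remainder would be reducible.
    have hnot : ξ ∉ grSpan P (pick U s.sel) := by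
      intro hmem
      have h1 : η ∈ grSpan P {g | g ∈ s.G} := by
        have := Submodule.sub_mem _ (grSpan_le_grSpan hr h.sel_mem hmem) hsubmem
        rwa [sub_sub_cancel] at this
      obtain ⟨t, ht⟩ := hX.exists_isLeading hη
      obtain ⟨g, hg, α, hα⟩ := h.exists_divides hr hSn h1 hηh (by omega) ht
      exact hrem t ht.1 g hg α hα
    refine ⟨?_, ?_, ?_, ?_, h.degW, fun l hl => h.degWn l (Finset.mem_of_mem_erase hl),
      h.degS_append hr hη hηh hdc hrem, ?_, ?_, ?_, ?_⟩
    · intro x hx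
      rcases List.mem_append.1 hx with hx | hx
      · exact h.gens x hx
      · rw [List.mem_singleton.1 hx]
        exact ⟨hη, _, by omega, hηh⟩
    · intro x hx
      have hG : ∀ g ∈ {g | g ∈ s.G}, g ∈ grSpan P (pick U (s.sel ++ [k])) := fun g hg =>
        grSpan_mono hpick (h.gens_mem g hg)
      rcases List.mem_append.1 hx with hx | hx
      · exact hG x hx
      · rw [List.mem_singleton.1 hx]
        have h1 := Submodule.sub_mem _
          (mem_grSpan (P := P) (S := pick U (s.sel ++ [k])) (u := ξ) ⟨k, by simp, hξ⟩)
          (grSpan_le_grSpan hr hG hsubmem)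
        rwa [sub_sub_cancel] at h1
    · intro u hu
      rcases hpick' u hu with hu | rfl
      · exact grSpan_mono hsub (h.sel_mem u hu)
      · exact hξmem
    · intro l u hu
      by_cases hl : l = k
      · subst hl
        obtain rfl : ξ = u := by simpa [hξ] using hu
        exact Or.inr (Or.inr hξmem)
      · rcases h.elems l u hu with h1 | h1 | h1
        · exact Or.inl h1
        · exact Or.inr (Or.inl (Finset.mem_erase.2 ⟨hl, h1⟩))
        · exact Or.inr (Or.inr (grSpan_mono hsub h1))
    · intro p hp
      dsimp only at hp
      rw [hSn] at hp
      exact absurd hp (Finset.notMem_empty _)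
    · refine HGSInv.reduces_append (C := fun i' j' => (i', j') ∈ s.Sn) ?_
      intro i j g g' hij hg hg'
      exact (h.reduces i j g g' hij hg hg').imp_right fun h1 => h1.imp_right fun h1 =>
        h1.mono hsub
    · intro i l hl
      dsimp only at hl ⊢
      by_cases hi : i < s.sel.length
      · rw [List.getElem?_append_left hi] at hl
        rw [List.take_append_of_le_length hi.le]
        exact h.indep i l hl
      · have hlen := (List.getElem?_eq_some_iff.1 hl).1
        rw [List.length_append, List.length_singleton] at hlen
        obtain rfl : i = s.sel.length := by omega
        obtain rfl : l = k := by simpa using hl.symm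
        rw [List.take_left]
        refine ⟨ξ, hξ, hnot, fun u hu => ?_⟩
        have := h.sel_deg u hu
        omega
    · intro u hu
      rcases hpick' u hu with hu | rfl
      · exact h.sel_deg u hu
      · omega

theorem hgs_step (hr : IsGradedLeftMonomialOrdering P b r) {U : List (Expo n × ι →₀ K)}
    (hU : ∀ u ∈ U, u ≠ 0 ∧ ∃ d, IsHomog P b d u) {s t : HGSState (Expo n × ι →₀ K)}
    (hs : ∃ c, HGSInv P b r U s c) (hst : HGSStep P b r U s t) :
    (∃ c, HGSInv P b r U t c) ∧
      Prod.Lex DicksonExt (· < ·) (hgsMeasure P r t) (hgsMeasure P r s) := by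
  obtain ⟨c, h⟩ := hs
  have hX := grAdm hr
  cases hst with
  | round e hSn hWn he =>
    refine ⟨⟨_, h.round hSn hWn he⟩, Prod.Lex.right _ ?_⟩
    have h1 := Finset.card_filter_add_card_filter_not (s := s.S)
      (fun p => pairDeg P b r s.G p = e)
    have h2 := Finset.card_filter_add_card_filter_not (s := s.W)
      (fun k => grDeg P b (U.getD k 0) = e)
    -- The degree `e` is attained, so at least one task moves and the doubled count strictly drops.
    have h3 : 0 < (s.S.filter fun p => pairDeg P b r s.G p = e).card +
        (s.W.filter fun k => grDeg P b (U.getD k 0) = e).card := by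
      rcases he.1 with ⟨p, hp, hpe⟩ | ⟨k, hk, hke⟩
      · exact Nat.add_pos_left (Finset.card_pos.2 ⟨p, Finset.mem_filter.2 ⟨hp, hpe.symm⟩⟩) _
      · exact Nat.add_pos_right _ (Finset.card_pos.2 ⟨k, Finset.mem_filter.2 ⟨hk, hke.symm⟩⟩)
    simp only [hSn, hWn, Finset.card_empty]
    simp only [ne_eq] at h1 h2 ⊢
    omega
  | pair i j g g' q η hij hg hg' hd =>
    refine ⟨⟨c, h.pair hr hij hg hg' hd⟩, ?_⟩
    split_ifs with hη
    · refine Prod.Lex.right _ ?_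
      have := Finset.card_erase_lt_of_mem hij
      dsimp only
      omega
    · exact Prod.Lex.left _ _ (hX.dicksonExt_append hη (hX.divL_remainder hd))
  | elem k ξ q η hSn hk hξ hd =>
    refine ⟨⟨c, h.elem hr hU hSn hk hξ hd⟩, ?_⟩
    split_ifs with hη
    · refine Prod.Lex.right _ ?_
      have := Finset.card_erase_lt_of_mem hk
      dsimp only
      omega
    · exact Prod.Lex.left _ _ (hX.dicksonExt_append hη (hX.divL_remainder hd))

theorem runMinHGS_of (hr : IsGradedLeftMonomialOrdering P b r) {U : List (Expo n × ι →₀ K)}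
    (hU : ∀ u ∈ U, u ≠ 0 ∧ ∃ d, IsHomog P b d u) {Q : List ℕ → Prop}
    (hQ : ∀ sel, IsIndependentSelection P b U sel → (∀ u ∈ U, u ∈ grSpan P (pick U sel)) →
      Q sel) : RunMinHGS P b r U Q := by
  have hX := grAdm hr
  refine Always.of_invariant (fun s => ∃ c, HGSInv P b r U s c)
    (WellFounded.prod_lex wellFounded_dicksonExt wellFounded_lt) (hgsMeasure P r) ?_
    (fun s t => hgs_step hr hU) ?_ ⟨0, ?_⟩
  · rintro s ⟨c, h⟩ hne
    by_cases hSn : s.Sn = ∅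
    · by_cases hWn : s.Wn = ∅
      · have hne' : {x | (∃ p ∈ s.S, x = pairDeg P b r s.G p) ∨
            ∃ k ∈ s.W, x = grDeg P b (U.getD k 0)}.Nonempty := by
          by_contra hemp
          rw [Set.not_nonempty_iff_eq_empty] at hemp
          refine hne ⟨Finset.eq_empty_of_forall_notMem fun p hp => ?_,
            Finset.eq_empty_of_forall_notMem fun k hk => ?_, hSn, hWn⟩
          · exact (Set.eq_empty_iff_forall_notMem.1 hemp) _ (Or.inl ⟨p, hp, rfl⟩)
          · exact (Set.eq_empty_iff_forall_notMem.1 hemp) _ (Or.inr ⟨k, hk, rfl⟩)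
        exact ⟨_, HGSStep.round s _ hSn hWn ⟨Nat.sInf_mem hne', fun _ h => Nat.sInf_le h⟩⟩
      · obtain ⟨k, hk⟩ := Finset.nonempty_iff_ne_empty.2 hWn
        have hlt := (h.degWn k hk).1
        obtain ⟨q, η, hd⟩ := hX.exists_divL s.G U[k]
        exact ⟨_, HGSStep.elem s k _ q η hSn hk (List.getElem?_eq_getElem hlt) hd⟩
    · obtain ⟨⟨i, j⟩, hij⟩ := Finset.nonempty_iff_ne_empty.2 hSn
      obtain ⟨h1, h2, -⟩ := h.degSn _ hij
      obtain ⟨q, η, hd⟩ := hX.exists_divL s.G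
        ((grMod P ι).sPoly r (s.G[i]'(h1.trans h2)) (s.G[j]'h2))
      exact ⟨_, HGSStep.pair s i j _ _ q η hij (List.getElem?_eq_getElem _)
        (List.getElem?_eq_getElem _) hd⟩
  · rintro s ⟨c, h⟩ ⟨-, hW, -, hWn⟩
    refine hQ _ h.indep fun u hu => ?_
    obtain ⟨k, hk⟩ := List.mem_iff_getElem?.1 hu
    rcases h.elems k u hk with h1 | h1 | h1
    · rw [hW] at h1
      exact absurd h1 (Finset.notMem_empty _)
    · rw [hWn] at h1
      exact absurd h1 (Finset.notMem_empty _)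
    · exact grSpan_le_grSpan hr h.gens_mem h1
  · refine ⟨by simp, by simp, ?_, ?_, ?_, by simp, by simp, by simp, by simp, ?_, ?_⟩
    · rintro u ⟨k, hk, -⟩
      simp at hk
    · intro k u hk
      exact Or.inl (Finset.mem_range.2 (List.getElem?_eq_some_iff.1 hk).1)
    · exact fun k hk => ⟨Finset.mem_range.1 hk, Nat.zero_le _⟩
    · intro i k hk
      simp at hk
    · rintro u ⟨k, hk, -⟩
      simp at hk

end HomogeneousGenerators

/-! ### Minimal standard bases -/

section MinimalStandardBasis

variable {K A : Type*} [Field K] [Ring A] [Algebra K A] {n : ℕ} {P : GradedSolvPolyAlg K A n}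
  {ι : Type*} {b : ι → ℕ} {r : Expo n × ι → Expo n × ι → Prop}

theorem basis_smul_mem_mulSpan {M : Type*} [AddCommGroup M] [Module A M] [Module K M]
    [IsScalarTower K A M] {κ : Type*} {v : κ → M} {dd : κ → ℕ} {p q : ℕ} {α : Expo n} {x : M}
    (hx : x ∈ mulSpan P v dd p) (h : P.wdeg α + p ≤ q) :
    P.basis α • x ∈ mulSpan P v dd q := by
  have hsc : ∀ (c : K) (y : M), P.basis α • c • y = c • P.basis α • y := by
    intro c y
    rw [← algebraMap_smul A c y, ← algebraMap_smul A c (P.basis α • y), smul_smul, smul_smul,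
      Algebra.commutes]
  induction hx using Submodule.span_induction with
  | mem x hx =>
    obtain ⟨k, β, hk, rfl⟩ := hx
    rw [smul_smul]
    refine smul_mem_mulSpan (p := P.wdeg α + P.wdeg β) ?_ (by omega)
    exact (mem_fil P).2 fun γ hγ => repr_mul_ne_zero P hγ
  | zero => rw [smul_zero]; exact Submodule.zero_mem _
  | add x y _ _ hx hy => rw [smul_add]; exact Submodule.add_mem _ hx hy
  | smul c x _ hx => rw [hsc]; exact Submodule.smul_mem _ c hx

variable [Fintype ι]

theorem isHomog_symbol (ξ : ι → A) : IsHomog P b (P.filDeg b ξ) (symbol P b ξ) :=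
  fun _ ht => mdeg_of_symbol_ne_zero P ht

theorem topPart_basis_smul_self (α : Expo n) {ξ : ι → A} {q : ℕ}
    (h : P.wdeg α + P.filDeg b ξ = q) :
    topPart P b q (P.basis α • ξ) = (grMod P ι).act α (symbol P b ξ) := by
  rw [← h, topPart_basis_smul P (mem_freeFil_filDeg P ξ), symbol_eq_topPart]

theorem topPart_eq_zero {q : ℕ} {ξ : ι → A} {p : ℕ} (h : ξ ∈ P.freeFil b p) (hpq : p < q) :
    topPart P b q ξ = 0 := by
  ext t
  rw [topPart_apply]
  split_ifs with ht
  · by_contra hne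
    have := (mem_freeFil P).1 h t hne
    omega
  · rfl

theorem mem_freeFil_of_topPart {q : ℕ} {ξ : ι → A} (h : ξ ∈ P.freeFil b q)
    (h0 : topPart P b q ξ = 0) (hξ : ξ ≠ 0) : ∃ p < q, ξ ∈ P.freeFil b p := by
  have hlt := mem_freeFil_pred P h h0
  obtain ⟨s, hs⟩ : ∃ s, P.coef ξ s ≠ 0 := by
    by_contra hno
    push Not at hno
    exact hξ (coef_ext P fun s => by rw [hno s, coef_zero])
  have := hlt s hs
  exact ⟨q - 1, by omega, (mem_freeFil P).2 fun t ht => by have := hlt t ht; omega⟩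

/-- In degree `q` a filtered representation becomes a homogeneous one in the symbols; summands of
smaller degree disappear. -/
theorem topPart_mem_of_mem_mulSpan {κ : Type*} {v : κ → ι → A} {q : ℕ} {x : ι → A}
    (hx : x ∈ mulSpan P v (fun k => P.filDeg b (v k)) q) :
    topPart P b q x ∈ Submodule.span K {y | ∃ k α, P.wdeg α + P.filDeg b (v k) = q ∧
      y = (grMod P ι).act α (symbol P b (v k))} := by
  revert x
  suffices H : mulSpan P v (fun k => P.filDeg b (v k)) q ≤ (Submodule.span K {y | ∃ k α,
      P.wdeg α + P.filDeg b (v k) = q ∧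
      y = (grMod P ι).act α (symbol P b (v k))}).comap (topPart P b q) from fun x hx => H hx
  refine mulSpan_le_iff.2 fun k α hk => ?_
  rw [Submodule.mem_comap]
  rcases hk.lt_or_eq with h | h
  · rw [topPart_eq_zero (basis_smul_mem_freeFil P (mem_freeFil_filDeg P (v k)) le_rfl) h]
    exact Submodule.zero_mem _
  · rw [topPart_basis_smul_self α h]
    exact Submodule.subset_span ⟨k, α, h, rfl⟩

/-- Conversely, a homogeneous combination of symbols lifts term by term, with control of only the
part of degree `q`. -/
theorem exists_mem_mulSpan_topPart {κ : Type*} {v : κ → ι → A} {q : ℕ}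
    {y : Expo n × ι →₀ K} (hy : y ∈ Submodule.span K {y | ∃ k α,
      P.wdeg α + P.filDeg b (v k) = q ∧ y = (grMod P ι).act α (symbol P b (v k))}) :
    ∃ x ∈ mulSpan P v (fun k => P.filDeg b (v k)) q, topPart P b q x = y := by
  induction hy using Submodule.span_induction with
  | mem y hy =>
    obtain ⟨k, α, hk, rfl⟩ := hy
    exact ⟨_, mem_mulSpan_basis hk.le, topPart_basis_smul_self α hk⟩
  | zero => exact ⟨0, Submodule.zero_mem _, map_zero _⟩
  | add y z _ _ hy hz =>
    obtain ⟨y', hy', rfl⟩ := hy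
    obtain ⟨z', hz', rfl⟩ := hz
    exact ⟨y' + z', Submodule.add_mem _ hy' hz', map_add _ _ _⟩
  | smul c y _ hy =>
    obtain ⟨y', hy', rfl⟩ := hy
    exact ⟨c • y', Submodule.smul_mem _ c hy', LinearMap.map_smul _ _ _⟩

/-- A subfamily of a standard basis whose symbols generate all symbols is a standard basis. -/
theorem isStandardBasis_of_symbols {N : Submodule A (ι → A)} {κ κ' : Type*} [Finite κ']
    {v : κ → ι → A} {w : κ' → ι → A} (hv : IsStandardBasis P (P.freeFil b) N v)
    (hw : ∀ k, ∃ j, w k = v j)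
    (hspan : ∀ j, symbol P b (v j) ∈ grSpan P (Set.range fun k => symbol P b (w k))) :
    IsStandardBasis P (P.freeFil b) N w := by
  obtain ⟨-, hvN, hvs⟩ := isStandardBasis_iff.1 hv
  have hwN : ∀ k, w k ∈ N ∧ w k ≠ 0 := fun k => by
    obtain ⟨j, hj⟩ := hw k
    exact hj ▸ hvN j
  have hle : ∀ q, mulSpan P w (fun k => P.filDeg b (w k)) q ≤ N.restrictScalars K := fun q =>
    mulSpan_le_iff.2 fun k α _ => N.smul_mem _ (hwN k).1
  refine isStandardBasis_iff.2 ⟨inferInstance, hwN, fun q => ?_⟩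
  induction q using Nat.strong_induction_on with
  | _ q ih =>
  -- Lift the expression of the symbol of `v j` in the symbols of `w`. The difference from `v j`
  -- lies in `N` and in a lower filtration step, where the induction hypothesis represents it.
  have hvw : ∀ j, P.filDeg b (v j) ≤ q →
      v j ∈ mulSpan P w (fun k => P.filDeg b (w k)) (P.filDeg b (v j)) := by
    intro j hj
    have h1 := mem_span_of_isHomog (dd := grDeg P b) (S := Set.range fun k => symbol P b (w k))
      (by
        rintro _ ⟨k, rfl⟩
        dsimp only
        rw [(isHomog_symbol (w k)).grDeg_eq (symbol_ne_zero P (hwN k).2)]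
        exact isHomog_symbol (w k)) (hspan j) (isHomog_symbol (v j))
    obtain ⟨y, hy, hyt⟩ := exists_mem_mulSpan_topPart (P := P) (b := b) (v := w)
      (q := P.filDeg b (v j)) (y := symbol P b (v j)) (by
        refine Submodule.span_mono ?_ h1
        rintro _ ⟨_, ⟨k, rfl⟩, α, hα, rfl⟩
        rw [(isHomog_symbol (w k)).grDeg_eq (symbol_ne_zero P (hwN k).2)] at hα
        exact ⟨k, α, hα, rfl⟩)
    by_cases h0 : v j - y = 0
    · have e : y = v j := (sub_eq_zero.1 h0).symm
      generalize P.filDeg b (v j) = d at hy ⊢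
      exact e ▸ hy
    · have hyF : y ∈ P.freeFil b (P.filDeg b (v j)) := by
        revert hy
        suffices H : mulSpan P w (fun k => P.filDeg b (w k)) (P.filDeg b (v j)) ≤
          P.freeFil b (P.filDeg b (v j)) from fun hy => H hy
        exact mulSpan_le_iff.2 fun k α hk =>
          basis_smul_mem_freeFil P (mem_freeFil_filDeg P (w k)) hk
      obtain ⟨p, hp, hpm⟩ := mem_freeFil_of_topPart
        (Submodule.sub_mem _ (mem_freeFil_filDeg P (v j)) hyF)
        (by rw [map_sub, hyt, ← symbol_eq_topPart, sub_self]) h0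
      have h2 := ih p (by omega) _ (N.sub_mem (hvN j).1 (hle _ hy)) hpm
      have := Submodule.add_mem _ (mulSpan_mono (fun _ => le_rfl) hp.le h2) hy
      rwa [sub_add_cancel] at this
  intro x hx hxq
  refine (mulSpan_le_iff (S := mulSpan P w (fun k => P.filDeg b (w k)) q)).2
    (fun j α hj => ?_) (hvs q x hx hxq)
  exact basis_smul_mem_mulSpan (hvw j (by omega)) hj

omit [Fintype ι] in
/-- Homogeneous elements of nondecreasing degrees, none of which lies in the submodule generated
by the preceding ones, form a minimal generating set. -/
theorem notMem_span_of_independent {t : ℕ} {σ : Fin t → Expo n × ι →₀ K} {dd : Fin t → ℕ}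
    (hdd : ∀ i j, j ≤ i → dd j ≤ dd i)
    (hind : ∀ i, σ i ∉ grSpan P {u | ∃ j < i, u = σ j}) (i : Fin t) :
    σ i ∉ Submodule.span K {y | ∃ j, j ≠ i ∧ ∃ α, P.wdeg α + dd j = dd i ∧
      y = (grMod P ι).act α (σ j)} := by
  -- Only generators with index below `m` are allowed; `m` is raised one at a time to exclude later
  -- generators from a relation for `σ i`.
  let E : ℕ → Submodule K (Expo n × ι →₀ K) := fun m => Submodule.span K {y | ∃ j, j ≠ i ∧
    (j : ℕ) < m ∧ ∃ α, P.wdeg α + dd j = dd i ∧ y = (grMod P ι).act α (σ j)}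
  have hE : ∀ m, σ i ∉ E m := by
    intro m
    induction m with
    | zero =>
      intro h
      refine hind i (Submodule.span_mono ?_ h)
      rintro _ ⟨j, -, hj, -⟩
      omega
    | succ m ih =>
      intro h
      by_cases hmi : m ≤ i
      · refine hind i (Submodule.span_mono ?_ h)
        rintro _ ⟨j, hji, hj, α, -, rfl⟩
        have hji' : (j : ℕ) ≠ i := fun h => hji (Fin.ext h)
        exact ⟨σ j, ⟨j, Fin.lt_def.2 (by omega), rfl⟩, α, rfl⟩
      · by_cases hmt : m < t
        · have hle : E (m + 1) ≤ E m ⊔ Submodule.span K {σ ⟨m, hmt⟩} := by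
            refine Submodule.span_le.2 ?_
            rintro _ ⟨j, hji, hj, α, hα, rfl⟩
            by_cases hjm : (j : ℕ) < m
            · exact Submodule.mem_sup_left (Submodule.subset_span ⟨j, hji, hjm, α, hα, rfl⟩)
            · obtain rfl : j = ⟨m, hmt⟩ := Fin.ext (by dsimp only; omega)
              -- A generator after `i` has at least the degree of `σ i`, so it can enter only with a
              -- scalar coefficient. If that is nonzero, the relation can be solved for this
              -- generator, contradicting its own independence.
              have h1 := hdd ⟨m, hmt⟩ i (Fin.le_def.2 (by dsimp only; omega))
              obtain rfl : α = 0 := P.wdeg_eq_zero.1 (by omega)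
              rw [act_zero_grMod]
              exact Submodule.mem_sup_right (Submodule.mem_span_singleton_self _)
          obtain ⟨e, he, z, hz, hez⟩ := Submodule.mem_sup.1 (hle h)
          obtain ⟨c, rfl⟩ := Submodule.mem_span_singleton.1 hz
          by_cases hc : c = 0
          · rw [hc, zero_smul, add_zero] at hez
            exact ih (hez ▸ he)
          · refine hind ⟨m, hmt⟩ ?_
            have hσ : σ ⟨m, hmt⟩ = c⁻¹ • (σ i - e) := by
              rw [← hez, add_sub_cancel_left, smul_smul, inv_mul_cancel₀ hc, one_smul]
            rw [hσ]
            refine Submodule.smul_mem _ _ (Submodule.sub_mem _ ?_ ?_)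
            · exact mem_grSpan ⟨i, Fin.lt_def.2 (by dsimp only; omega), rfl⟩
            · refine Submodule.span_mono ?_ he
              rintro _ ⟨j, -, hj, α, -, rfl⟩
              exact ⟨σ j, ⟨j, Fin.lt_def.2 hj, rfl⟩, α, rfl⟩
        · refine ih (Submodule.span_mono ?_ h)
          rintro _ ⟨j, hji, hj, h1⟩
          exact ⟨j, hji, by omega, h1⟩
  intro h
  refine hE t (Submodule.span_mono ?_ h)
  rintro _ ⟨j, hji, h1⟩
  exact ⟨j, hji, j.2, h1⟩

/-- If a member could be omitted, its representation by the others, taken in its own degree, would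
express its symbol by the remaining ones. The order of selection excludes this even for symbols
selected later. -/
theorem isMinimalStandardBasis_of_selection {N : Submodule A (ι → A)} {G : List (ι → A)}
    (hG : IsStandardBasis P (P.freeFil b) N G.get) {sel : List ℕ}
    (hind : IsIndependentSelection P b (G.map (symbol P b)) sel)
    (hspan : ∀ u ∈ G.map (symbol P b), u ∈ grSpan P (pick (G.map (symbol P b)) sel)) :
    IsMinimalStandardBasis P (P.freeFil b) N (sel.map fun k => G.getD k 0).get := by
  obtain ⟨-, hGN, -⟩ := isStandardBasis_iff.1 hG
  set W := sel.map fun k => G.getD k 0 with hW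
  have hlen : W.length = sel.length := List.length_map _
  have hsel : ∀ i : Fin W.length, ∃ (k : ℕ) (hk : k < G.length), sel[(i : ℕ)]? = some k ∧
      W.get i = G[k] := by
    intro i
    have hi : (i : ℕ) < sel.length := hlen ▸ i.2
    obtain ⟨u, hu, -⟩ := hind i _ (List.getElem?_eq_getElem hi)
    have hk : sel[(i : ℕ)] < G.length := by
      simpa using (List.getElem?_eq_some_iff.1 hu).1
    refine ⟨_, hk, List.getElem?_eq_getElem hi, ?_⟩
    simp [hW, List.getElem?_eq_getElem hk]
  have hpick : ∀ m u, u ∈ pick (G.map (symbol P b)) (sel.take m) ↔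
      ∃ j : Fin W.length, (j : ℕ) < m ∧ u = symbol P b (W.get j) := by
    intro m u
    constructor
    · rintro ⟨k, hk, hu⟩
      obtain ⟨j, hj⟩ := List.mem_iff_getElem?.1 hk
      rw [List.getElem?_take] at hj
      split_ifs at hj with hjm
      have hj' : j < W.length := hlen ▸ (List.getElem?_eq_some_iff.1 hj).1
      obtain ⟨k', hk', h1, h2⟩ := hsel ⟨j, hj'⟩
      refine ⟨⟨j, hj'⟩, hjm, ?_⟩
      obtain rfl : k' = k := by simpa [hj] using h1.symm
      rw [h2]
      simpa [List.getElem?_eq_getElem hk'] using hu.symm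
    · rintro ⟨j, hj, rfl⟩
      obtain ⟨k, hk, h1, h2⟩ := hsel j
      refine ⟨k, List.mem_iff_getElem?.2 ⟨j, ?_⟩, ?_⟩
      · rw [List.getElem?_take, if_pos hj, h1]
      · rw [h2, List.getElem?_map, List.getElem?_eq_getElem hk]
        rfl
  have hWG : ∀ i : Fin W.length, ∃ j : Fin G.length, W.get i = G.get j := fun i => by
    obtain ⟨k, hk, -, h⟩ := hsel i
    exact ⟨⟨k, hk⟩, h⟩
  have hWne : ∀ i, W.get i ≠ 0 := fun i => by
    obtain ⟨j, hj⟩ := hWG i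
    exact hj ▸ (hGN j).2
  have hdeg : ∀ i, grDeg P b (symbol P b (W.get i)) = P.filDeg b (W.get i) := fun i =>
    (isHomog_symbol _).grDeg_eq (symbol_ne_zero P (hWne i))
  refine isMinimalStandardBasis_iff.2 ⟨isStandardBasis_of_symbols hG hWG fun j => ?_, ?_⟩
  · refine grSpan_mono ?_ (hspan _ (List.mem_map_of_mem (List.get_mem G j)))
    intro u hu
    rw [← List.take_length (l := sel), hpick] at hu
    obtain ⟨i, -, rfl⟩ := hu
    exact ⟨i, rfl⟩
  · intro T hT hstd
    obtain ⟨i, hi⟩ := (Set.ne_univ_iff_exists_notMem T).1 hT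
    obtain ⟨-, -, hs⟩ := isStandardBasis_iff.1 hstd
    obtain ⟨j, hj⟩ := hWG i
    have hmem := topPart_mem_of_mem_mulSpan
      (hs (P.filDeg b (W.get i)) (W.get i) (hj ▸ (hGN j).1) (mem_freeFil_filDeg P _))
    rw [← symbol_eq_topPart] at hmem
    have hstep : ∀ i : Fin W.length, ∃ k, sel[(i : ℕ)]? = some k ∧
        (G.map (symbol P b))[k]? = some (symbol P b (W.get i)) := fun i => by
      obtain ⟨k, hk, h1, h2⟩ := hsel i
      exact ⟨k, h1, by rw [h2, List.getElem?_map, List.getElem?_eq_getElem hk]; rfl⟩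
    refine notMem_span_of_independent (P := P) (σ := fun i => symbol P b (W.get i))
      (dd := fun i => P.filDeg b (W.get i)) ?_ ?_ i (Submodule.span_mono ?_ hmem)
    · intro i j hji
      rcases hji.eq_or_lt with rfl | hji
      · exact le_rfl
      · obtain ⟨k, hk1, hk2⟩ := hstep i
        obtain ⟨u, hu, -, h3⟩ := hind i k hk1
        obtain rfl : symbol P b (W.get i) = u := by simpa [hk2] using hu
        have := h3 _ ((hpick _ _).2 ⟨j, Fin.lt_def.1 hji, rfl⟩)
        rwa [hdeg, hdeg] at this
    · intro i
      obtain ⟨k, hk1, hk2⟩ := hstep i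
      obtain ⟨u, hu, h2, -⟩ := hind i k hk1
      obtain rfl : symbol P b (W.get i) = u := by simpa [hk2] using hu
      intro hin
      refine h2 (grSpan_mono ?_ hin)
      rintro _ ⟨j, hj, rfl⟩
      exact (hpick _ _).2 ⟨j, Fin.lt_def.1 hj, rfl⟩
    · rintro _ ⟨⟨j, hjT⟩, α, hα, rfl⟩
      exact ⟨j, fun h => hi (h ▸ hjT), α, hα, rfl⟩

theorem runMinStdBasis_of (hr : IsGradedLeftMonomialOrdering P b r) {U : List (ι → A)}
    (hU : ∀ u ∈ U, u ≠ 0) {Q : List (ι → A) → Prop}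
    (hQ : ∀ W : List (ι → A), IsMinimalStandardBasis P (P.freeFil b)
      (Submodule.span A {x | x ∈ U}) W.get → Q W) : RunMinStdBasis P b r U Q := by
  refine runLGB_of hr hU fun G hG => ?_
  have hmap : (G.map fun g => symbol P b g.1) = (G.map Prod.fst).map (symbol P b) := by
    rw [List.map_map]
    rfl
  refine runMinHGS_of hr ?_ fun sel hind hspan => hQ _ ?_
  · intro u hu
    obtain ⟨g, hg, rfl⟩ := List.mem_map.1 hu
    exact ⟨symbol_ne_zero P (hG.ne_zero g hg), _, isHomog_symbol g.1⟩
  · rw [hmap] at hind hspan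
    exact isMinimalStandardBasis_of_selection (hG.isStandardBasis hr) hind hspan

end MinimalStandardBasis

/-! ### Minimal F-bases -/

section Pivot

variable {K A : Type*} [Field K] [Ring A] [Algebra K A] {n : ℕ} {P : GradedSolvPolyAlg K A n}
  {ι : Type*} {b : ι → ℕ}

/-- No element of `N` has a nonzero constant component of the same degree as the element. -/
def NoPivot (P : GradedSolvPolyAlg K A n) (b : ι → ℕ) (N : Submodule A (ι → A)) : Prop :=
  ∀ x ∈ N, ∀ i, x ∈ P.freeFil b (b i) → P.coef x (0, i) = 0

/-- The elimination of the `i`-th component by means of a relation `v` in which it is `c`. -/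
def pivotElim (c : K) (v : ι → A) (i : ι) : (ι → A) →ₗ[A] (ι → A) :=
  LinearMap.id - (LinearMap.toSpanSingleton A (ι → A) v).comp
    (c⁻¹ • (LinearMap.proj i : (ι → A) →ₗ[A] A))

theorem pivotElim_apply (c : K) (v u : ι → A) (i : ι) :
    pivotElim c v i u = u - (c⁻¹ • u i) • v := rfl

theorem pivotElim_apply_self {c : K} {v : ι → A} {i : ι} (hc : c ≠ 0)
    (hv : v i = algebraMap K A c) (u : ι → A) : pivotElim c v i u i = 0 := by
  rw [pivotElim_apply, Pi.sub_apply, Pi.smul_apply, hv, smul_eq_mul, smul_mul_assoc,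
    ← Algebra.commutes, ← Algebra.smul_def, smul_smul, inv_mul_cancel₀ hc, one_smul, sub_self]

theorem pivotElim_pivot {c : K} {v : ι → A} {i : ι} (hc : c ≠ 0)
    (hv : v i = algebraMap K A c) : pivotElim c v i v = 0 := by
  rw [pivotElim_apply, hv, Algebra.smul_def, ← map_mul, inv_mul_cancel₀ hc, map_one, one_smul,
    sub_self]

theorem pivotElim_of_apply_eq_zero {c : K} {v u : ι → A} {i : ι} (hu : u i = 0) :
    pivotElim c v i u = u := by
  rw [pivotElim_apply, hu, smul_zero, zero_smul, sub_zero]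

theorem coef_stdVec (i : ι) : P.coef (stdVec A i) (0, i) = 1 := by
  have : P.basis.repr 1 = Finsupp.single 0 1 := by rw [← P.basis_zero, P.basis.repr_self]
  simp [GradedSolvPolyAlg.coef, stdVec, this]

theorem coef_eq_zero_of_apply {x : ι → A} {i : ι} (h : x i = 0) : P.coef x (0, i) = 0 := by
  simp [GradedSolvPolyAlg.coef, h]

theorem sum_smul_stdVec [Fintype ι] (f : ι → A) : ∑ i, f i • stdVec A i = f := by
  ext j
  simp [stdVec, Finset.sum_apply, Pi.single_apply]

section Finite

variable [Finite ι]

/-- The coefficient $u_i$ has degree at most $q-b_i$ and $v$ has degree at most $b_i$, so the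
correction stays in step $q$. -/
theorem pivotElim_mem_freeFil {c : K} {v u : ι → A} {i : ι} {q : ℕ}
    (hv : v ∈ P.freeFil b (b i)) (hu : u ∈ P.freeFil b q) :
    pivotElim c v i u ∈ P.freeFil b q := by
  rw [pivotElim_apply]
  refine Submodule.sub_mem _ hu ?_
  by_cases hq : q < b i
  · rw [apply_eq_zero_of_mem_freeFil P hu hq, smul_zero, zero_smul]
    exact Submodule.zero_mem _
  · exact smul_mem_freeFil P (Submodule.smul_mem _ _ (apply_mem_fil P hu i)) hv (by omega)

theorem apply_eq_algebraMap {x : ι → A} {i : ι} (hx : x ∈ P.freeFil b (b i)) :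
    x i = algebraMap K A (P.coef x (0, i)) := by
  have := apply_mem_fil P hx i
  rw [Nat.sub_self] at this
  exact fil_zero_eq P this

end Finite

variable [Fintype ι] {M : Type*} [AddCommGroup M] [Module A M] [Module K M] [IsScalarTower K A M]
  {FM : ℕ → Submodule K M} {φ : (ι → A) →ₗ[A] M}

theorem map_stdVec_isFBasis (hφ : ∀ q, (P.freeFil b q).map (φ.restrictScalars K) = FM q)
    {T : Set ι} (hT : ∀ i ∈ T, φ (stdVec A i) ≠ 0)
    (hrep : ∀ q, ∀ x ∈ P.freeFil b q, ∃ y ∈ P.freeFil b q, φ y = φ x ∧ ∀ i ∉ T, y i = 0) :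
    IsFBasis P FM fun i : T => φ (stdVec A (i : ι)) := by
  refine isFBasis_of (fun i => b i) (fun i => hT i i.2) ?_ ?_
  · intro i α q h
    rw [← hφ]
    exact ⟨P.basis α • stdVec A (i : ι), basis_smul_mem_freeFil P (stdVec_mem_freeFil P (i : ι)) h,
      map_smul φ _ _⟩
  · intro q x hx
    rw [← hφ] at hx
    obtain ⟨y, hy, rfl⟩ := hx
    obtain ⟨z, hz, hzy, hz0⟩ := hrep q y hy
    have h1 : (φ.restrictScalars K) y = ∑ i : T, z i • φ (stdVec A (i : ι)) := by
      rw [LinearMap.restrictScalars_apply, ← hzy]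
      conv_lhs => rw [← sum_smul_stdVec z, map_sum]
      simp only [map_smul]
      refine (Fintype.sum_of_injective (Subtype.val : T → ι) Subtype.val_injective _ _
        (fun i hi => ?_) fun i => rfl).symm
      rw [hz0 i (by simpa using hi), zero_smul]
    rw [h1]
    exact sum_smul_mem_mulSpan
      ((mem_freeFil_iff_apply P).2 fun i => (mem_freeFil_iff_apply P).1 hz i)

/-- If an omitted $e_j$ had the same class as some $y\in F_{b_j}L$ with $y_j=0$, then $e_j-y$ would
be a kernel element with the pivot $1$ at $j$. -/
theorem isMinimalFBasis_of_noPivot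
    (hφ : ∀ q, (P.freeFil b q).map (φ.restrictScalars K) = FM q)
    (hN : NoPivot P b (LinearMap.ker φ)) : IsMinimalFBasis P FM fun i => φ (stdVec A i) := by
  have hker : ∀ i y, y ∈ P.freeFil b (b i) → y i = 0 → φ (stdVec A i) ≠ φ y := by
    intro i y hy hyi h
    have := hN (stdVec A i - y) (by rw [LinearMap.mem_ker, map_sub, h, sub_self]) i
      (Submodule.sub_mem _ (stdVec_mem_freeFil P i) hy)
    rw [coef_sub, coef_stdVec, coef_eq_zero_of_apply hyi, sub_zero] at this
    exact one_ne_zero this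
  have hne : ∀ i, φ (stdVec A i) ≠ 0 := fun i h =>
    hker i 0 (Submodule.zero_mem _) rfl (by rw [h, map_zero])
  constructor
  · refine isFBasis_of b hne ?_ ?_
    · intro i α q h
      rw [← hφ]
      exact ⟨P.basis α • stdVec A i, basis_smul_mem_freeFil P (stdVec_mem_freeFil P i) h,
        map_smul φ _ _⟩
    · intro q x hx
      rw [← hφ] at hx
      obtain ⟨y, hy, rfl⟩ := hx
      rw [LinearMap.restrictScalars_apply, ← sum_smul_stdVec y, map_sum]
      simp only [map_smul]
      exact sum_smul_mem_mulSpan hy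
  · intro T hT h
    obtain ⟨j, hj⟩ := (Set.ne_univ_iff_exists_notMem T).1 hT
    -- The class of $e_k$ cannot drop in degree: a representative in a lower step has zero $k$-th
    -- component and would again give a pivot.
    have hdd : ∀ (k : T) q, φ (stdVec A (k : ι)) ∈ FM q → b k ≤ q := by
      intro k q hk
      by_contra hlt
      rw [← hφ] at hk
      obtain ⟨y, hy, hyk⟩ := hk
      exact hker k y (freeFil_mono P (by omega) hy)
        (apply_eq_zero_of_mem_freeFil P hy (by omega)) hyk.symm
    have hmem : φ (stdVec A j) ∈ FM (b j) := by
      rw [← hφ]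
      exact ⟨_, stdVec_mem_freeFil P j, rfl⟩
    obtain ⟨f, hf, hfF⟩ := exists_coeff_of_mem_mulSpan (h.mem_mulSpan hdd hmem)
    refine hker j (∑ k : T, f k • stdVec A (k : ι)) ?_ ?_ ?_
    · refine Submodule.sum_mem _ fun k _ => ?_
      by_cases hk : b j < b k
      · rw [apply_eq_zero_of_mem_freeFil P hfF hk, zero_smul]
        exact Submodule.zero_mem _
      · exact smul_mem_freeFil P (apply_mem_fil P hfF k) (stdVec_mem_freeFil P (k : ι))
          (by omega)
    · rw [Finset.sum_apply]
      refine Finset.sum_eq_zero fun k _ => ?_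
      have : j ≠ k := fun h => hj (h ▸ k.2)
      simp [stdVec, this]
    · rw [hf, map_sum]
      simp only [map_smul]

/-- A pivot at `i` eliminates the `i`-th component of every representative without raising its
degree, so the class of $e_i$ would be superfluous. -/
theorem noPivot_of_isMinimalFBasis
    (hφ : ∀ q, (P.freeFil b q).map (φ.restrictScalars K) = FM q)
    (hmin : IsMinimalFBasis P FM fun i => φ (stdVec A i)) : NoPivot P b (LinearMap.ker φ) := by
  intro x hx i hxi
  by_contra hc
  refine hmin.2 {i}ᶜ (fun h => ?_) (map_stdVec_isFBasis hφ (fun j _ => hmin.1.2.1 j) ?_)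
  · exact (h ▸ Set.mem_univ i : i ∈ ({i}ᶜ : Set ι)) rfl
  · intro q y hy
    refine ⟨pivotElim (P.coef x (0, i)) x i y, pivotElim_mem_freeFil hxi hy, ?_, ?_⟩
    · rw [pivotElim_apply, map_sub, map_smul, LinearMap.mem_ker.1 hx, smul_zero, sub_zero]
    · intro j hj
      obtain rfl : j = i := by simpa using hj
      exact pivotElim_apply_self hc (apply_eq_algebraMap hxi) y

end Pivot

/-! ### The algorithm for minimal F-bases -/

section MinFB

variable {K A : Type*} [Field K] [Ring A] [Algebra K A] {n : ℕ} {P : GradedSolvPolyAlg K A n}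
  {m : ℕ} {b : Fin m → ℕ} {N : Submodule A (Fin m → A)}

/-- The span of the `a^α v` with `v` in the list and `d(a^α) + d(v) ≤ q`. -/
abbrev listSpan (P : GradedSolvPolyAlg K A n) (b : Fin m → ℕ) (V : List (Fin m → A)) (q : ℕ) :
    Submodule K (Fin m → A) :=
  mulSpan P (fun v : {v // v ∈ V} => v.1) (fun v => P.filDeg b v.1) q

/-- The invariant of the algorithm for minimal F-bases. -/
structure MinFBInv (P : GradedSolvPolyAlg K A n) (b : Fin m → ℕ) (N : Submodule A (Fin m → A))
    (E : Finset (Fin m)) (V : List (Fin m → A)) : Prop where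
  mem : ∀ v ∈ V, v ∈ N ∧ v ≠ 0 ∧ ∀ i, i ∉ E → v i = 0
  standard : ∀ q, ∀ x ∈ N, (∀ i, i ∉ E → x i = 0) → x ∈ P.freeFil b q → x ∈ listSpan P b V q
  gen : ∀ q, ∀ x ∈ P.freeFil b q, ∃ y ∈ P.freeFil b q, (∀ i, i ∉ E → y i = 0) ∧ x - y ∈ N

theorem minFBInv_start {V : List (Fin m → A)} (hV : IsStandardBasis P (P.freeFil b) N V.get) :
    MinFBInv P b N Finset.univ V := by
  obtain ⟨-, hm, hs⟩ := isStandardBasis_iff.1 hV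
  refine ⟨fun v hv => ?_, fun q x hx _ hq => ?_, fun q x hx => ⟨x, hx, by simp, by simp⟩⟩
  · obtain ⟨k, rfl⟩ := List.get_of_mem hv
    exact ⟨(hm k).1, (hm k).2, by simp⟩
  · refine mulSpan_le_iff.2 (fun k α hk => ?_) (hs q x hx hq)
    exact mem_mulSpan_basis (v := fun v : {v // v ∈ V} => v.1) (k := ⟨V.get k, List.get_mem V k⟩) hk

/-- Elimination by `v` is filtered, changes vectors only by multiples of `v`, kills `v` and fixes
vectors with zero `i`-th component. Hence it carries a filtered representation of such a vector to
one by the new relations, and representatives to representatives. -/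
theorem minFBInv_step {E E' : Finset (Fin m)} {V V' : List (Fin m → A)}
    (h : MinFBInv P b N E V) (hst : MinFBStep P b (E, V) (E', V')) :
    MinFBInv P b N E' V' ∧ V'.length < V.length := by
  obtain ⟨_, _, j, v, i, c, hj, ⟨hi, hc, hvi, hbi⟩, -⟩ := hst
  have hvV := List.mem_of_getElem? hj
  obtain ⟨hvN, hv0, hvE⟩ := h.mem v hvV
  have hvF : v ∈ P.freeFil b (b i) := hbi ▸ mem_freeFil_filDeg P v
  have hsupp : ∀ y : Fin m → A, (∀ i, i ∉ E → y i = 0) → ∀ k, k ∉ E.erase i →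
      pivotElim c v i y k = 0 := by
    intro y hy k hk
    by_cases hki : k = i
    · rw [hki]
      exact pivotElim_apply_self hc hvi y
    · have hkE : k ∉ E := fun h => hk (Finset.mem_erase.2 ⟨hki, h⟩)
      rw [pivotElim_apply, Pi.sub_apply, Pi.smul_apply, hy k hkE, hvE k hkE, smul_zero, sub_zero]
  have hdiff : ∀ y : Fin m → A, y - pivotElim c v i y ∈ N := by
    intro y
    rw [pivotElim_apply, sub_sub_cancel]
    exact N.smul_mem _ hvN
  refine ⟨⟨?_, ?_, ?_⟩, ?_⟩
  · intro u hu
    obtain ⟨hu, hu0⟩ := List.mem_filter.1 hu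
    obtain ⟨u, huV, rfl⟩ := List.mem_map.1 hu
    obtain ⟨huN, -, huE⟩ := h.mem u (List.mem_of_mem_eraseIdx huV)
    refine ⟨?_, by simpa using hu0, hsupp u huE⟩
    exact N.sub_mem huN (N.smul_mem _ hvN)
  · intro q x hx hxE hxq
    have hxi : x i = 0 := hxE i (Finset.notMem_erase i E)
    have h1 := h.standard q x hx (fun k hk => hxE k fun h => hk (Finset.mem_of_mem_erase h)) hxq
    rw [← pivotElim_of_apply_eq_zero (c := c) (v := v) hxi]
    have h2 : listSpan P b V q ≤ Submodule.comap ((pivotElim c v i).restrictScalars K)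
        (listSpan P b (((V.eraseIdx j).map fun u => u - (c⁻¹ • u i) • v).filter
          fun u => u ≠ 0) q) := ?_
    · exact h2 h1
    refine mulSpan_le_iff.2 ?_
    rintro ⟨u, hu⟩ α hα
    rw [Submodule.mem_comap, LinearMap.restrictScalars_apply, map_smul]
    by_cases hu0 : pivotElim c v i u = 0
    · rw [hu0, smul_zero]
      exact Submodule.zero_mem _
    · have hmem : u ∈ V.eraseIdx j := by
        obtain ⟨k, hk, rfl⟩ := List.mem_iff_getElem.1 hu
        refine List.mem_eraseIdx_iff_getElem.2 ⟨k, hk, ?_, rfl⟩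
        rintro rfl
        rw [List.getElem?_eq_getElem hk, Option.some.injEq] at hj
        rw [hj] at hu0
        exact hu0 (pivotElim_pivot hc hvi)
      refine mem_mulSpan_basis (v := fun v : {v // v ∈ _} => v.1)
        (k := ⟨pivotElim c v i u, List.mem_filter.2 ⟨List.mem_map.2 ⟨u, hmem, rfl⟩, by simpa using hu0⟩⟩) ?_
      refine le_trans (Nat.add_le_add_left ?_ _) hα
      exact filDeg_le P (pivotElim_mem_freeFil hvF (mem_freeFil_filDeg P u))
  · intro q x hx
    obtain ⟨y, hy, hyE, hxy⟩ := h.gen q x hx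
    refine ⟨pivotElim c v i y, pivotElim_mem_freeFil hvF hy, hsupp y hyE, ?_⟩
    have := N.add_mem hxy (hdiff y)
    rwa [sub_add_sub_cancel] at this
  · refine (List.length_filter_le _ _).trans_lt ?_
    have hjlt := (List.getElem?_eq_some_iff.1 hj).1
    rw [List.length_map, List.length_eraseIdx, if_pos hjlt]
    omega

theorem runMinFB_of {V : List (Fin m → A)} (hV : IsStandardBasis P (P.freeFil b) N V.get)
    {Q : Finset (Fin m) → List (Fin m → A) → Prop}
    (hQ : ∀ E V, MinFBInv P b N E V → (∀ v ∈ V, ∀ i c, ¬ IsPivot P b E v i c) → Q E V) :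
    RunMinFB P b V Q := by
  refine Always.of_invariant (fun s : Finset (Fin m) × List (Fin m → A) => MinFBInv P b N s.1 s.2)
    wellFounded_lt (fun s => s.2.length) ?_ (fun s t hs hst => minFBInv_step hs hst)
    (fun s hs hh => hQ s.1 s.2 hs hh) (minFBInv_start hV)
  rintro ⟨E, V⟩ hs hh
  push Not at hh
  obtain ⟨v, hv, i, c, hp⟩ := hh
  obtain ⟨j, hj⟩ := List.mem_iff_getElem?.1 hv
  obtain ⟨i, ⟨c, hp⟩, hmin⟩ := (wellFounded_lt (α := Fin m)).has_min
    {i | ∃ c, IsPivot P b E v i c} ⟨i, c, hp⟩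
  exact ⟨(_, _), MinFBStep.mk E V j v i c hj hp fun i' hi' c' hp' => hmin i' ⟨c', hp'⟩ hi'⟩

/-- The extension by zero of a vector with components in `E`. -/
def extendZero (A : Type*) [Ring A] (E : Finset (Fin m)) :
    ({i // i ∈ E} → A) →ₗ[A] (Fin m → A) where
  toFun x i := if h : i ∈ E then x ⟨i, h⟩ else 0
  map_add' x y := by
    ext i
    by_cases h : i ∈ E <;> simp [h]
  map_smul' c x := by
    ext i
    by_cases h : i ∈ E <;> simp [h]

/-! ### Free submodules spanned by part of the basis -/

section ExtendZero

variable {E : Finset (Fin m)}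

theorem extendZero_apply_mem (x : {i // i ∈ E} → A) (i : {i // i ∈ E}) :
    extendZero A E x i = x i := by simp [extendZero]

theorem extendZero_apply_notMem (x : {i // i ∈ E} → A) {i : Fin m} (h : i ∉ E) :
    extendZero A E x i = 0 := by simp [extendZero, h]

theorem extendZero_restrict {x : Fin m → A} (h : ∀ i, i ∉ E → x i = 0) :
    extendZero A E (fun i => x i) = x := by
  ext i
  by_cases hi : i ∈ E
  · exact extendZero_apply_mem _ ⟨i, hi⟩
  · rw [extendZero_apply_notMem _ hi, h i hi]

theorem extendZero_stdVec (i : {i // i ∈ E}) :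
    extendZero A E (stdVec A i) = stdVec A (i : Fin m) := by
  ext k
  by_cases hk : k ∈ E
  · simp [extendZero, hk, stdVec, Pi.single_apply, Subtype.ext_iff]
  · have : k ≠ i := fun h => hk (h ▸ i.2)
    simp [extendZero, hk, stdVec, this]

theorem extendZero_mem_freeFil {q : ℕ} {x : {i // i ∈ E} → A} :
    extendZero A E x ∈ P.freeFil b q ↔ x ∈ P.freeFil (fun i : {i // i ∈ E} => b i) q := by
  rw [mem_freeFil_iff_apply, mem_freeFil_iff_apply]
  constructor
  · intro h i γ hγ
    exact h i γ (by rwa [extendZero_apply_mem])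
  · intro h i γ hγ
    by_cases hi : i ∈ E
    · exact h ⟨i, hi⟩ γ (by rwa [← extendZero_apply_mem x ⟨i, hi⟩])
    · rw [extendZero_apply_notMem x hi] at hγ
      simp at hγ

theorem extendZero_eq_sum (x : {i // i ∈ E} → A) :
    extendZero A E x = ∑ i, x i • stdVec A (i : Fin m) := by
  conv_lhs => rw [← sum_smul_stdVec x]
  simp only [map_sum, map_smul, extendZero_stdVec]

theorem subMap_apply (x : (subLevel b E).ι → A) :
    subMap b N E x = N.mkQ (extendZero A E x) := by
  refine Eq.trans ?_ (congrArg N.mkQ (extendZero_eq_sum x)).symm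
  rw [map_sum]
  exact Finset.sum_congr rfl fun i _ => (map_smul _ _ _).symm

theorem subMap_stdVec (i : (subLevel b E).ι) :
    subMap b N E (stdVec A i) = N.mkQ (stdVec A i.1) :=
  (subMap_apply _).trans (congrArg N.mkQ (extendZero_stdVec i))

theorem mem_ker_subMap {x : (subLevel b E).ι → A} :
    x ∈ LinearMap.ker (subMap b N E) ↔ extendZero A E x ∈ N := by
  rw [LinearMap.mem_ker, subMap_apply, Submodule.mkQ_apply]
  exact Submodule.Quotient.mk_eq_zero N

end ExtendZero

namespace MinFBInv

variable {E : Finset (Fin m)} {V : List (Fin m → A)}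

theorem map_subMap (h : MinFBInv P b N E V) (q : ℕ) :
    (P.freeFil (subLevel b E).deg q).map ((subMap b N E).restrictScalars K) =
      quotFil K (P.freeFil b) N q := by
  apply le_antisymm
  · rintro _ ⟨x, hx, rfl⟩
    exact ⟨extendZero A E x, extendZero_mem_freeFil.2 hx, (subMap_apply x).symm⟩
  · rintro _ ⟨x, hx, rfl⟩
    obtain ⟨y, hy, hyE, hxy⟩ := h.gen q x hx
    have e := extendZero_restrict hyE
    refine ⟨fun i => y i.1, extendZero_mem_freeFil.1 (e.symm ▸ hy), ?_⟩
    exact (subMap_apply _).trans ((congrArg N.mkQ e).trans ((Submodule.Quotient.eq N).2 hxy).symm)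

theorem subMap_surjective (h : MinFBInv P b N E V) : Function.Surjective (subMap b N E) := by
  intro y
  obtain ⟨x, rfl⟩ := N.mkQ_surjective y
  obtain ⟨q, hq⟩ := exists_mem_freeFil P (b := b) x
  have : N.mkQ x ∈ quotFil K (P.freeFil b) N q := ⟨x, hq, rfl⟩
  rw [← h.map_subMap] at this
  obtain ⟨z, -, hz⟩ := this
  exact ⟨z, hz⟩

theorem strict_subMap (h : MinFBInv P b N E V) :
    IsStrictFiltered (P.freeFil (subLevel b E).deg) (quotFil K (P.freeFil b) N)
      (subMap b N E) := by
  intro q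
  rw [h.map_subMap, LinearMap.range_eq_top.2 h.subMap_surjective]
  simp

theorem ker_subMap (h : MinFBInv P b N E V) : LinearMap.ker (subMap b N E) =
    Submodule.span A {x | x ∈ V.map fun v (i : {i // i ∈ E}) => v i.1} := by
  apply le_antisymm
  · intro x hx
    replace hx := mem_ker_subMap.1 hx
    obtain ⟨q, hq⟩ := exists_mem_freeFil P (b := b) (extendZero A E x)
    have h1 := h.standard q _ hx (fun i hi => extendZero_apply_notMem x hi) hq
    have h2 : listSpan P b V q ≤ ((Submodule.span A
        {x | x ∈ V.map fun v (i : {i // i ∈ E}) => v i.1}).comap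
        (LinearMap.funLeft A A (Subtype.val : {i // i ∈ E} → Fin m))).restrictScalars K := by
      refine mulSpan_le_iff.2 fun v α _ => ?_
      rw [Submodule.restrictScalars_mem, Submodule.mem_comap, map_smul]
      refine Submodule.smul_mem _ _ (Submodule.subset_span ?_)
      exact List.mem_map_of_mem v.2
    have h3 := h2 h1
    have h4 : LinearMap.funLeft A A (Subtype.val : {i // i ∈ E} → Fin m) (extendZero A E x) = x :=
      funext fun i => extendZero_apply_mem x i
    rw [← h4]
    exact h3
  · refine Submodule.span_le.2 fun x hx => ?_
    obtain ⟨v, hv, rfl⟩ := List.mem_map.1 hx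
    obtain ⟨hvN, -, hvE⟩ := h.mem v hv
    refine mem_ker_subMap.2 ?_
    rwa [extendZero_restrict hvE]

theorem ne_zero_restrict (h : MinFBInv P b N E V) :
    ∀ u ∈ V.map fun v (i : {i // i ∈ E}) => v i.1, u ≠ 0 := by
  intro u hu h0
  obtain ⟨v, hv, rfl⟩ := List.mem_map.1 hu
  obtain ⟨-, hv0, hvE⟩ := h.mem v hv
  refine hv0 ?_
  rw [← extendZero_restrict hvE, h0, map_zero]

/-- The algorithm inspects only the listed relations; the standard basis property extends the
conclusion to the whole kernel. In a representation in degree $b_i$, a summand $a^\alpha v$ with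
$\alpha\ne0$ has $v$ of degree below $b_i$, hence $v_i=0$; one with $\alpha=0$ would exhibit a pivot
of $v$ itself. -/
theorem noPivot (h : MinFBInv P b N E V) (hp : ∀ v ∈ V, ∀ i c, ¬ IsPivot P b E v i c) :
    NoPivot P (subLevel b E).deg (LinearMap.ker (subMap b N E)) := by
  intro x hx i hxi
  replace hx := mem_ker_subMap.1 hx
  have hF : extendZero A E x ∈ P.freeFil b (b i.1) := extendZero_mem_freeFil.2 hxi
  have h1 := h.standard _ _ hx (fun i hi => extendZero_apply_notMem x hi) hF
  have h2 : P.coef x (0, i) = P.coef (extendZero A E x) (0, i.1) := by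
    exact congrArg (fun y => P.basis.repr y 0) (extendZero_apply_mem x i).symm
  rw [h2]
  let f : (Fin m → A) →ₗ[K] K :=
    { toFun := fun y => P.coef y (0, i.1)
      map_add' := fun y z => coef_add P y z _
      map_smul' := fun c y => coef_smul P c y _ }
  have h3 : listSpan P b V (b i.1) ≤ LinearMap.ker f := by
    refine mulSpan_le_iff.2 fun v α hα => LinearMap.mem_ker.2 ?_
    obtain ⟨v, hv⟩ := v
    dsimp only at hα ⊢
    change P.coef (P.basis α • v) (0, i.1) = 0
    by_cases h0 : P.wdeg α = 0
    · obtain rfl := P.wdeg_eq_zero.1 h0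
      rw [P.basis_zero, one_smul]
      by_contra hc
      have hvF := mem_freeFil_filDeg P (b := b) v
      have h4 := (mem_freeFil P).1 hvF _ hc
      have h5 : b i.1 = P.filDeg b v := by
        simp only [mdeg, P.wdeg_zero] at h4
        omega
      exact hp v hv i.1 _ ⟨i.2, hc, apply_eq_algebraMap (h5 ▸ hvF), h5⟩
    · refine coef_eq_zero_of_apply ?_
      rw [Pi.smul_apply, apply_eq_zero_of_mem_freeFil P (mem_freeFil_filDeg P (b := b) v) (by omega),
        smul_zero]
  exact LinearMap.mem_ker.1 (h3 h1)

theorem exists_equiv (h : MinFBInv P b N E V) {N' : Submodule A ((subLevel b E).ι → A)}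
    (hN' : N' = LinearMap.ker (subMap b N E)) :
    ∃ ψ : (((subLevel b E).ι → A) ⧸ N') ≃ₗ[A] ((Fin m → A) ⧸ N),
      (∀ x, ψ (N'.mkQ x) = subMap b N E x) ∧
      IsStrictFiltered (quotFil K (P.freeFil (subLevel b E).deg) N')
        (quotFil K (P.freeFil b) N) ψ.toLinearMap := by
  subst hN'
  refine ⟨(subMap b N E).quotKerEquivOfSurjective h.subMap_surjective, fun x => rfl, fun q => ?_⟩
  have hr : LinearMap.range ((subMap b N E).quotKerEquivOfSurjective
      h.subMap_surjective).toLinearMap = ⊤ := LinearEquiv.range _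
  rw [hr, Submodule.restrictScalars_top, top_inf_eq, ← h.map_subMap, quotFil, ← Submodule.map_comp]
  rfl

theorem isMinimalFBasis (h : MinFBInv P b N E V)
    (hp : ∀ v ∈ V, ∀ i c, ¬ IsPivot P b E v i c) :
    IsMinimalFBasis P (quotFil K (P.freeFil b) N) fun i : {i // i ∈ E} => N.mkQ (stdVec A i.1) := by
  have := isMinimalFBasis_of_noPivot h.map_subMap (h.noPivot hp)
  have e : (fun i : {i // i ∈ E} => N.mkQ (stdVec A i.1)) =
      fun i => subMap b N E (stdVec A i) := funext fun i => (subMap_stdVec i).symm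
  rw [e]
  exact this

end MinFBInv

end MinFB

/-! ### Resolutions by strict covers -/

section Schreyer

variable {K A : Type*} [Field K] [Ring A] [Algebra K A] {n : ℕ} {P : GradedSolvPolyAlg K A n}
  {ι : Type*} {b : ι → ℕ} {r : Expo n × ι → Expo n × ι → Prop}

/-- The leading monomials of the elements of `N`. -/
def leadSet (P : GradedSolvPolyAlg K A n) (r : Expo n × ι → Expo n × ι → Prop)
    (N : Submodule A (ι → A)) : Set (Expo n × ι) :=
  {s | ∃ x ∈ N, IsLeading r (P.coef x) s}

/-- The elements of a set of monomials that are minimal for divisibility. -/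
def minMonomials (S : Set (Expo n × ι)) : Set (Expo n × ι) :=
  {s | s ∈ S ∧ ∀ t ∈ S, MDvd t s → t = s}

theorem finite_minMonomials [Finite ι] (S : Set (Expo n × ι)) : (minMonomials S).Finite :=
  finite_of_mdvd_antichain _ fun _ hs _ ht h => ht.2 _ hs.1 h

/-- The ordering that decides between multiples of monomials that coincide. -/
def tieLT (r : Expo n × ι → Expo n × ι → Prop) (i : Fin n) (s t : Expo n × ι) : Prop :=
  s.1 i < t.1 i ∨ (s.1 i = t.1 i ∧ r s t)

/-- The ordering on the syzygies of elements whose leading monomials form the set `S`. -/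
def schreyerLT (r : Expo n × ι → Expo n × ι → Prop) (i : Fin n) (S : Set (Expo n × ι))
    (s t : Expo n × S) : Prop :=
  r (shift s.1 s.2.1) (shift t.1 t.2.1) ∨
    (shift s.1 s.2.1 = shift t.1 t.2.1 ∧ tieLT r i s.2 t.2)

theorem tieLT_strictTotal (hr : IsStrictTotal r) (i : Fin n) : IsStrictTotal (tieLT r i) := by
  refine ⟨?_, ?_, ?_⟩
  · rintro s (h | ⟨-, h⟩)
    · exact lt_irrefl _ h
    · exact hr.irrefl s h
  · rintro s t u (h | ⟨h, h'⟩) (k | ⟨k, k'⟩)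
    · exact Or.inl (h.trans k)
    · exact Or.inl (k ▸ h)
    · exact Or.inl (h ▸ k)
    · exact Or.inr ⟨h.trans k, hr.trans _ _ _ h' k'⟩
  · intro s t
    rcases lt_trichotomy (s.1 i) (t.1 i) with h | h | h
    · exact Or.inl (Or.inl h)
    · rcases hr.total s t with h' | h' | h'
      · exact Or.inl (Or.inr ⟨h, h'⟩)
      · exact Or.inr (Or.inl h')
      · exact Or.inr (Or.inr (Or.inr ⟨h.symm, h'⟩))
    · exact Or.inr (Or.inr (Or.inl h))

theorem schreyerLT_strictTotal (hr : IsStrictTotal r) (i : Fin n) (S : Set (Expo n × ι)) :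
    IsStrictTotal (schreyerLT r i S) := by
  have ht := tieLT_strictTotal hr i
  refine ⟨?_, ?_, ?_⟩
  · rintro s (h | ⟨-, h⟩)
    · exact hr.irrefl _ h
    · exact ht.irrefl _ h
  · rintro s t u (h | ⟨h, h'⟩) (k | ⟨k, k'⟩)
    · exact Or.inl (hr.trans _ _ _ h k)
    · exact Or.inl (k ▸ h)
    · exact Or.inl (h ▸ k)
    · exact Or.inr ⟨h.trans k, ht.trans _ _ _ h' k'⟩
  · intro s t
    rcases hr.total (shift s.1 s.2.1) (shift t.1 t.2.1) with h | h | h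
    · exact Or.inl (Or.inl h)
    · rcases ht.total s.2 t.2 with h' | h' | h'
      · exact Or.inl (Or.inr ⟨h, h'⟩)
      · refine Or.inr (Or.inl ?_)
        have h2 : s.2 = t.2 := Subtype.ext h'
        rw [h2] at h
        exact Prod.ext (shift_left_injective _ h) h2
      · exact Or.inr (Or.inr (Or.inr ⟨h.symm, h'⟩))
    · exact Or.inr (Or.inr (Or.inl h))

/-- The order is pulled back from image monomials, which gives the degrees of the new basis vectors.
A tie depends on the basis vectors alone, so multiplication by a monomial does not affect it. -/
theorem schreyerLT_isGraded (hr : IsGradedLeftMonomialOrdering P b r) (i : Fin n)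
    (S : Set (Expo n × ι)) :
    IsGradedLeftMonomialOrdering P (fun s : S => mdeg P b s.1) (schreyerLT r i S) := by
  have hst := schreyerLT_strictTotal hr.strictTotal i S
  have hcompat : ∀ (α β : Expo n) (k : S), P.lt α β → schreyerLT r i S (α, k) (β, k) :=
    fun α β k h => Or.inl (hr.shift_left_lt h k.1)
  refine ⟨hst, ?_, hcompat, ?_⟩
  · intro γ s t s' t' h hs ht
    obtain rfl := IsLeading.unique hst hs (isLeading_smul_mon_of_compat hcompat γ s)
    obtain rfl := IsLeading.unique hst ht (isLeading_smul_mon_of_compat hcompat γ t)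
    have e : ∀ s : Expo n × S, shift (shift γ s).1 (shift γ s).2.1 =
        shift γ (shift s.1 s.2.1) := fun s => (shift_shift _ _ _).symm
    rcases h with h | ⟨h, h'⟩
    · refine Or.inl ?_
      rw [e, e]
      exact hr.shift_lt γ h
    · refine Or.inr ⟨?_, h'⟩
      rw [e, e, h]
  · intro s t h
    change mdeg P (fun s : S => mdeg P b s.1) s ≤ mdeg P (fun s : S => mdeg P b s.1) t
    have e : ∀ s : Expo n × S, mdeg P (fun s : S => mdeg P b s.1) s =
        mdeg P b (shift s.1 s.2.1) := fun s => (mdeg_shift P b _ _).symm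
    rw [e, e]
    exact hr.mdeg_le (h.elim Or.inr fun h => Or.inl h.1)

theorem linearCombination_mon {κ M : Type*} [Fintype κ] [AddCommGroup M] [Module A M] (v : κ → M)
    (s : Expo n × κ) :
    Fintype.linearCombination A v (P.mon s) = P.basis s.1 • v s.2 := by
  rw [GradedSolvPolyAlg.mon, Fintype.linearCombination_apply_single]

theorem linearCombination_smul {κ M : Type*} [Fintype κ] [AddCommGroup M] [Module A M]
    [Module K M] [IsScalarTower K A M] (v : κ → M) (c : K) (x : κ → A) :
    Fintype.linearCombination A v (c • x) = c • Fintype.linearCombination A v x :=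
  ((Fintype.linearCombination A v).restrictScalars K).map_smul c x

/-! ### Leading monomials of syzygies -/

section Cover

variable [Fintype ι] {S : Set (Expo n × ι)} [Fintype S] {v : S → ι → A}

omit [Fintype ι] in
theorem mem_monoSpan_of_coef (lead : S → Expo n × ι) {D : Set (Expo n × ι)} {y : S → A}
    (hy : ∀ s, P.coef y s ≠ 0 → shift s.1 (lead s.2) ∈ D) :
    Fintype.linearCombination A v y ∈
      MonomialModule.monoSpan K lead (fun k α => P.basis α • v k) D := by
  have h1 : y ∈ Submodule.span K (freeBasis P S '' {s | shift s.1 (lead s.2) ∈ D}) := by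
    rw [Module.Basis.mem_span_image]
    intro s hs
    refine hy s ?_
    simpa [freeBasis, freeRepr_apply] using hs
  revert h1
  suffices H : Submodule.span K (freeBasis P S '' {s | shift s.1 (lead s.2) ∈ D}) ≤
      (MonomialModule.monoSpan K lead (fun k α => P.basis α • v k) D).comap
        ((Fintype.linearCombination A v).restrictScalars K) from fun h => H h
  refine Submodule.span_le.2 ?_
  rintro _ ⟨s, hs, rfl⟩
  rw [SetLike.mem_coe, Submodule.mem_comap, freeBasis_apply, LinearMap.restrictScalars_apply,
    linearCombination_mon]
  exact MonomialModule.mem_monoSpan hs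

omit [Fintype ι] in
theorem exists_coef_of_mem_monoSpan (lead : S → Expo n × ι) {D : Set (Expo n × ι)} {x : ι → A}
    (hx : x ∈ MonomialModule.monoSpan K lead (fun k α => P.basis α • v k) D) :
    ∃ y : S → A, Fintype.linearCombination A v y = x ∧
      ∀ s, P.coef y s ≠ 0 → shift s.1 (lead s.2) ∈ D := by
  induction hx using Submodule.span_induction with
  | mem x hx =>
    obtain ⟨k, α, hk, rfl⟩ := hx
    refine ⟨P.mon (α, k), linearCombination_mon v _, fun s hs => ?_⟩
    rw [coef_mon] at hs
    obtain rfl : (α, k) = s := by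
      by_contra hne
      exact hs (if_neg hne)
    exact hk
  | zero => exact ⟨0, map_zero _, fun s hs => absurd (coef_zero P s) hs⟩
  | add x y _ _ hx hy =>
    obtain ⟨x', rfl, hx'⟩ := hx
    obtain ⟨y', rfl, hy'⟩ := hy
    refine ⟨x' + y', map_add _ _ _, fun s hs => ?_⟩
    by_cases h : P.coef x' s = 0
    · refine hy' s fun h' => hs ?_
      rw [coef_add, h, h', add_zero]
    · exact hx' s h
  | smul c x _ hx =>
    obtain ⟨x', rfl, hx'⟩ := hx
    refine ⟨c • x', linearCombination_smul v c x',
      fun s hs => hx' s fun h => hs ?_⟩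
    rw [coef_smul, h, mul_zero]

variable (hr : IsGradedLeftMonomialOrdering P b r) (hv : ∀ s, IsLeading r (P.coef (v s)) s.1)
include hr hv

theorem coef_linearCombination_eq_zero {M : Expo n × ι} {y : S → A}
    (hy : ∀ s, P.coef y s ≠ 0 → r (shift s.1 s.2.1) M) :
    P.coef (Fintype.linearCombination A v y) M = 0 := by
  have h1 := mem_monoSpan_of_coef (P := P) (v := v) (fun s => s.1) (D := {t | r t M}) hy
  have h2 : MonomialModule.monoSpan K (fun s : S => s.1) (fun k α => P.basis α • v k)
      {t | r t M} ≤ LinearMap.ker ((Finsupp.lapply M).comp (freeRepr P ι).toLinearMap) := by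
    refine Submodule.span_le.2 ?_
    rintro _ ⟨k, α, hk, rfl⟩
    change freeRepr P ι (P.basis α • v k) M = 0
    rw [freeRepr_apply]
    by_contra hne
    have h3 := ((freeAdm hr).lead_act α (hv k)).2 M hne
    exact hr.strictTotal.irrefl _ (hr.strictTotal.lt_of_le_of_lt h3 hk)
  have h3 := h2 h1
  rwa [LinearMap.mem_ker, LinearMap.comp_apply, Finsupp.lapply_apply, LinearEquiv.coe_coe,
    freeRepr_apply] at h3

/-- A leading monomial of a syzygy is a multiple of a smaller leading monomial. -/
theorem exists_tie_of_isLeading {i : Fin n} {z : S → A}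
    (hz : Fintype.linearCombination A v z = 0) {s : Expo n × S}
    (hs : IsLeading (schreyerLT r i S) (P.coef z) s) :
    ∃ t : S, tieLT r i t.1 s.2.1 ∧ MDvd t.1 (shift s.1 s.2.1) := by
  by_contra! hno
  -- A term tied with `s` would supply the desired divisor. If there is none, all other terms have
  -- strictly smaller images, and the image of the term at `s` cannot cancel.
  have hlow : ∀ t, P.coef z t ≠ 0 → t ≠ s → r (shift t.1 t.2.1) (shift s.1 s.2.1) := by
    intro t ht hts
    rcases (hs.2 t ht).resolve_left hts with h | ⟨h, h'⟩
    · exact h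
    · exact absurd ⟨_, h⟩ (hno t.2 h')
  have h1 := coef_linearCombination_eq_zero hr hv (M := shift s.1 s.2.1)
    (y := z - P.coef z s • P.mon s) fun t ht => by
      rw [coef_sub, coef_smul, coef_mon] at ht
      by_cases hts : t = s
      · rw [hts, if_pos rfl, mul_one, sub_self] at ht
        exact absurd rfl ht
      · rw [if_neg (Ne.symm hts), mul_zero, sub_zero] at ht
        exact hlow t ht hts
  have h2 : Fintype.linearCombination A v (P.coef z s • P.mon s) =
      P.coef z s • P.basis s.1 • v s.2 := by
    rw [linearCombination_smul, linearCombination_mon]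
  rw [map_sub, hz, h2, zero_sub, ← neg_smul, coef_smul] at h1
  exact mul_ne_zero (neg_ne_zero.2 hs.1) ((freeAdm hr).lead_act s.1 (hv s.2)).1 h1

/-- Each multiple of a smaller leading monomial is the leading monomial of a syzygy. -/
theorem mem_leadSet_ker {N : Submodule A (ι → A)} (hvN : ∀ s, v s ∈ N)
    (hN : ∀ x ∈ N, ∀ s, IsLeading r (P.coef x) s → ∃ k : S, MDvd k.1 s) {i : Fin n} {α : Expo n}
    {s t : S} (hts : tieLT r i t.1 s.1) (hd : MDvd t.1 (shift α s.1)) :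
    (α, s) ∈ leadSet P (schreyerLT r i S)
      (LinearMap.ker (Fintype.linearCombination A v)) := by
  obtain ⟨β, hβ⟩ := hd
  have h1 := (freeAdm hr).lead_act α (hv s)
  have h2 := (freeAdm hr).lead_act β (hv t)
  rw [hβ] at h2
  change IsLeading r (P.coef (P.basis α • v s)) _ at h1
  change IsLeading r (P.coef (P.basis β • v t)) _ at h2
  set M := shift α s.1 with hM
  set c : K := P.coef (P.basis α • v s) M * (P.coef (P.basis β • v t) M)⁻¹ with hc
  have hxN : P.basis α • v s - c • P.basis β • v t ∈ N := by
    rw [← smul_assoc]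
    exact N.sub_mem (N.smul_mem _ (hvN s)) (N.smul_mem _ (hvN t))
  have hlow : ∀ u, P.coef (P.basis α • v s - c • P.basis β • v t) u ≠ 0 → r u M := by
    intro u hu
    refine (freeAdm hr).coef_sub_lead (a := 1) (b := c) h1 h2 ?_ (by rwa [one_smul])
    change 1 * P.coef (P.basis α • v s) M = c * P.coef (P.basis β • v t) M
    rw [one_mul, hc, mul_assoc, inv_mul_cancel₀ h2.1, mul_one]
  -- The two multiples have been combined to cancel at `M`; the rest is represented by terms
  -- strictly below `M`, and subtracting `y` completes a syzygy. Its leading monomial is `(α, s)`,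
  -- since the tie is decided against `t`.
  obtain ⟨y, hy, hyl⟩ := exists_coef_of_mem_monoSpan (P := P) (fun s : S => s.1)
    (mem_monoSpan_of_groebner hr hvN hv hN (D := {u | r u M})
      (fun a b hab ha => hr.strictTotal.trans _ _ _ hab ha) hxN hlow)
  have hne : (β, t) ≠ (α, s) := by
    intro h
    rw [(Prod.mk.inj h).2] at hts
    exact (tieLT_strictTotal hr.strictTotal i).irrefl _ hts
  have hys : P.coef y (α, s) = 0 := by
    by_contra h
    exact hr.strictTotal.irrefl _ (hyl _ h)
  refine ⟨P.mon (α, s) - c • P.mon (β, t) - y, ?_, ?_, fun u hu => ?_⟩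
  · rw [LinearMap.mem_ker, map_sub, map_sub, hy, linearCombination_smul, linearCombination_mon,
      linearCombination_mon, sub_self]
  · rw [coef_sub, coef_sub, coef_smul, coef_mon, coef_mon, if_pos rfl, if_neg hne, hys]
    simp
  · rw [coef_sub, coef_sub, coef_smul, coef_mon, coef_mon] at hu
    by_cases h3 : (α, s) = u
    · exact Or.inl h3.symm
    · right
      by_cases h4 : (β, t) = u
      · subst h4
        exact Or.inr ⟨hβ, hts⟩
      · rw [if_neg h3, if_neg h4, mul_zero, sub_zero, zero_sub] at hu
        exact Or.inl (hyl u (neg_ne_zero.1 hu))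

end Cover

/-- The exponent vector in which the first `i` entries are replaced by `0`. -/
def zeroFirst (i : ℕ) (α : Expo n) : Expo n := fun j => if j.1 < i then 0 else α j

theorem zeroFirst_le (i : ℕ) (α : Expo n) : zeroFirst i α ≤ α := by
  intro j
  unfold zeroFirst
  split_ifs
  · exact Nat.zero_le _
  · exact le_rfl

end Schreyer

/-- `φ` is a filtered homomorphism onto `N` that is strict. -/
structure IsStrictCover {K A : Type*} [Field K] [Ring A] [Algebra K A] {n : ℕ}
    (P : GradedSolvPolyAlg K A n) (F' F : FreeLevel) (N : Submodule A (F.ι → A))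
    (φ : (F'.ι → A) →ₗ[A] (F.ι → A)) : Prop where
  range : LinearMap.range φ = N
  map_mem : ∀ q, ∀ x ∈ P.freeFil F'.deg q, φ x ∈ P.freeFil F.deg q
  lift : ∀ q, ∀ x ∈ N, x ∈ P.freeFil F.deg q → ∃ y ∈ P.freeFil F'.deg q, φ y = x

/-- `N` has a resolution of length `d` (with `d` terms) by strict covers. -/
def HasFreeRes {K A : Type*} [Field K] [Ring A] [Algebra K A] {n : ℕ}
    (P : GradedSolvPolyAlg K A n) : ℕ → (F : FreeLevel) → Submodule A (F.ι → A) → Prop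
  | 0, _, N => N = ⊥
  | d + 1, F, N => ∃ (F' : FreeLevel) (φ : (F'.ι → A) →ₗ[A] (F.ι → A)),
      IsStrictCover P F' F N φ ∧ HasFreeRes P d F' (LinearMap.ker φ)

/-! ### Schreyer resolutions of bounded length -/

section FreeRes

variable {K A : Type*} [Field K] [Ring A] [Algebra K A] {n : ℕ} {P : GradedSolvPolyAlg K A n}

theorem linearCombination_mem_freeFil {κ ι : Type*} [Fintype κ] [Finite ι] {b : ι → ℕ} {d : κ → ℕ}
    {v : κ → ι → A} (hv : ∀ k, v k ∈ P.freeFil b (d k)) {q : ℕ} {x : κ → A}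
    (hx : x ∈ P.freeFil d q) : Fintype.linearCombination A v x ∈ P.freeFil b q := by
  have h1 := sum_smul_mem_mulSpan (v := v) hx
  refine (mulSpan_le_iff (S := P.freeFil b q)).2 (fun k α hk => ?_) h1
  exact basis_smul_mem_freeFil P (hv k) hk

theorem isStrictCover_of_standardBasis {F : FreeLevel} {N : Submodule A (F.ι → A)}
    {κ : Type} [Fintype κ] {v : κ → F.ι → A} {d : κ → ℕ}
    (hd : ∀ k, P.filDeg F.deg (v k) = d k) (hv : IsStandardBasis P (P.freeFil F.deg) N v) :
    IsStrictCover P ⟨κ, inferInstance, d⟩ F N (Fintype.linearCombination A v) := by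
  obtain ⟨-, hm, hs⟩ := isStandardBasis_iff.1 hv
  have hlift : ∀ q, ∀ x ∈ N, x ∈ P.freeFil F.deg q → ∃ y ∈ P.freeFil d q,
      Fintype.linearCombination A v y = x := by
    intro q x hx hq
    obtain ⟨f, hf, hfq⟩ := exists_coeff_of_mem_mulSpan (hs q x hx hq)
    simp only [hd] at hfq
    exact ⟨f, hfq, hf.symm⟩
  refine ⟨le_antisymm ?_ ?_, fun q x hx => ?_, hlift⟩
  · rintro _ ⟨f, rfl⟩
    exact N.sum_mem fun k _ => N.smul_mem _ (hm k).1
  · intro x hx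
    obtain ⟨q, hq⟩ := exists_mem_freeFil P (b := F.deg) x
    obtain ⟨y, -, hy⟩ := hlift q x hx hq
    exact ⟨y, hy⟩
  · exact linearCombination_mem_freeFil (d := d)
      (fun k => (mem_freeFil_iff_filDeg_le P).2 (hd k).le) hx

/-- Schreyer's construction: each step clears one more variable from the leading monomials. -/
theorem hasFreeRes_of_zeroFirst (k : ℕ) : ∀ {i : ℕ}, i + k = n → ∀ {F : FreeLevel}
    {r : Expo n × F.ι → Expo n × F.ι → Prop}, IsGradedLeftMonomialOrdering P F.deg r →
    ∀ {N : Submodule A (F.ι → A)}, (∀ e, (0, e) ∉ leadSet P r N) →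
    (∀ s ∈ leadSet P r N, (zeroFirst i s.1, s.2) ∈ leadSet P r N) → HasFreeRes P k F N := by
  induction k with
  | zero =>
    intro i hi F r hr N h0 hz
    refine (Submodule.eq_bot_iff N).2 fun x hx => ?_
    by_contra hx0
    obtain ⟨s, hs⟩ := (freeAdm hr).exists_isLeading hx0
    refine h0 s.2 ?_
    have h1 := hz s ⟨x, hx, hs⟩
    -- Here `i = n`, so clearing the first `i` exponents leaves a bare basis vector, which is
    -- excluded as a leading monomial.
    have h2 : zeroFirst i s.1 = 0 := by
      funext j
      exact if_pos (by have := j.2; omega)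
    rwa [h2] at h1
  | succ k ih =>
    intro i hi F r hr N h0 hz
    set S := minMonomials (leadSet P r N) with hS
    have : Fintype S := (finite_minMonomials _).fintype
    choose v hvN hv using fun s : S => s.2.1
    have hN : ∀ x ∈ N, ∀ s, IsLeading r (P.coef x) s → ∃ k : S, MDvd k.1 s := by
      intro x hx s hs
      obtain ⟨t, ht, hts, hmin⟩ := exists_minimal_mdvd (leadSet P r N) ⟨x, hx, hs⟩
      exact ⟨⟨t, ht, hmin⟩, hts⟩
    -- Clearing the first `i` exponents gives a leading monomial dividing the old one; minimal
    -- leading monomials therefore do not involve these variables.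
    have hzS : ∀ s : S, zeroFirst i s.1.1 = s.1.1 := by
      intro s
      exact congrArg Prod.fst (s.2.2 _ (hz _ s.2.1) (mdvd_iff.2 ⟨zeroFirst_le i _, rfl⟩))
    let i' : Fin n := ⟨i, by omega⟩
    refine ⟨⟨S, inferInstance, fun s => mdeg P F.deg s.1⟩, Fintype.linearCombination A v,
      isStrictCover_of_standardBasis (fun s => filDeg_eq_mdeg hr (hv s))
        (isStandardBasis_of_groebner hr hvN hv hN), ?_⟩
    refine ih (i := i + 1) (by omega) (schreyerLT_isGraded hr i' S) ?_ ?_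
    -- A bare basis vector would require a smaller member of `S` dividing another one; by minimality
    -- the two coincide, against irreflexivity of the tie.
    · rintro s ⟨z, hz', hs⟩
      obtain ⟨t, hts, hd⟩ := exists_tie_of_isLeading hr hv hz' hs
      rw [shift_zero] at hd
      rw [s.2.2 _ t.2.1 hd] at hts
      exact (tieLT_strictTotal hr.strictTotal i').irrefl _ hts
    · rintro s ⟨z, hz', hs⟩
      obtain ⟨t, hts, hd⟩ := exists_tie_of_isLeading hr hv hz' hs
      refine mem_leadSet_ker hr hv hvN hN hts ?_
      obtain ⟨h1, h2⟩ := mdvd_iff.1 hd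
      refine mdvd_iff.2 ⟨fun j => ?_, h2⟩
      have h3 := h1 j
      change t.1.1 j ≤ zeroFirst (i + 1) s.1 j + s.2.1.1 j
      change t.1.1 j ≤ s.1 j + s.2.1.1 j at h3
      unfold zeroFirst
      split_ifs with hj
      -- Divisibility survives clearing the multiplier: below position `i` the exponents of `t` are
      -- zero, and at `i` the tie-breaking says that `t` has no larger exponent than `s`.
      · rcases Nat.lt_succ_iff_lt_or_eq.1 hj with hj | hj
        · rw [← hzS t]
          simp [zeroFirst, hj]
        · obtain rfl : j = i' := Fin.ext hj
          rw [zero_add]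
          exact hts.elim le_of_lt fun h => h.1.le
      · exact h3

/-- For a graded ordering a bare basis vector as leading monomial is a pivot. At the start `i = 0`,
so the condition on cleared exponents is void. -/
theorem hasFreeRes_of_noPivot {F : FreeLevel} {N : Submodule A (F.ι → A)}
    (hN : NoPivot P F.deg N) : HasFreeRes P n F N := by
  obtain ⟨r, hr⟩ := exists_isGradedLeftMonomialOrdering P F.deg
  refine hasFreeRes_of_zeroFirst n (i := 0) (Nat.zero_add n) hr ?_ ?_
  · rintro e ⟨x, hx, he⟩
    refine he.1 (hN x hx e ((mem_freeFil P).2 fun s hs => ?_))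
    refine (hr.mdeg_le (he.2 s hs)).trans ?_
    simp [mdeg, P.wdeg_zero]
  · intro s hs
    exact hs

/-! ### Comparison of resolutions -/

/-- `N` is a direct summand of `Q` up to a filtered free module, in a filtered sense. -/
def Linked (P : GradedSolvPolyAlg K A n) (F : FreeLevel) (N : Submodule A (F.ι → A))
    (G : FreeLevel) (Q : Submodule A (G.ι → A)) : Prop :=
  ∃ (f : (F.ι → A) →ₗ[A] (G.ι → A)) (g : (G.ι → A) →ₗ[A] (F.ι → A))
    (s : (F.ι → A) →ₗ[A] (F.ι → A)),
    (∀ q, ∀ x ∈ P.freeFil F.deg q, f x ∈ P.freeFil G.deg q) ∧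
    (∀ q, ∀ x ∈ P.freeFil G.deg q, g x ∈ P.freeFil F.deg q) ∧
    (∀ q, ∀ x ∈ P.freeFil F.deg q, s x ∈ P.freeFil F.deg q) ∧
    (∀ x ∈ N, f x ∈ Q) ∧ (∀ y ∈ Q, g y ∈ N) ∧ (∀ x, s x ∈ N) ∧
    ∀ x ∈ N, g (f x) + s x = x

theorem Linked.refl (F : FreeLevel) (N : Submodule A (F.ι → A)) : Linked P F N F N :=
  ⟨LinearMap.id, LinearMap.id, 0, fun _ _ h => h, fun _ _ h => h,
    fun _ _ _ => Submodule.zero_mem _, fun _ h => h, fun _ h => h, fun _ => N.zero_mem,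
    fun x _ => add_zero x⟩

theorem linearMap_eq_linearCombination {κ M : Type*} [Fintype κ] [AddCommGroup M] [Module A M]
    (h : (κ → A) →ₗ[A] M) (x : κ → A) :
    h x = Fintype.linearCombination A (fun k => h (stdVec A k)) x := by
  conv_lhs => rw [← sum_smul_stdVec x, map_sum]
  simp only [map_smul]
  rfl

/-- Filtered projectivity of free modules: strictness lifts the image of each basis vector within
its own degree. -/
theorem IsStrictCover.exists_lift {F' F H : FreeLevel} {N : Submodule A (F.ι → A)}
    {φ : (F'.ι → A) →ₗ[A] (F.ι → A)} (hφ : IsStrictCover P F' F N φ)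
    (h : (H.ι → A) →ₗ[A] (F.ι → A)) (hN : ∀ x, h x ∈ N)
    (hF : ∀ q, ∀ x ∈ P.freeFil H.deg q, h x ∈ P.freeFil F.deg q) :
    ∃ h' : (H.ι → A) →ₗ[A] (F'.ι → A),
      (∀ q, ∀ x ∈ P.freeFil H.deg q, h' x ∈ P.freeFil F'.deg q) ∧ ∀ x, φ (h' x) = h x := by
  choose y hyF hy using fun k : H.ι => hφ.lift (H.deg k) (h (stdVec A k)) (hN _)
    (hF _ _ (stdVec_mem_freeFil P k))
  refine ⟨Fintype.linearCombination A y, fun q x hx => linearCombination_mem_freeFil hyF hx,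
    fun x => ?_⟩
  rw [linearMap_eq_linearCombination h x, Fintype.linearCombination_apply,
    Fintype.linearCombination_apply, map_sum]
  simp only [map_smul, hy]

/-- The comparison theorem in one step. Lift `f`, `g` and the correction `s` to the covers as $f'$,
$g'$, $h$; the new correction is $\mathrm{id}-g'f'-h\varphi$. It maps into the kernel because $gf+s$
is the identity on `N`, and its last term vanishes on the kernel. -/
theorem Linked.ker {F' F G' G : FreeLevel} {N : Submodule A (F.ι → A)} {Q : Submodule A (G.ι → A)}
    {φ : (F'.ι → A) →ₗ[A] (F.ι → A)} {ψ : (G'.ι → A) →ₗ[A] (G.ι → A)} (h : Linked P F N G Q)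
    (hφ : IsStrictCover P F' F N φ) (hψ : IsStrictCover P G' G Q ψ) :
    Linked P F' (LinearMap.ker φ) G' (LinearMap.ker ψ) := by
  obtain ⟨f, g, s, hfF, hgF, hsF, hfN, hgN, hsN, hfg⟩ := h
  have hφN : ∀ x, φ x ∈ N := fun x => hφ.range ▸ LinearMap.mem_range_self φ x
  have hψN : ∀ x, ψ x ∈ Q := fun x => hψ.range ▸ LinearMap.mem_range_self ψ x
  obtain ⟨f', hf'F, hf'⟩ := hψ.exists_lift (f.comp φ) (fun x => hfN _ (hφN x))
    fun q x hx => hfF q _ (hφ.map_mem q x hx)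
  obtain ⟨g', hg'F, hg'⟩ := hφ.exists_lift (g.comp ψ) (fun x => hgN _ (hψN x))
    fun q x hx => hgF q _ (hψ.map_mem q x hx)
  obtain ⟨h, hhF, hh⟩ := hφ.exists_lift s hsN hsF
  refine ⟨f', g', LinearMap.id - g'.comp f' - h.comp φ, hf'F, hg'F, fun q x hx => ?_,
    fun x hx => ?_, fun y hy => ?_, fun x => ?_, fun x hx => ?_⟩
  · exact Submodule.sub_mem _ (Submodule.sub_mem _ hx (hg'F _ _ (hf'F _ _ hx)))
      (hhF _ _ (hφ.map_mem q x hx))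
  · rw [LinearMap.mem_ker, hf', LinearMap.comp_apply, LinearMap.mem_ker.1 hx, map_zero]
  · rw [LinearMap.mem_ker, hg', LinearMap.comp_apply, LinearMap.mem_ker.1 hy, map_zero]
  · simp only [LinearMap.mem_ker, LinearMap.sub_apply, LinearMap.id_apply, LinearMap.comp_apply,
      map_sub, hg', hf', hh]
    rw [sub_sub, hfg _ (hφN x), sub_self]
  · simp only [LinearMap.sub_apply, LinearMap.id_apply, LinearMap.comp_apply,
      LinearMap.mem_ker.1 hx, map_zero, sub_zero]
    abel

/-- The map `s` is now a filtered projection of the free module onto `N`. Take a nonzero $x\in N$ of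
least degree and write $x=\sum x_i\,s(e_i)$. Where $s(e_i)\ne0$, minimality gives $x\in F_{b_i}$, so
$x_i$ is a scalar, and it vanishes by `NoPivot`; thus $x=0$. -/
theorem Linked.eq_bot {F G : FreeLevel} {N : Submodule A (F.ι → A)}
    (h : Linked P F N G ⊥) (hN : NoPivot P F.deg N) : N = ⊥ := by
  obtain ⟨f, g, s, -, -, hsF, hfN, -, hsN, hfg⟩ := h
  have hs : ∀ x ∈ N, s x = x := fun x hx => by
    have := hfg x hx
    rwa [(Submodule.mem_bot A).1 (hfN x hx), map_zero, zero_add] at this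
  by_contra hne
  obtain ⟨x₀, hx₀, hx₀0⟩ := (Submodule.ne_bot_iff N).1 hne
  obtain ⟨x, ⟨hx, hx0⟩, hmin⟩ := (measure (P.filDeg F.deg)).wf.has_min
    {x | x ∈ N ∧ x ≠ 0} ⟨x₀, hx₀, hx₀0⟩
  refine hx0 ?_
  have hxF := mem_freeFil_filDeg P (b := F.deg) x
  rw [← hs x hx, linearMap_eq_linearCombination s x, Fintype.linearCombination_apply]
  refine Finset.sum_eq_zero fun i _ => ?_
  by_cases hsi : s (stdVec A i) = 0
  · rw [hsi, smul_zero]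
  have h1 : P.filDeg F.deg x ≤ F.deg i :=
    (not_lt.1 (hmin _ ⟨hsN _, hsi⟩)).trans (filDeg_le P (hsF _ _ (stdVec_mem_freeFil P i)))
  have hxi : x ∈ P.freeFil F.deg (F.deg i) := freeFil_mono P h1 hxF
  rw [apply_eq_algebraMap hxi, hN x hx i hxi, map_zero, zero_smul]

end FreeRes

/-! ### Construction of minimal resolutions -/

section Resolution

variable {K A : Type*} [Field K] [Ring A] [Algebra K A] {n : ℕ} {P : GradedSolvPolyAlg K A n}

/-- The complex resolves the submodule `N` of its last term minimally. -/
structure ResolvesMinimally (P : GradedSolvPolyAlg K A n) (F : FreeLevel)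
    (N : Submodule A (F.ι → A)) (C : FilteredFreeComplex A F) : Prop where
  exact_d0 : LinearMap.range C.d0 = N
  exact_d1 : LinearMap.range (C.d 0) = LinearMap.ker C.d0
  exact_d : ∀ i, LinearMap.range (C.d (i + 1)) = LinearMap.ker (C.d i)
  strict_d0 : IsStrictFiltered (P.freeFil (C.lev 0).deg) (P.freeFil F.deg) C.d0
  strict_d : ∀ i,
    IsStrictFiltered (P.freeFil (C.lev (i + 1)).deg) (P.freeFil (C.lev i).deg) (C.d i)
  min_d0 : IsMinimalStandardBasis P (P.freeFil F.deg) N (fun i => C.d0 (stdVec A i))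
  min_d1 : IsMinimalStandardBasis P (P.freeFil (C.lev 0).deg) (LinearMap.ker C.d0)
    (fun i => C.d 0 (stdVec A i))
  min_d : ∀ i, IsMinimalStandardBasis P (P.freeFil (C.lev (i + 1)).deg) (LinearMap.ker (C.d i))
    (fun j => C.d (i + 1) (stdVec A j))

theorem isMinimalStandardBasis_of_isEmpty {ι κ : Type*} [Finite ι] [IsEmpty κ] {b : ι → ℕ}
    {N : Submodule A (ι → A)} (hN : N = ⊥) (v : κ → ι → A) :
    IsMinimalStandardBasis P (P.freeFil b) N v := by
  refine isMinimalStandardBasis_iff.2 ⟨isStandardBasis_iff.2 ⟨inferInstance, fun k => isEmptyElim k,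
    fun q x hx _ => ?_⟩, fun T hT => absurd (Set.eq_univ_of_forall fun k => isEmptyElim k) hT⟩
  rw [hN, Submodule.mem_bot] at hx
  rw [hx]
  exact Submodule.zero_mem _

theorem isStrictFiltered_zero {ι κ : Type*} {b : ι → ℕ} {d : κ → ℕ} :
    IsStrictFiltered (P.freeFil d) (P.freeFil b) (0 : (κ → A) →ₗ[A] (ι → A)) := by
  intro q
  rw [LinearMap.range_zero]
  have : ((0 : (κ → A) →ₗ[A] (ι → A)).restrictScalars K) = 0 := rfl
  rw [this, Submodule.map_zero]
  ext x
  simp +contextual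

theorem resolvesMinimally_zero {F : FreeLevel} {N : Submodule A (F.ι → A)} (hN : N = ⊥) :
    ResolvesMinimally P F N (FilteredFreeComplex.zero A F) := by
  have : ∀ i, IsEmpty ((FilteredFreeComplex.zero A F).lev i).ι := fun i =>
    inferInstanceAs (IsEmpty Empty)
  have hr : ∀ (ι κ : Type) [IsEmpty ι] [IsEmpty κ] (N : Submodule A (ι → A)),
      LinearMap.range (0 : (κ → A) →ₗ[A] (ι → A)) = N := fun ι κ _ _ N =>
    Submodule.ext fun x => by
      rw [Subsingleton.elim x 0]
      simp
  refine ⟨?_, hr _ _ _, fun i => hr _ _ _, isStrictFiltered_zero, fun i => isStrictFiltered_zero,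
    isMinimalStandardBasis_of_isEmpty hN _, isMinimalStandardBasis_of_isEmpty ?_ _,
    fun i => isMinimalStandardBasis_of_isEmpty ?_ _⟩
  · rw [hN]
    exact LinearMap.range_zero
  · exact (Submodule.eq_bot_iff _).2 fun x _ => Subsingleton.elim _ _
  · exact (Submodule.eq_bot_iff _).2 fun x _ => Subsingleton.elim _ _

theorem ResolvesMinimally.cons {F F' : FreeLevel} {N : Submodule A (F.ι → A)}
    {f : (F'.ι → A) →ₗ[A] (F.ι → A)} {C : FilteredFreeComplex A F'}
    (h : ResolvesMinimally P F' (LinearMap.ker f) C) (hf : LinearMap.range f = N)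
    (hs : IsStrictFiltered (P.freeFil F'.deg) (P.freeFil F.deg) f)
    (hm : IsMinimalStandardBasis P (P.freeFil F.deg) N fun i => f (stdVec A i)) :
    ResolvesMinimally P F N (FilteredFreeComplex.cons F' f C) := by
  refine ⟨hf, h.exact_d0, ?_, hs, ?_, hm, h.min_d0, ?_⟩
  · rintro (_ | i)
    · exact h.exact_d1
    · exact h.exact_d i
  · rintro (_ | i)
    · exact h.strict_d0
    · exact h.strict_d i
  · rintro (_ | i)
    · exact h.min_d1
    · exact h.min_d i

theorem FilteredFreeComplex.LengthLE.cons {F F' : FreeLevel} {f : (F'.ι → A) →ₗ[A] (F.ι → A)}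
    {C : FilteredFreeComplex A F'} {k : ℕ} (h : C.LengthLE k) :
    (FilteredFreeComplex.cons F' f C).LengthLE (k + 1) := by
  rintro (_ | i) hi
  · omega
  · exact h i (by omega)

theorem lengthLE_zero (F : FreeLevel) (k : ℕ) :
    (FilteredFreeComplex.zero A F).LengthLE k := fun _ _ => inferInstanceAs (IsEmpty Empty)

theorem ResolvesMinimally.isMinimalFilteredFreeResolution {M : Type*} [AddCommGroup M]
    [Module A M] [Module K M] [IsScalarTower K A M] {FM : ℕ → Submodule K M} {F : FreeLevel}
    {φ : (F.ι → A) →ₗ[A] M} {C : FilteredFreeComplex A F}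
    (h : ResolvesMinimally P F (LinearMap.ker φ) C) (hφ : Function.Surjective φ)
    (hs : IsStrictFiltered (P.freeFil F.deg) FM φ)
    (hm : IsMinimalFBasis P FM fun i => φ (stdVec A i)) :
    IsMinimalFilteredFreeResolution P FM φ C where
  surj := hφ
  exact_d0 := h.exact_d0
  exact_d1 := h.exact_d1
  exact_d := h.exact_d
  strict_φ0 := hs
  strict_d0 := h.strict_d0
  strict_d := h.strict_d
  min_φ0 := hm
  min_d0 := h.min_d0
  min_d1 := h.min_d1
  min_d := h.min_d

theorem IsStrictCover.isStrictFiltered {F F' : FreeLevel} {N : Submodule A (F.ι → A)}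
    {φ : (F'.ι → A) →ₗ[A] (F.ι → A)} (h : IsStrictCover P F' F N φ) :
    IsStrictFiltered (P.freeFil F'.deg) (P.freeFil F.deg) φ := by
  intro q
  apply le_antisymm
  · rintro _ ⟨x, hx, rfl⟩
    exact ⟨LinearMap.mem_range_self φ x, h.map_mem q x hx⟩
  · rintro x ⟨hx, hq⟩
    exact h.lift q x (h.range ▸ hx) hq

theorem linearCombination_stdVec {κ M : Type*} [Fintype κ] [AddCommGroup M] [Module A M]
    (v : κ → M) (k : κ) : Fintype.linearCombination A v (stdVec A k) = v k := by
  rw [stdVec, Fintype.linearCombination_apply_single, one_smul]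

/-! ### The map given by a minimal standard basis -/

section Next

variable {F : FreeLevel} {N : Submodule A (F.ι → A)} {W : List (F.ι → A)}

theorem nextMap_stdVec (k : (nextLevel P F W).ι) :
    nextMap P F W (stdVec A k) = W.get k :=
  linearCombination_stdVec _ _

theorem isStrictCover_nextMap (hW : IsStandardBasis P (P.freeFil F.deg) N W.get) :
    IsStrictCover P (nextLevel P F W) F N (nextMap P F W) :=
  isStrictCover_of_standardBasis (fun _ => rfl) hW

/-- With codomain restricted to `N`, the map sends the basis to a minimal F-basis of `N`, so the
pivot criterion applies to its kernel. -/
theorem noPivot_ker_nextMap (hW : IsMinimalStandardBasis P (P.freeFil F.deg) N W.get) :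
    NoPivot P (nextLevel P F W).deg (LinearMap.ker (nextMap P F W)) := by
  have hc := isStrictCover_nextMap (isMinimalStandardBasis_iff.1 hW).1
  obtain ⟨hWN, hmin⟩ := hW
  have hN : ∀ x, nextMap P F W x ∈ N := fun x => hc.range ▸ LinearMap.mem_range_self _ x
  rw [← LinearMap.ker_codRestrict N (nextMap P F W) hN]
  refine noPivot_of_isMinimalFBasis (FM := subFil K (P.freeFil F.deg) N) (fun q => ?_) ?_
  · apply le_antisymm
    · rintro _ ⟨x, hx, rfl⟩
      exact hc.map_mem q x hx
    · rintro ⟨x, hxN⟩ hx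
      obtain ⟨y, hy, hyx⟩ := hc.lift q x hxN hx
      exact ⟨y, hy, Subtype.ext hyx⟩
  · have e : (fun i => (nextMap P F W).codRestrict N hN (stdVec A i)) =
        fun k : Fin W.length => (⟨W.get k, hWN k⟩ : N) :=
      funext fun k => Subtype.ext (nextMap_stdVec k)
    rw [e]
    exact hmin

end Next

theorem IsSyzygyOutput.ne_zero {ι : Type*} {r : Expo n × ι → Expo n × ι → Prop} {W : List (ι → A)}
    {gens : List ((ι → A) × (Fin W.length → A))} {S : List (Fin W.length → A)}
    (h : IsSyzygyOutput P r W gens S) : ∀ x ∈ S, x ≠ 0 := by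
  obtain ⟨q, f, -, -, rfl⟩ := h
  intro x hx
  simpa using (List.mem_filter.1 hx).2

theorem eq_nil_of_span_eq_bot {M : Type*} [AddCommGroup M] [Module A M] {U : List M}
    (hU : ∀ u ∈ U, u ≠ 0) (h : Submodule.span A {x | x ∈ U} = ⊥) : U = [] :=
  List.eq_nil_iff_forall_not_mem.2 fun u hu => hU u hu <|
    (Submodule.mem_bot A).1 (h ▸ Submodule.subset_span hu)

/-- The current kernel `N` runs parallel to a kernel `Q'` of a resolution of known length; each
round replaces both by kernels of strict covers and preserves the link. When `Q'` reaches zero so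
does `N`, whatever choices the algorithm has made. -/
theorem resolveLoop_of (k : ℕ) : ∀ {F : FreeLevel} {U : List (F.ι → A)} {N : Submodule A (F.ι → A)}
    {G : FreeLevel} {Q' : Submodule A (G.ι → A)} {Q : FilteredFreeComplex A F → Prop},
    (∀ u ∈ U, u ≠ 0) → Submodule.span A {x | x ∈ U} = N → NoPivot P F.deg N → Linked P F N G Q' →
    HasFreeRes P k G Q' → (∀ C, ResolvesMinimally P F N C → C.LengthLE k → Q C) →
    ResolveLoop P k F U Q := by
  have hnil : ∀ {F : FreeLevel} {U : List (F.ι → A)} {N : Submodule A (F.ι → A)},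
      Submodule.span A {x | x ∈ U} = N → U = [] → N = ⊥ := by
    rintro F U N rfl rfl
    simp
  induction k with
  | zero =>
    rintro F U N G Q' Q hU hUN hN hl hQ' hQ
    obtain rfl : Q' = ⊥ := hQ'
    have hN0 := hl.eq_bot hN
    exact ⟨eq_nil_of_span_eq_bot hU (hUN.trans hN0),
      hQ _ (resolvesMinimally_zero hN0) (lengthLE_zero F 0)⟩
  | succ k ih =>
    rintro F U N G Q' Q hU hUN hN hl ⟨G', ψ, hψ, hres⟩ hQ
    refine ⟨fun h0 => hQ _ (resolvesMinimally_zero (hnil hUN h0)) (lengthLE_zero F _),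
      fun _ => ⟨exists_isGradedLeftMonomialOrdering P F.deg, fun r hr => ?_⟩⟩
    refine runMinStdBasis_of hr hU fun W hW => ⟨hW, fun r' hr' => ?_⟩
    rw [hUN] at hW
    have hWs := (isMinimalStandardBasis_iff.1 hW).1
    have hW0 : ∀ w ∈ W, w ≠ 0 := by
      intro w hw
      obtain ⟨j, rfl⟩ := List.get_of_mem hw
      exact ((isStandardBasis_iff.1 hWs).2.1 j).2
    refine runLGB_of hr' hW0 fun G₁ hG₁ => ⟨hG₁.exists_isSyzygyOutput hr', fun U₁ hU₁ => ?_⟩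
    have hspan := hG₁.span_isSyzygyOutput hr' hU₁
    have hcov := isStrictCover_nextMap hWs
    refine ⟨hspan, ih (F := nextLevel P F W) hU₁.ne_zero hspan (noPivot_ker_nextMap hW)
      (hl.ker hcov hψ) hres fun C hC hlen => hQ _ ?_ hlen.cons⟩
    refine hC.cons hcov.range hcov.isStrictFiltered ?_
    have e : (fun i => nextMap P F W (stdVec A i)) = fun k : Fin W.length => W.get k :=
      funext fun k => nextMap_stdVec k
    exact e ▸ hW

/-- Orderings and syzygy lists exist and all runs end, so one sequence of choices can be carried
through. -/
theorem ResolveLoop.exists_complex (k : ℕ) : ∀ {F : FreeLevel} {U : List (F.ι → A)}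
    {Q : FilteredFreeComplex A F → Prop}, ResolveLoop P k F U Q → ∃ C, Q C := by
  induction k with
  | zero => exact fun h => ⟨_, h.2⟩
  | succ k ih =>
    intro F U Q h
    by_cases hU : U = []
    · exact ⟨_, h.1 hU⟩
    · obtain ⟨⟨r, hr⟩, h⟩ := h.2 hU
      obtain ⟨_, h⟩ := (h r hr).exists_final
      obtain ⟨_, -, h⟩ := h.exists_final
      obtain ⟨_, ⟨U₁, hU₁⟩, h⟩ := (h r hr).exists_final
      obtain ⟨C, hC⟩ := ih (h U₁ hU₁).2
      exact ⟨_, hC⟩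

/-- Noetherianity by Dickson's lemma: the minimal leading monomials are finite in number, and
elements realising them generate. -/
theorem exists_list_span {ι : Type*} [Finite ι] (P : GradedSolvPolyAlg K A n)
    (N : Submodule A (ι → A)) :
    ∃ U : List (ι → A), (∀ u ∈ U, u ≠ 0) ∧ Submodule.span A {x | x ∈ U} = N := by
  obtain ⟨r, hr⟩ := exists_isGradedLeftMonomialOrdering P fun _ : ι => 0
  set S := minMonomials (leadSet P r N) with hS
  have : Fintype S := (finite_minMonomials _).fintype
  choose v hvN hv using fun s : S => s.2.1
  refine ⟨(Finset.univ : Finset S).toList.map v, fun u hu => ?_, le_antisymm ?_ fun x hx => ?_⟩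
  · obtain ⟨s, -, rfl⟩ := List.mem_map.1 hu
    exact (freeAdm hr).ne_zero_of_isLeading (hv s)
  · refine Submodule.span_le.2 fun x hx => ?_
    obtain ⟨s, -, rfl⟩ := List.mem_map.1 hx
    exact hvN s
  · have h1 := mem_monoSpan_of_groebner hr hvN hv (fun x hx s hs => by
      obtain ⟨t, ht, hts, hmin⟩ := exists_minimal_mdvd (leadSet P r N) ⟨x, hx, hs⟩
      exact ⟨⟨t, ht, hmin⟩, hts⟩) (D := Set.univ) (fun _ _ _ _ => Set.mem_univ _) hx
      fun _ _ => Set.mem_univ _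
    have h2 : MonomialModule.monoSpan K (fun s : S => s.1) (fun k α => P.basis α • v k) Set.univ ≤
        (Submodule.span A {x | x ∈ (Finset.univ : Finset S).toList.map v}).restrictScalars K := by
      refine Submodule.span_le.2 ?_
      rintro _ ⟨k, α, -, rfl⟩
      have hk : v k ∈ Submodule.span A {x | x ∈ (Finset.univ : Finset S).toList.map v} :=
        Submodule.subset_span (List.mem_map_of_mem (Finset.mem_toList.2 (Finset.mem_univ k)))
      exact Submodule.smul_mem _ (P.basis α) hk
    exact h2 h1

end Resolution

end

end SolvPoly

/-! ### The main theorem -/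

theorem theorem5p7p1 {K A : Type*} [Field K] [Ring A] [Algebra K A] {n : ℕ}
    (P : SolvPoly.GradedSolvPolyAlg K A n) {m : ℕ} (b : Fin m → ℕ)
    (N : Submodule A (Fin m → A)) :
    -- existence
    (∃ (E : Finset (Fin m)) (C : SolvPoly.FilteredFreeComplex A (SolvPoly.subLevel b E)),
      SolvPoly.IsMinimalFilteredFreeResolution P (SolvPoly.quotFil K (P.freeFil b) N)
        (SolvPoly.subMap b N E) C ∧ C.LengthLE n) ∧
    -- the algorithm, for a given list of nonzero generators of `N`
    ∀ U : List (Fin m → A), (∀ u ∈ U, u ≠ 0) → Submodule.span A {x | x ∈ U} = N →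
      (∃ r, SolvPoly.IsGradedLeftMonomialOrdering P b r) ∧
      ∀ r, SolvPoly.IsGradedLeftMonomialOrdering P b r →
        SolvPoly.RunLGB P r U fun G =>
          SolvPoly.IsLeftGroebnerBasis P r N (G.map Prod.fst) ∧
          SolvPoly.IsStandardBasis P (P.freeFil b) N (G.map Prod.fst).get ∧
          SolvPoly.RunMinFB P b (G.map Prod.fst) fun E V =>
            (∀ v ∈ V, v ∈ N ∧ ∀ i, i ∉ E → v i = 0) ∧
            -- the restrictions to `L₀'` of the relations, and the submodule `N'` they generate
            ∀ (V' : List ((SolvPoly.subLevel b E).ι → A))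
              (N' : Submodule A ((SolvPoly.subLevel b E).ι → A)),
              V' = V.map (fun v i => v i.1) → N' = Submodule.span A {x | x ∈ V'} →
              (∃ ψ : (((SolvPoly.subLevel b E).ι → A) ⧸ N') ≃ₗ[A] ((Fin m → A) ⧸ N),
                (∀ x, ψ (N'.mkQ x) = SolvPoly.subMap b N E x) ∧
                SolvPoly.IsStrictFiltered
                  (SolvPoly.quotFil K (P.freeFil (SolvPoly.subLevel b E).deg) N')
                  (SolvPoly.quotFil K (P.freeFil b) N) ψ.toLinearMap) ∧
              SolvPoly.IsMinimalFBasis P (SolvPoly.quotFil K (P.freeFil b) N)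
                (fun i : {i // i ∈ E} => N.mkQ (SolvPoly.stdVec A i.1)) ∧
              SolvPoly.ResolveLoop P n (SolvPoly.subLevel b E) V' fun C =>
                SolvPoly.IsMinimalFilteredFreeResolution P
                  (SolvPoly.quotFil K (P.freeFil b) N) (SolvPoly.subMap b N E) C ∧
                C.LengthLE n := by
  -- Existence follows from the algorithmic part, applied to some finite list of generators and
  -- followed along one run.
  refine and_iff_right_of_imp (fun h => ?_) |>.2 fun U hU hUN => ?_
  · obtain ⟨U, hU, hUN⟩ := SolvPoly.exists_list_span P N
    obtain ⟨⟨r, hr⟩, h⟩ := h U hU hUN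
    obtain ⟨_, -, -, h⟩ := (h r hr).exists_final
    obtain ⟨⟨E, V⟩, -, h⟩ := h.exists_final
    obtain ⟨-, -, h⟩ := h _ _ rfl rfl
    exact ⟨E, h.exists_complex⟩
  · refine ⟨SolvPoly.exists_isGradedLeftMonomialOrdering P b, fun r hr => ?_⟩
    refine SolvPoly.runLGB_of hr hU fun G hG => ?_
    have hgb := hG.isLeftGroebnerBasis hr
    have hsb := hG.isStandardBasis hr
    rw [hUN] at hgb hsb
    refine ⟨hgb, hsb, SolvPoly.runMinFB_of hsb fun E V hV hp => ?_⟩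
    refine ⟨fun v hv => ⟨(hV.mem v hv).1, (hV.mem v hv).2.2⟩, ?_⟩
    rintro V' N' rfl hN'
    have hker := hN'.trans hV.ker_subMap.symm
    refine ⟨hV.exists_equiv hker, hV.isMinimalFBasis hp, ?_⟩
    have hnp := hV.noPivot hp
    -- The comparison starts with the kernel linked to itself, on one side resolved by the algorithm
    -- and on the other by Schreyer's construction.
    refine SolvPoly.resolveLoop_of n (F := SolvPoly.subLevel b E) hV.ne_zero_restrict
      hV.ker_subMap.symm hnp (SolvPoly.Linked.refl _ _) (SolvPoly.hasFreeRes_of_noPivot hnp)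
      fun C hC hlen => ⟨?_, hlen⟩
    exact hC.isMinimalFilteredFreeResolution hV.subMap_surjective hV.strict_subMap
      (SolvPoly.isMinimalFBasis_of_noPivot hV.map_subMap hnp)
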